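/- **Setting.** Fix an arbitrary signature and an arbitrary equational theory $=_E$ on messages: the least congruence, closed under substitution, containing a given set of equations. Messages $M,N,K$ are built from countably many variables $x,y,z,\dots$ by the function symbols. (Mismatch-free) processes are $$P,Q ::= 0 \mid \overline{M}\langle N\rangle.P \mid M(y).P \mid [M=N]P \mid \nu x.P \mid P\,|\,Q \mid P+Q \mid\, !P,$$ taken up to $\alpha$-conversion, where $\nu x.P$ and $M(x).P$ bind $x$ in $P$. Contexts $\mathcal C\{\cdot\}$ are processes with one hole; filling the hole may capture variables. Extended processes in normal form are $\nu\vec x.(\sigma\,|\,P)$, where $\sigma$ is a finite (active) substitution whose domain is fresh for $\vec x$, $P$ and the messages in the range of $\sigma$; a process $P$ is identified with $\mathrm{id}\,|\,P$. The free variables of $\nu\vec x.(\sigma\,|\,P)$ include $\mathrm{dom}(\sigma)$. Parallel composition of extended processes extrudes restrictions, $\nu z.A\,|\,B=\nu z.(A\,|\,B)$ and $B\,|\,\nu z.A=\nu z.(B\,|\,A)$ for $z$ fresh for $B$, and joins active substitutions, $(\sigma\,|\,P)\,|\,(\theta\,|\,Q)=\sigma\cdot\theta\,|\,(P\,|\,Q)$;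 likewise $\rho\,|\,\nu z.A=\nu z.(\rho\,|\,A)$ and $\sigma\,|\,(\theta\,|\,Q)=\sigma\cdot\theta\,|\,Q$. **Late transitions** $A\xrightarrow{\pi}B$ have labels $\pi$ of the form $\tau$, $\overline M(x)$ (bound output) and $M(x)$ (bound input), where $\mathrm{bn}(\overline M(x))=\mathrm{bn}(M(x))=\{x\}$ and $\mathrm{bn}(\tau)=\emptyset$. They are generated by the following rules, together with the symmetric rules for $+$ and $|$. - $M(x).P\xrightarrow{M'(x)}P$ and $\overline M\langle N\rangle.P\xrightarrow{\overline{M'}(x)}\{N/x\}\,|\,P$, if $M=_EM'$ and $x$ is fresh (not free in $M'$ or in the process on the left). - If $P\xrightarrow{\pi}A$, then $P+Q\xrightarrow{\pi}A$; and $[M=N]P\xrightarrow{\pi}A$ if $M=_EN$; and $P\,|\,Q\xrightarrow{\pi}A\,|\,Q$ if $\mathrm{bn}(\pi)\cap\mathrm{fv}(Q)=\emptyset$; and $!P\xrightarrow{\pi}A\,|\,!P$ if $\mathrm{bn}(\pi)\cap\mathrm{fv}(P)=\emptyset$. - If $A\xrightarrow{\pi}B$ and $x$ does not occur in $\pi$,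 then $\nu x.A\xrightarrow{\pi}\nu x.B$. - If $P\xrightarrow{\pi\sigma}A$, and $\mathrm{bn}(\pi)$ meets neither $\mathrm{dom}(\sigma)$ nor $\mathrm{fv}(y\sigma)$ for any $y\notin\mathrm{bn}(\pi)$, then $\sigma\,|\,P\xrightarrow{\pi}\sigma\,|\,A$. - If $P\xrightarrow{\overline M(x)}\nu\vec z.(\{N/x\}\,|\,P')$ and $Q\xrightarrow{M'(x)}Q'$ with $M=_EM'$ and $\vec z\cap\mathrm{fv}(Q)=\emptyset$, then $P\,|\,Q\xrightarrow{\tau}\nu\vec z.(P'\,|\,Q'\{N/x\})$. - If $P\xrightarrow{\overline M(x)}\nu\vec z.(\{N/x\}\,|\,Q)$ and $P\xrightarrow{M'(x)}R$ with $M=_EM'$ and $\vec z\cap\mathrm{fv}(P)=\emptyset$, then $!P\xrightarrow{\tau}\nu\vec z.(Q\,|\,R\{N/x\}\,|\,!P)$. **Histories** are $h::=\epsilon\mid h\cdot x^o\mid h\cdot M^i$. A substitution $\sigma$ *respects* $h$ if, whenever $h=h'\cdot x^o\cdot h''$, we have $x\sigma=x$, and $x\notin\mathrm{fv}(y\sigma)$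 for every $y\in\mathrm{fv}(h')$. The application $A\sigma$ of $\sigma$ to an extended process $A=\nu\vec x.(\theta\,|\,P)$ is capture avoiding and fully applied: with $\vec x$ chosen fresh for $\sigma$, $A\sigma=\nu\vec x.(\theta'\,|\,P\sigma\theta')$, where $\mathrm{dom}(\theta')=\mathrm{dom}(\theta)$ and $\theta'$ is determined entry by entry, in the order in which the messages were output, by $x\theta'=x\theta\sigma\theta'_{x}$, where $\theta'_x$ is the part of $\theta'$ on the variables output before $x$. Extended processes $\nu\vec x.(\sigma\,|\,P)$ and $\nu\vec y.(\theta\,|\,Q)$ are *statically equivalent* if, for all messages $M,N$ with no variable in $\vec x\cup\vec y$, $M\sigma=_EN\sigma$ if and only if $M\theta=_EN\theta$. **Open bisimilarity.** A history-indexed symmetric relation $\mathcal R$ on extended processes in normal form is an *open bisimulation* if, whenever $A\mathrel{\mathcal R^h}B$, for every $x$ fresh for $A$, $B$, $h$: - $A$ and $B$ are statically equivalent; - $A\sigma\mathrel{\mathcal R^{h\sigma}}B\sigma$ for every $\sigma$ respecting $h$; - if $A\xrightarrow{\tau}A'$, then $B\xrightarrow{\tau}B'$ with $A'\mathrel{\mathcal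 R^h}B'$ for some $B'$; - if $A\xrightarrow{\overline M(x)}A'$, then $B\xrightarrow{\overline M(x)}B'$ with $A'\mathrel{\mathcal R^{h\cdot x^o}}B'$ for some $B'$; - if $A\xrightarrow{M(x)}A'$, then $B\xrightarrow{M(x)}B'$ with $A'\mathrel{\mathcal R^{h\cdot x^i}}B'$ for some $B'$. Write $P\sim_oQ$ if $P\mathrel{\mathcal R^{x_1^i\cdots x_n^i}}Q$ for some open bisimulation $\mathcal R$ and some $x_1,\dots,x_n$ with $\mathrm{fv}(P)\cup\mathrm{fv}(Q)\subseteq\{x_1,\dots,x_n\}$. **Theorem.** Open bisimilarity is a congruence for the mismatch-free applied $\pi$-calculus: $\sim_o$ is an equivalence relation on processes, and if $P\sim_oQ$, then $\mathcal C\{P\}\sim_o\mathcal C\{Q\}$ for all contexts $\mathcal C\{\cdot\}$. -/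

import Mathlib

/-! # Mismatch-free applied pi-calculus, late transitions and open bisimilarity

Binders are represented by nested types: a process over the variable type `V` binds a variable by
having a body over `Option V`, where `none` is the bound variable.  Thus alpha-convertible
processes are equal, and substitution is capture avoiding.  The processes and extended processes
of the calculus are those over the countable set `Name` of variables. -/

namespace AppliedPi

universe u

/-- Variables; there is no separate syntactic class of names. -/
abbrev Name : Type := ℕ

/-- A message signature: function symbols with finite arities. -/
structure Signature where
  Op : Type u
  arity : Op → ℕ

/-- Messages over the variables `V`. -/
inductive Term (S : Signature.{u}) (V : Type) : Type u
  | var (x : V) : Term S V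
  | app (f : S.Op) (args : Fin (S.arity f) → Term S V) : Term S V

variable {S : Signature.{u}}

namespace Term

def subst {V W : Type} (σ : V → Term S W) : Term S V → Term S W
  | var x => σ x
  | app f args => app f (fun i => (args i).subst σ)

/-- Renaming of variables. -/
def map {V W : Type} (f : V → W) (M : Term S V) : Term S W :=
  M.subst (fun x => var (f x))

def fv {V : Type} : Term S V → Set V
  | var x => {x}
  | app _ args => {x | ∃ i, x ∈ (args i).fv}

end Term

/-- The equational theory generated by a set `Ax` of equations: the least congruence on messages
that contains all substitution instances of the equations. -/
inductive EqE (Ax : Term S Name → Term S Name → Prop) {V : Type} :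
    Term S V → Term S V → Prop
  | ax {M N : Term S Name} (σ : Name → Term S V) : Ax M N → EqE Ax (M.subst σ) (N.subst σ)
  | refl (M : Term S V) : EqE Ax M M
  | symm {M N : Term S V} : EqE Ax M N → EqE Ax N M
  | trans {M N K : Term S V} : EqE Ax M N → EqE Ax N K → EqE Ax M K
  | congr (f : S.Op) {a b : Fin (S.arity f) → Term S V} :
      (∀ i, EqE Ax (a i) (b i)) → EqE Ax (Term.app f a) (Term.app f b)

/-- A substitution under a binder. -/
def lift {V W : Type} (σ : V → Term S W) : Option V → Term S (Option W)
  | none => Term.var none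
  | some x => (σ x).map some

open Classical in
/-- The substitution of `N` for `x`. -/
noncomputable def single {V : Type} (x : V) (N : Term S V) : V → Term S V :=
  fun y => if y = x then N else Term.var y

/-- The substitution that replaces the outermost bound variable by `N`. -/
def instBound {V : Type} (N : Term S V) : Option V → Term S V
  | none => N
  | some x => Term.var x

open Classical in
/-- The renaming that makes the variable `x` the outermost bound variable. -/
noncomputable def bindName {V : Type} (x : V) : V → Option V :=
  fun y => if y = x then none else some y

/-- `σ` is fresh for the set of variables `env`. -/
def FreshFor {V : Type} (σ : V → Term S V) (env : Set V) : Prop :=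
  (∀ x ∈ env, σ x = Term.var x) ∧ ∀ y, y ∉ env → (σ y).fv ∩ env = ∅

/-- Processes (without mismatch) over the variables `V`. -/
inductive Proc (S : Signature.{u}) : Type → Type (max 1 u)
  | nil {V : Type} : Proc S V
  | out {V : Type} (M N : Term S V) (P : Proc S V) : Proc S V
  | inp {V : Type} (M : Term S V) (P : Proc S (Option V)) : Proc S V
  | mat {V : Type} (M N : Term S V) (P : Proc S V) : Proc S V
  | nu {V : Type} (P : Proc S (Option V)) : Proc S V
  | par {V : Type} (P Q : Proc S V) : Proc S V
  | sum {V : Type} (P Q : Proc S V) : Proc S V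
  | rep {V : Type} (P : Proc S V) : Proc S V

namespace Proc

/-- Capture-avoiding substitution. -/
def subst : {V : Type} → Proc S V → {W : Type} → (V → Term S W) → Proc S W
  | _, nil, _, _ => nil
  | _, out M N P, _, σ => out (M.subst σ) (N.subst σ) (P.subst σ)
  | _, inp M P, _, σ => inp (M.subst σ) (P.subst (lift σ))
  | _, mat M N P, _, σ => mat (M.subst σ) (N.subst σ) (P.subst σ)
  | _, nu P, _, σ => nu (P.subst (lift σ))
  | _, par P Q, _, σ => par (P.subst σ) (Q.subst σ)
  | _, sum P Q, _, σ => sum (P.subst σ) (Q.subst σ)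
  | _, rep P, _, σ => rep (P.subst σ)

/-- Renaming of variables. -/
def map {V W : Type} (f : V → W) (P : Proc S V) : Proc S W :=
  P.subst (fun x => Term.var (f x))

/-- Free variables. -/
def fv : {V : Type} → Proc S V → Set V
  | _, nil => ∅
  | _, out M N P => M.fv ∪ N.fv ∪ P.fv
  | _, inp M P => M.fv ∪ {x | some x ∈ P.fv}
  | _, mat M N P => M.fv ∪ N.fv ∪ P.fv
  | _, nu P => {x | some x ∈ P.fv}
  | _, par P Q => P.fv ∪ Q.fv
  | _, sum P Q => P.fv ∪ Q.fv
  | _, rep P => P.fv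

end Proc

/-- Active substitutions: finite lists of pairs of a variable and a message, the most recently
output message first. -/
abbrev Frame (S : Signature.{u}) (V : Type) : Type u := List (V × Term S V)

namespace Frame

open Classical in
/-- The substitution given by a frame; it is the identity outside the domain. -/
noncomputable def app {V : Type} : Frame S V → V → Term S V
  | [], x => Term.var x
  | (y, N) :: θ, x => if x = y then N else app θ x

def dom {V : Type} (θ : Frame S V) : Set V := {x | ∃ N, (x, N) ∈ θ}

def fv {V : Type} (θ : Frame S V) : Set V :=
  {x | ∃ p ∈ θ, x = p.1 ∨ x ∈ p.2.fv}

/-- Renaming of variables. -/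
def rename {V W : Type} (f : V → W) (θ : Frame S V) : Frame S W :=
  List.map (fun p => (f p.1, p.2.map f)) θ

/-- Application of `σ` to the messages in a frame.  The message `σ x` for a variable `x` may refer
to variables in the domain of the frame (messages output before `x` was received); these are
replaced by the messages they stand for, so that the result is again fully applied. -/
noncomputable def subst {V : Type} (σ : V → Term S V) : Frame S V → Frame S V
  | [] => []
  | (x, M) :: θ => (x, (M.subst σ).subst (app (subst σ θ))) :: subst σ θ

end Frame

/-- Extended processes over the variables `V`: `base θ P` is the process `P` with the active
substitution `θ`, and `nu A` restricts a variable. -/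
inductive Ext (S : Signature.{u}) : Type → Type (max 1 u)
  | base {V : Type} (θ : Frame S V) (P : Proc S V) : Ext S V
  | nu {V : Type} (A : Ext S (Option V)) : Ext S V

namespace Ext

/-- A process as an extended process with the identity active substitution. -/
def ofProc {V : Type} (P : Proc S V) : Ext S V := base [] P

/-- Domain of the active substitution. -/
def dom : {V : Type} → Ext S V → Set V
  | _, base θ _ => θ.dom
  | _, nu A => {x | some x ∈ A.dom}

/-- Free variables, including the domain of the active substitution. -/
def fv : {V : Type} → Ext S V → Set V
  | _, base θ P => θ.fv ∪ P.fv
  | _, nu A => {x | some x ∈ A.fv}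

/-- Normal forms: the domain of the active substitution is fresh for the restricted variables,
the process, and the messages in the active substitution. -/
def Normal : {V : Type} → Ext S V → Prop
  | _, base θ P => (List.map Prod.fst θ).Nodup ∧
      ∀ x ∈ θ.dom, x ∉ P.fv ∧ ∀ y, x ∉ (θ.app y).fv
  | _, nu A => none ∉ A.dom ∧ A.Normal

/-- Renaming of variables. -/
def map : {V : Type} → Ext S V → {W : Type} → (V → W) → Ext S W
  | _, base θ P, _, f => base (θ.rename f) (P.map f)
  | _, nu A, _, f => nu (A.map (Option.map f))

/-- Capture-avoiding application of a substitution to an extended process in normal form; the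
result is fully applied, see `Frame.subst`. -/
noncomputable def subst : {V : Type} → Ext S V → (V → Term S V) → Ext S V
  | _, base θ P, σ => base (θ.subst σ) ((P.subst σ).subst (θ.subst σ).app)
  | _, nu A, σ => nu (A.subst (lift σ))

/-- `A.parR Q` is the parallel composition of `A` (left) and `Q` (right). -/
def parR : {V : Type} → Ext S V → Proc S V → Ext S V
  | _, base θ P, Q => base θ (Proc.par P Q)
  | _, nu A, Q => nu (A.parR (Q.map some))

/-- `A.parL P` is the parallel composition of `P` (left) and `A` (right). -/
def parL : {V : Type} → Ext S V → Proc S V → Ext S V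
  | _, base θ Q, P => base θ (Proc.par P Q)
  | _, nu A, P => nu (A.parL (P.map some))

/-- `A.activate θ` is the composition of the active substitution `θ` with `A`. -/
def activate : {V : Type} → Ext S V → Frame S V → Ext S V
  | _, base θ' P, θ => base (θ' ++ θ) P
  | _, nu A, θ => nu (A.activate (θ.rename some))

/-- If `A` is `ν z₁ … zₖ.({N/x} | P)` then `A.closeL x B` is `ν z₁ … zₖ.(P | B{N/x})`. -/
noncomputable def closeL : {V : Type} → Ext S V → V → Ext S V → Ext S V
  | _, base θ P, x, B => (B.subst (single x (θ.app x))).parL P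
  | _, nu A, x, B => nu (A.closeL (some x) (B.map some))

/-- If `A` is `ν z₁ … zₖ.({N/x} | P)` then `A.closeR x B` is `ν z₁ … zₖ.(B{N/x} | P)`. -/
noncomputable def closeR : {V : Type} → Ext S V → V → Ext S V → Ext S V
  | _, base θ P, x, B => (B.subst (single x (θ.app x))).parR P
  | _, nu A, x, B => nu (A.closeR (some x) (B.map some))

end Ext

/-- Labels of late transitions: progress, bound output and late (bound) input. -/
inductive Label (S : Signature.{u}) (V : Type) : Type u
  | tau : Label S V
  | out (M : Term S V) (x : V) : Label S V
  | inp (M : Term S V) (x : V) : Label S V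

namespace Label

/-- Bound variables of a label. -/
def bn {V : Type} : Label S V → Set V
  | tau => ∅
  | out _ x => {x}
  | inp _ x => {x}

def map {V W : Type} (f : V → W) : Label S V → Label S W
  | tau => tau
  | out M x => out (M.map f) (f x)
  | inp M x => inp (M.map f) (f x)

/-- Application of a substitution to the free part of a label. -/
def subst {V : Type} (σ : V → Term S V) : Label S V → Label S V
  | tau => tau
  | out M x => out (M.subst σ) x
  | inp M x => inp (M.subst σ) x

end Label

/-- Late transitions of processes.  In the rule `res` the label `π.map some` does not mention the
restricted variable `none`. -/
inductive PStep (Ax : Term S Name → Term S Name → Prop) :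
    {V : Type} → Proc S V → Label S V → Ext S V → Prop
  | inp {V : Type} {M M' : Term S V} {P : Proc S (Option V)} {x : V} :
      EqE Ax M M' → x ∉ M'.fv ∪ (Proc.inp M P).fv →
      PStep Ax (Proc.inp M P) (Label.inp M' x) (Ext.ofProc (P.subst (instBound (Term.var x))))
  | out {V : Type} {M M' N : Term S V} {P : Proc S V} {x : V} :
      EqE Ax M M' → x ∉ M'.fv ∪ (Proc.out M N P).fv →
      PStep Ax (Proc.out M N P) (Label.out M' x) (Ext.base [(x, N)] P)
  | sumL {V : Type} {P Q : Proc S V} {π : Label S V} {A : Ext S V} :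
      PStep Ax P π A → PStep Ax (Proc.sum P Q) π A
  | sumR {V : Type} {P Q : Proc S V} {π : Label S V} {A : Ext S V} :
      PStep Ax Q π A → PStep Ax (Proc.sum P Q) π A
  | mat {V : Type} {M N : Term S V} {P : Proc S V} {π : Label S V} {A : Ext S V} :
      EqE Ax M N → PStep Ax P π A → PStep Ax (Proc.mat M N P) π A
  | res {V : Type} {P : Proc S (Option V)} {π : Label S V} {B : Ext S (Option V)} :
      PStep Ax P (π.map some) B → PStep Ax (Proc.nu P) π (Ext.nu B)
  | parL {V : Type} {P Q : Proc S V} {π : Label S V} {A : Ext S V} :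
      PStep Ax P π A → π.bn ∩ Q.fv = ∅ → PStep Ax (Proc.par P Q) π (A.parR Q)
  | parR {V : Type} {P Q : Proc S V} {π : Label S V} {A : Ext S V} :
      PStep Ax Q π A → π.bn ∩ P.fv = ∅ → PStep Ax (Proc.par P Q) π (A.parL P)
  | repAct {V : Type} {P : Proc S V} {π : Label S V} {A : Ext S V} :
      PStep Ax P π A → π.bn ∩ P.fv = ∅ → PStep Ax (Proc.rep P) π (A.parR (Proc.rep P))
  | closeL {V : Type} {P Q : Proc S V} {M M' : Term S V} {x : V} {A B : Ext S V} :
      PStep Ax P (Label.out M x) A → PStep Ax Q (Label.inp M' x) B → EqE Ax M M' →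
      PStep Ax (Proc.par P Q) Label.tau (A.closeL x B)
  | closeR {V : Type} {P Q : Proc S V} {M M' : Term S V} {x : V} {A B : Ext S V} :
      PStep Ax Q (Label.out M x) A → PStep Ax P (Label.inp M' x) B → EqE Ax M M' →
      PStep Ax (Proc.par P Q) Label.tau (A.closeR x B)
  | repClose {V : Type} {P : Proc S V} {M M' : Term S V} {x : V} {A B : Ext S V} :
      PStep Ax P (Label.out M x) A → PStep Ax P (Label.inp M' x) B → EqE Ax M M' →
      PStep Ax (Proc.rep P) Label.tau ((A.closeL x B).parR (Proc.rep P))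

/-- Late transitions of extended processes. -/
inductive EStep (Ax : Term S Name → Term S Name → Prop) :
    {V : Type} → Ext S V → Label S V → Ext S V → Prop
  | act {V : Type} {θ : Frame S V} {P : Proc S V} {π : Label S V} {A : Ext S V} :
      PStep Ax P (π.subst θ.app) A → FreshFor θ.app π.bn →
      EStep Ax (Ext.base θ P) π (A.activate θ)
  | res {V : Type} {A B : Ext S (Option V)} {π : Label S V} :
      EStep Ax A (π.map some) B → EStep Ax (Ext.nu A) π (Ext.nu B)

/-- The messages `M` and `N`, which do not mention the restricted variables of the extended
process, are equal under its active substitution. -/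
def Ext.Equates (Ax : Term S Name → Term S Name → Prop) :
    {V : Type} → Ext S V → Term S V → Term S V → Prop
  | _, Ext.base θ _, M, N => EqE Ax (M.subst θ.app) (N.subst θ.app)
  | _, Ext.nu A, M, N => A.Equates Ax (M.map some) (N.map some)

/-- Static equivalence. -/
def StaticEq (Ax : Term S Name → Term S Name → Prop) {V : Type} (A B : Ext S V) : Prop :=
  ∀ M N : Term S V, A.Equates Ax M N ↔ B.Equates Ax M N

/-- Histories: `out h x` is `h · xᵒ` and `inp h M` is `h · Mⁱ`. -/
inductive History (S : Signature.{u}) : Type u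
  | nil : History S
  | out (h : History S) (x : Name) : History S
  | inp (h : History S) (M : Term S Name) : History S

namespace History

def fv : History S → Set Name
  | nil => ∅
  | out h x => h.fv ∪ {x}
  | inp h M => h.fv ∪ M.fv

/-- `σ` respects the history: for every prefix `h · xᵒ`, `σ` fixes `x`, and `x` does not occur in
`σ y` for any variable `y` of `h`. -/
def Respects (σ : Name → Term S Name) : History S → Prop
  | nil => True
  | out h x => Respects σ h ∧ σ x = Term.var x ∧ ∀ y ∈ h.fv, x ∉ (σ y).fv
  | inp h _ => Respects σ h

/-- Application of a substitution that respects the history. -/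
def subst (σ : Name → Term S Name) : History S → History S
  | nil => nil
  | out h x => out (h.subst σ) x
  | inp h M => inp (h.subst σ) (M.subst σ)

/-- The history `x₁ⁱ · … · xₙⁱ`. -/
def ofInputs (xs : List Name) : History S :=
  xs.foldl (fun h x => inp h (Term.var x)) nil

end History

/-- Open bisimulations: symmetric relations on extended processes in normal form, indexed by
histories. -/
structure IsOpenBisim (Ax : Term S Name → Term S Name → Prop)
    (R : History S → Ext S Name → Ext S Name → Prop) : Prop where
  normal : ∀ {h A B}, R h A B → A.Normal ∧ B.Normal
  symm : ∀ {h A B}, R h A B → R h B A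
  static : ∀ {h A B}, R h A B → StaticEq Ax A B
  subst : ∀ {h A B}, R h A B → ∀ σ : Name → Term S Name, h.Respects σ →
    R (h.subst σ) (A.subst σ) (B.subst σ)
  tau : ∀ {h A B}, R h A B → ∀ A', EStep Ax A Label.tau A' →
    ∃ B', EStep Ax B Label.tau B' ∧ R h A' B'
  out : ∀ {h A B}, R h A B → ∀ M x A', x ∉ A.fv ∪ B.fv ∪ h.fv →
    EStep Ax A (Label.out M x) A' →
    ∃ B', EStep Ax B (Label.out M x) B' ∧ R (h.out x) A' B'
  inp : ∀ {h A B}, R h A B → ∀ M x A', x ∉ A.fv ∪ B.fv ∪ h.fv →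
    EStep Ax A (Label.inp M x) A' →
    ∃ B', EStep Ax B (Label.inp M x) B' ∧ R (h.inp (Term.var x)) A' B'

/-- Open bisimilarity of processes. -/
def OpenBisimilar (Ax : Term S Name → Term S Name → Prop) (P Q : Proc S Name) : Prop :=
  ∃ R : History S → Ext S Name → Ext S Name → Prop, IsOpenBisim Ax R ∧
    ∃ xs : List Name, P.fv ∪ Q.fv ⊆ {x | x ∈ xs} ∧
      R (History.ofInputs xs) (Ext.ofProc P) (Ext.ofProc Q)

/-- Process contexts with one hole.  The binders `inp M x C` and `nu x C` carry the name of the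
bound variable, since they capture that variable in the process put into the hole. -/
inductive Ctx (S : Signature.{u}) : Type (max 1 u)
  | hole : Ctx S
  | out (M N : Term S Name) (C : Ctx S) : Ctx S
  | inp (M : Term S Name) (x : Name) (C : Ctx S) : Ctx S
  | mat (M N : Term S Name) (C : Ctx S) : Ctx S
  | nu (x : Name) (C : Ctx S) : Ctx S
  | parL (C : Ctx S) (R : Proc S Name) : Ctx S
  | parR (R : Proc S Name) (C : Ctx S) : Ctx S
  | sumL (C : Ctx S) (R : Proc S Name) : Ctx S
  | sumR (R : Proc S Name) (C : Ctx S) : Ctx S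
  | rep (C : Ctx S) : Ctx S

/-- The process obtained by putting `P` into the hole. -/
noncomputable def Ctx.fill (P : Proc S Name) : Ctx S → Proc S Name
  | hole => P
  | out M N C => Proc.out M N (C.fill P)
  | inp M x C => Proc.inp M ((C.fill P).map (bindName x))
  | mat M N C => Proc.mat M N (C.fill P)
  | nu x C => Proc.nu ((C.fill P).map (bindName x))
  | parL C R => Proc.par (C.fill P) R
  | parR R C => Proc.par R (C.fill P)
  | sumL C R => Proc.sum (C.fill P) R
  | sumR R C => Proc.sum R (C.fill P)
  | rep C => Proc.rep (C.fill P)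

end AppliedPi

/-! Let `Bis` be the least relation on well-formed extended processes that contains every open
bisimulation and is closed under the operators of the calculus, together with the operations that
appear when processes run in parallel with an environment. By construction it is compatible with
contexts, and it is reflexive on well-formed processes, symmetric and transitive. The theorem
therefore reduces to `Bis` being an open bisimulation. Its three substantial clauses are proved by
rule induction: `Bis.static`, `Bis.subst` and `Bis.sim`.

The main case is `A.env b Q`: an environment `Q`, written with recipes over the known variables of
`A`, including its output variables, and evaluated by the active substitution of `A`. By
`Ext.env_step`, a transition of the composition is a move of `A`, a move of `Q`, or a communication
in one of the two directions, and `Sim.env` transports each to a bisimilar `B`.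

Moves of `Q` depend on the active substitution only through equations between recipes. Static
equivalence says that those of `A` hold for `B`, and without mismatch all tests are positive, so the
whole derivation carries over (`RStep.transfer`). If the environment emits a message, its recipe
becomes a new entry of both active substitutions (`Bis.recipe`). If `A` sends to `Q`, then `A` makes
a bound output of a fresh variable, `Q` receives that variable, and the variable is hidden
afterwards (`Bis.hide`). If `Q` sends to `A`, then `A` makes a late input of a fresh variable, for
which the message is substituted; the substitution clause of open bisimulations covers this.
Restrictions opened by `A` and `Q` interleave, which `Mix` and `NuAt` keep track of. Replication
uses the same facts with one component replaced at a time, the steps being joined by transitivity.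

To let one derivation of `Q` serve several active substitutions, transitions are recast as `RStep`:
labels carry no bound variable, tests are evaluated under a substitution `θ`, and results are left
unsubstituted. Histories are reduced to `Hy`, the sets of known variables together with the order of
the outputs. -/

namespace AppliedPi

universe u

variable {S : Signature.{u}}

/-! ### Messages -/

namespace Term

variable {U V W : Type}

@[simp] theorem subst_var_apply (σ : V → Term S W) (x : V) : (var x : Term S V).subst σ = σ x := rfl

theorem subst_subst (σ : V → Term S W) (τ : W → Term S U) (M : Term S V) :
    (M.subst σ).subst τ = M.subst (fun x => (σ x).subst τ) := by
  induction M with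
  | var x => rfl
  | app f a ih => simp only [subst, ih]

@[simp] theorem subst_var (M : Term S V) : M.subst var = M := by
  induction M with
  | var x => rfl
  | app f a ih => simp only [subst, ih]

theorem subst_congr {σ τ : V → Term S W} {M : Term S V} (h : ∀ x ∈ M.fv, σ x = τ x) :
    M.subst σ = M.subst τ := by
  induction M with
  | var x => exact h x rfl
  | app f a ih =>
    simp only [subst, app.injEq, heq_eq_eq, true_and]
    funext i
    exact ih i fun x hx => h x ⟨i, hx⟩

theorem subst_eq_self {σ : V → Term S V} {M : Term S V} (h : ∀ x ∈ M.fv, σ x = var x) :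
    M.subst σ = M := by
  rw [subst_congr h]; exact subst_var M

theorem mem_fv_subst {σ : V → Term S W} {M : Term S V} {x : W} :
    x ∈ (M.subst σ).fv ↔ ∃ y ∈ M.fv, x ∈ (σ y).fv := by
  induction M with
  | var y => simp [fv, subst]
  | app f a ih =>
    simp only [fv, subst, Set.mem_ofPred_eq, ih]
    constructor
    · rintro ⟨i, y, hy, hx⟩; exact ⟨y, ⟨i, hy⟩, hx⟩
    · rintro ⟨y, ⟨i, hy⟩, hx⟩; exact ⟨i, y, hy, hx⟩

@[simp] theorem mem_fv_var {x y : V} : x ∈ (var y : Term S V).fv ↔ x = y := Iff.rfl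

theorem fv_finite (M : Term S V) : M.fv.Finite := by
  induction M with
  | var x => exact Set.finite_singleton x
  | app f a ih =>
    have : (app f a).fv = ⋃ i, (a i).fv := by ext; simp [fv]
    rw [this]
    exact Set.finite_iUnion ih

theorem mem_fv_map {f : V → W} {M : Term S V} {x : W} : x ∈ (M.map f).fv ↔ ∃ y ∈ M.fv, x = f y := by
  simp [map, mem_fv_subst]

theorem map_mem_fv_map {f : V → W} (hf : f.Injective) {M : Term S V} {x : V} :
    f x ∈ (M.map f).fv ↔ x ∈ M.fv := by
  rw [mem_fv_map]
  exact ⟨fun ⟨y, hy, h⟩ => hf h ▸ hy, fun h => ⟨x, h, rfl⟩⟩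

@[simp] theorem some_mem_fv_map {M : Term S V} {x : V} : some x ∈ (M.map some).fv ↔ x ∈ M.fv :=
  map_mem_fv_map (Option.some_injective V)

@[simp] theorem none_notMem_fv_map {M : Term S V} : none ∉ (M.map some).fv := by
  simp [mem_fv_map]

@[simp] theorem map_var (f : V → W) (x : V) : (var x : Term S V).map f = var (f x) := rfl

theorem subst_map (σ : V → Term S W) (f : W → U) (M : Term S V) :
    (M.subst σ).map f = M.subst (fun x => (σ x).map f) := subst_subst _ _ _

theorem map_subst (f : V → W) (σ : W → Term S U) (M : Term S V) :
    (M.map f).subst σ = M.subst (fun x => σ (f x)) := subst_subst _ _ _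

theorem map_map (f : V → W) (g : W → U) (M : Term S V) :
    (M.map f).map g = M.map (fun x => g (f x)) := subst_subst _ _ _

end Term

/-! ### Substitutions under a binder. -/

section Lift

variable {U V W : Type}

@[simp] theorem lift_none (σ : V → Term S W) : lift σ none = Term.var none := rfl

@[simp] theorem lift_some (σ : V → Term S W) (x : V) : lift σ (some x) = (σ x).map some := rfl

theorem lift_subst (σ : V → Term S W) (τ : W → Term S U) :
    (fun x => (lift σ x).subst (lift τ)) = lift (fun x => (σ x).subst τ) := by
  funext x
  cases x with
  | none => rfl
  | some x => simp [Term.map_subst, Term.subst_map]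

@[simp] theorem lift_var : lift (Term.var : V → Term S V) = Term.var := by
  funext x
  cases x <;> rfl

theorem lift_var_comp (f : V → W) :
    lift (fun x => (Term.var (f x) : Term S W)) = fun x => Term.var (Option.map f x) := by
  funext x
  cases x <;> rfl

theorem some_mem_fv_lift {σ : V → Term S W} {x : W} {y : Option V} :
    some x ∈ (lift σ y).fv ↔ ∃ z, y = some z ∧ x ∈ (σ z).fv := by
  cases y <;> simp

theorem none_mem_fv_lift {σ : V → Term S W} {y : Option V} :
    none ∈ (lift σ y).fv ↔ y = none := by
  cases y <;> simp

end Lift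

/-! ### Processes -/

namespace Proc

variable {U V W : Type}

theorem subst_subst (P : Proc S V) (σ : V → Term S W) (τ : W → Term S U) :
    (P.subst σ).subst τ = P.subst (fun x => (σ x).subst τ) := by
  induction P generalizing W U with
  | nil => rfl
  | out M N P ih => simp only [subst, Term.subst_subst, ih]
  | inp M P ih => simp only [subst, Term.subst_subst, ih, lift_subst]
  | mat M N P ih => simp only [subst, Term.subst_subst, ih]
  | nu P ih => simp only [subst, ih, lift_subst]
  | par P Q ih1 ih2 => simp only [subst, ih1, ih2]
  | sum P Q ih1 ih2 => simp only [subst, ih1, ih2]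
  | rep P ih => simp only [subst, ih]

@[simp] theorem subst_var (P : Proc S V) : P.subst Term.var = P := by
  induction P with
  | nil => rfl
  | out M N P ih => simp only [subst, Term.subst_var, ih]
  | inp M P ih => simp only [subst, Term.subst_var, ih, lift_var]
  | mat M N P ih => simp only [subst, Term.subst_var, ih]
  | nu P ih => simp only [subst, ih, lift_var]
  | par P Q ih1 ih2 => simp only [subst, ih1, ih2]
  | sum P Q ih1 ih2 => simp only [subst, ih1, ih2]
  | rep P ih => simp only [subst, ih]

theorem lift_congr {σ τ : V → Term S W} {A : Set (Option V)}
    (h : ∀ x, some x ∈ A → σ x = τ x) : ∀ x ∈ A, lift σ x = lift τ x := by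
  intro x hx
  cases x with
  | none => rfl
  | some x => simp [h x hx]

theorem subst_congr {σ τ : V → Term S W} {P : Proc S V} (h : ∀ x ∈ P.fv, σ x = τ x) :
    P.subst σ = P.subst τ := by
  induction P generalizing W with
  | nil => rfl
  | out M N P ih =>
    simp only [subst, Term.subst_congr fun x hx => h x (Or.inl (Or.inl hx)),
      Term.subst_congr fun x hx => h x (Or.inl (Or.inr hx)), ih fun x hx => h x (Or.inr hx)]
  | inp M P ih =>
    simp only [subst, Term.subst_congr fun x hx => h x (Or.inl hx),
      ih (lift_congr fun x hx => h x (Or.inr hx))]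
  | mat M N P ih =>
    simp only [subst, Term.subst_congr fun x hx => h x (Or.inl (Or.inl hx)),
      Term.subst_congr fun x hx => h x (Or.inl (Or.inr hx)), ih fun x hx => h x (Or.inr hx)]
  | nu P ih => simp only [subst, ih (lift_congr fun x hx => h x hx)]
  | par P Q ih1 ih2 =>
    simp only [subst, ih1 fun x hx => h x (Or.inl hx), ih2 fun x hx => h x (Or.inr hx)]
  | sum P Q ih1 ih2 =>
    simp only [subst, ih1 fun x hx => h x (Or.inl hx), ih2 fun x hx => h x (Or.inr hx)]
  | rep P ih => simp only [subst, ih h]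

theorem some_mem_fv_subst_lift {σ : V → Term S W} {A : Set (Option V)} {x : W} :
    (∃ y ∈ A, some x ∈ (lift σ y).fv) ↔ ∃ y, some y ∈ A ∧ x ∈ (σ y).fv := by
  constructor
  · rintro ⟨y, hy, hx⟩
    obtain ⟨z, rfl, hz⟩ := some_mem_fv_lift.1 hx
    exact ⟨z, hy, hz⟩
  · rintro ⟨y, hy, hx⟩
    exact ⟨some y, hy, by simpa using hx⟩

theorem mem_fv_subst {σ : V → Term S W} {P : Proc S V} {x : W} :
    x ∈ (P.subst σ).fv ↔ ∃ y ∈ P.fv, x ∈ (σ y).fv := by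
  induction P generalizing W with
  | nil => simp [subst, fv]
  | out M N P ih =>
    simp only [subst, fv, Set.mem_union, Term.mem_fv_subst, ih, or_and_right, exists_or]
  | inp M P ih =>
    simp only [subst, fv, Set.mem_union, Term.mem_fv_subst, Set.mem_ofPred_eq, ih,
      some_mem_fv_subst_lift, or_and_right, exists_or]
  | mat M N P ih =>
    simp only [subst, fv, Set.mem_union, Term.mem_fv_subst, ih, or_and_right, exists_or]
  | nu P ih => simp only [subst, fv, Set.mem_ofPred_eq, ih, some_mem_fv_subst_lift]
  | par P Q ih1 ih2 => simp only [subst, fv, Set.mem_union, ih1, ih2, or_and_right, exists_or]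
  | sum P Q ih1 ih2 => simp only [subst, fv, Set.mem_union, ih1, ih2, or_and_right, exists_or]
  | rep P ih => simp only [subst, fv, ih]

theorem fv_finite (P : Proc S V) : P.fv.Finite := by
  have key : ∀ {V : Type} {A : Set (Option V)}, A.Finite → {x | some x ∈ A}.Finite :=
    fun h => h.preimage (Option.some_injective _).injOn
  induction P with
  | nil => exact Set.finite_empty
  | out M N P ih => exact (M.fv_finite.union N.fv_finite).union ih
  | inp M P ih => exact M.fv_finite.union (key ih)
  | mat M N P ih => exact (M.fv_finite.union N.fv_finite).union ih
  | nu P ih => exact key ih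
  | par P Q ih1 ih2 => exact ih1.union ih2
  | sum P Q ih1 ih2 => exact ih1.union ih2
  | rep P ih => exact ih

theorem mem_fv_map {f : V → W} {P : Proc S V} {x : W} : x ∈ (P.map f).fv ↔ ∃ y ∈ P.fv, x = f y := by
  simp [map, mem_fv_subst]

theorem map_mem_fv_map {f : V → W} (hf : f.Injective) {P : Proc S V} {x : V} :
    f x ∈ (P.map f).fv ↔ x ∈ P.fv := by
  rw [mem_fv_map]
  exact ⟨fun ⟨y, hy, h⟩ => hf h ▸ hy, fun h => ⟨x, h, rfl⟩⟩

@[simp] theorem some_mem_fv_map {P : Proc S V} {x : V} : some x ∈ (P.map some).fv ↔ x ∈ P.fv :=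
  map_mem_fv_map (Option.some_injective V)

theorem subst_map (σ : V → Term S W) (f : W → U) (P : Proc S V) :
    (P.subst σ).map f = P.subst (fun x => (σ x).map f) := subst_subst _ _ _

theorem map_subst (f : V → W) (σ : W → Term S U) (P : Proc S V) :
    (P.map f).subst σ = P.subst (fun x => σ (f x)) := subst_subst _ _ _

theorem map_map (f : V → W) (g : W → U) (P : Proc S V) :
    (P.map f).map g = P.map (fun x => g (f x)) := subst_subst _ _ _

/-- Parallel composition; `P` is on the left if `b` is true. -/
def pr (b : Bool) (P Q : Proc S V) : Proc S V :=
  match b with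
  | true => par P Q
  | false => par Q P

@[simp] theorem pr_subst (b : Bool) (P Q : Proc S V) (σ : V → Term S W) :
    (pr b P Q).subst σ = pr b (P.subst σ) (Q.subst σ) := by cases b <;> rfl

@[simp] theorem pr_map (b : Bool) (P Q : Proc S V) (f : V → W) :
    (pr b P Q).map f = pr b (P.map f) (Q.map f) := pr_subst _ _ _ _

@[simp] theorem mem_fv_pr {b : Bool} {P Q : Proc S V} {x : V} :
    x ∈ (pr b P Q).fv ↔ x ∈ P.fv ∨ x ∈ Q.fv := by
  cases b <;> simp [pr, fv, or_comm]

theorem pr_not (b : Bool) (P Q : Proc S V) : pr (!b) P Q = pr b Q P := by cases b <;> rfl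

end Proc

/-! ### Equational theory -/

section EqE

variable {Ax : Term S Name → Term S Name → Prop} {V W : Type}

theorem EqE.subst {M N : Term S V} (h : EqE Ax M N) (σ : V → Term S W) :
    EqE Ax (M.subst σ) (N.subst σ) := by
  induction h with
  | ax τ h => rw [Term.subst_subst, Term.subst_subst]; exact EqE.ax _ h
  | refl M => exact EqE.refl _
  | symm _ ih => exact ih.symm
  | trans _ _ ih1 ih2 => exact ih1.trans ih2
  | congr f _ ih => exact EqE.congr f ih

theorem EqE.map {M N : Term S V} (h : EqE Ax M N) (f : V → W) : EqE Ax (M.map f) (N.map f) :=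
  h.subst _

/-- A left inverse of `f` is again a renaming, and equations are stable under renaming. `Nonempty V`
provides the values of the left inverse outside the range of `f`. -/
theorem EqE.map_iff {f : V → W} (hf : f.Injective) [Nonempty V] {M N : Term S V} :
    EqE Ax (M.map f) (N.map f) ↔ EqE Ax M N := by
  refine ⟨fun h => ?_, fun h => h.map f⟩
  have key (K : Term S V) : (K.map f).map (Function.invFun f) = K := by
    rw [Term.map_map]
    exact Term.subst_eq_self fun x _ => congrArg Term.var (Function.leftInverse_invFun hf x)
  have := h.map (Function.invFun f)
  rwa [key, key] at this

end EqE

/-! ### Nameless symbolic transitions -/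

/-- Labels without bound variable. -/
inductive NLab (S : Signature.{u}) (V : Type) : Type u
  | tau : NLab S V
  | out (M : Term S V) : NLab S V
  | inp (M : Term S V) : NLab S V

namespace NLab

variable {U V W : Type}

def subst (σ : V → Term S W) : NLab S V → NLab S W
  | tau => tau
  | out M => out (M.subst σ)
  | inp M => inp (M.subst σ)

def map (f : V → W) (κ : NLab S V) : NLab S W := κ.subst (fun x => Term.var (f x))

def fv : NLab S V → Set V
  | tau => ∅
  | out M => M.fv
  | inp M => M.fv

@[simp] theorem map_tau (f : V → W) : (tau : NLab S V).map f = tau := rfl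
@[simp] theorem map_out (f : V → W) (M : Term S V) : (out M).map f = out (M.map f) := rfl
@[simp] theorem map_inp (f : V → W) (M : Term S V) : (inp M).map f = inp (M.map f) := rfl
@[simp] theorem subst_tau (σ : V → Term S W) : (tau : NLab S V).subst σ = tau := rfl
@[simp] theorem subst_out (σ : V → Term S W) (M : Term S V) :
    (out M).subst σ = out (M.subst σ) := rfl
@[simp] theorem subst_inp (σ : V → Term S W) (M : Term S V) :
    (inp M).subst σ = inp (M.subst σ) := rfl

theorem subst_subst (σ : V → Term S W) (τ : W → Term S U) (κ : NLab S V) :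
    (κ.subst σ).subst τ = κ.subst (fun x => (σ x).subst τ) := by
  cases κ <;> simp [Term.subst_subst]

@[simp] theorem subst_var (κ : NLab S V) : κ.subst Term.var = κ := by
  cases κ <;> simp

theorem map_subst (f : V → W) (σ : W → Term S U) (κ : NLab S V) :
    (κ.map f).subst σ = κ.subst (fun x => σ (f x)) := subst_subst _ _ _

theorem subst_map (σ : V → Term S W) (f : W → U) (κ : NLab S V) :
    (κ.subst σ).map f = κ.subst (fun x => (σ x).map f) := subst_subst _ _ _

theorem map_map (f : V → W) (g : W → U) (κ : NLab S V) :
    (κ.map f).map g = κ.map (fun x => g (f x)) := subst_subst _ _ _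

theorem mem_fv_subst {σ : V → Term S W} {κ : NLab S V} {x : W} :
    x ∈ (κ.subst σ).fv ↔ ∃ y ∈ κ.fv, x ∈ (σ y).fv := by
  cases κ <;> simp [fv, Term.mem_fv_subst]

theorem mem_fv_map {f : V → W} {κ : NLab S V} {x : W} :
    x ∈ (κ.map f).fv ↔ ∃ y ∈ κ.fv, x = f y := by
  simp [map, mem_fv_subst]

theorem map_mem_fv_map {f : V → W} (hf : f.Injective) {κ : NLab S V} {x : V} :
    f x ∈ (κ.map f).fv ↔ x ∈ κ.fv := by
  rw [mem_fv_map]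
  exact ⟨fun ⟨y, hy, h⟩ => hf h ▸ hy, fun h => ⟨x, h, rfl⟩⟩

theorem fv_finite (κ : NLab S V) : κ.fv.Finite := by
  cases κ with
  | tau => exact Set.finite_empty
  | out M => exact M.fv_finite
  | inp M => exact M.fv_finite

/-- Equality of labels up to the equational theory. -/
inductive Eqv (Ax : Term S Name → Term S Name → Prop) : NLab S V → NLab S V → Prop
  | tau : Eqv Ax tau tau
  | out {M N : Term S V} : EqE Ax M N → Eqv Ax (out M) (out N)
  | inp {M N : Term S V} : EqE Ax M N → Eqv Ax (inp M) (inp N)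

variable {Ax : Term S Name → Term S Name → Prop}

theorem Eqv.refl (κ : NLab S V) : Eqv Ax κ κ := by
  cases κ
  · exact .tau
  · exact .out (.refl _)
  · exact .inp (.refl _)

theorem Eqv.subst {κ μ : NLab S V} (h : Eqv Ax κ μ) (σ : V → Term S W) :
    Eqv Ax (κ.subst σ) (μ.subst σ) := by
  cases h with
  | tau => exact .tau
  | out h => exact .out (h.subst σ)
  | inp h => exact .inp (h.subst σ)

end NLab

/-- The result of a transition below the restrictions: a process, a message with a process, or a
process with an input variable. -/
inductive Body (S : Signature.{u}) (V : Type) : Type (max 1 u)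
  | tau (P : Proc S V) : Body S V
  | out (N : Term S V) (P : Proc S V) : Body S V
  | inp (P : Proc S (Option V)) : Body S V

namespace Body

variable {U V W : Type}

def subst (σ : V → Term S W) : Body S V → Body S W
  | tau P => tau (P.subst σ)
  | out N P => out (N.subst σ) (P.subst σ)
  | inp P => inp (P.subst (lift σ))

def fv : Body S V → Set V
  | tau P => P.fv
  | out N P => N.fv ∪ P.fv
  | inp P => {x | some x ∈ P.fv}

/-- Parallel composition with a process. -/
def par (b : Bool) (Q : Proc S V) : Body S V → Body S V
  | tau P => tau (Proc.pr b P Q)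
  | out N P => out N (Proc.pr b P Q)
  | inp P => inp (Proc.pr b P (Q.map some))

theorem subst_subst (σ : V → Term S W) (τ : W → Term S U) (c : Body S V) :
    (c.subst σ).subst τ = c.subst (fun x => (σ x).subst τ) := by
  cases c <;> simp [subst, Term.subst_subst, Proc.subst_subst, lift_subst]

theorem mem_fv_subst {σ : V → Term S W} {c : Body S V} {x : W} :
    x ∈ (c.subst σ).fv ↔ ∃ y ∈ c.fv, x ∈ (σ y).fv := by
  cases c with
  | tau P => exact Proc.mem_fv_subst
  | out N P =>
    simp only [subst, fv, Set.mem_union, Proc.mem_fv_subst, Term.mem_fv_subst, or_and_right,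
      exists_or]
  | inp P =>
    simp only [subst, fv, Set.mem_ofPred_eq, Proc.mem_fv_subst, Proc.some_mem_fv_subst_lift]

@[simp] theorem subst_var (c : Body S V) : c.subst Term.var = c := by
  cases c <;> simp [subst]

theorem mem_fv_par {b : Bool} {Q : Proc S V} {c : Body S V} {x : V} :
    x ∈ (c.par b Q).fv ↔ x ∈ c.fv ∨ x ∈ Q.fv := by
  cases c <;> simp [par, fv, or_assoc]

theorem par_subst (b : Bool) (Q : Proc S V) (c : Body S V) (σ : V → Term S W) :
    (c.par b Q).subst σ = (c.subst σ).par b (Q.subst σ) := by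
  cases c <;> simp [par, subst, Proc.map_subst, Proc.subst_map]

end Body

/-- Results of transitions, with restrictions. -/
inductive Con (S : Signature.{u}) : Type → Type (max 1 u)
  | base {V : Type} (c : Body S V) : Con S V
  | nu {V : Type} (C : Con S (Option V)) : Con S V

namespace Con

variable {U V W : Type}

def subst : {V : Type} → Con S V → {W : Type} → (V → Term S W) → Con S W
  | _, base c, _, σ => base (c.subst σ)
  | _, nu C, _, σ => nu (C.subst (lift σ))

def map (f : V → W) (C : Con S V) : Con S W := C.subst (fun x => Term.var (f x))

def fv : {V : Type} → Con S V → Set V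
  | _, base c => c.fv
  | _, nu C => {x | some x ∈ C.fv}

/-- Parallel composition with a process, which is on the right if `b` is true. -/
def par (b : Bool) : {V : Type} → Con S V → Proc S V → Con S V
  | _, base c, Q => base (c.par b Q)
  | _, nu C, Q => nu (C.par b (Q.map some))

/-- Passing a message `N` to an input, in parallel with the process `P`. -/
def recv (b : Bool) : {V : Type} → Con S V → Term S V → Proc S V → Con S V
  | _, base (Body.inp Q), N, P => base (Body.tau (Proc.pr b P (Q.subst (instBound N))))
  -- A default value for results that are not inputs. Communications never reach it, by
  -- `RStep.fits`.
  | _, base _, _, _ => base (Body.tau Proc.nil)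
  | _, nu C, N, P => nu (C.recv b (N.map some) (P.map some))

/-- Communication of an output with an input. -/
def close (b : Bool) : {V : Type} → Con S V → Con S V → Con S V
  | _, base (Body.out N P), B => B.recv b N P
  | _, base _, _ => base (Body.tau Proc.nil)
  | _, nu A, B => nu (A.close b (B.map some))

theorem subst_subst (C : Con S V) (σ : V → Term S W) (τ : W → Term S U) :
    (C.subst σ).subst τ = C.subst (fun x => (σ x).subst τ) := by
  induction C generalizing W U with
  | base c => simp only [subst, Body.subst_subst]
  | nu C ih => simp only [subst, ih, lift_subst]

@[simp] theorem subst_var (C : Con S V) : C.subst Term.var = C := by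
  induction C with
  | base c => simp [subst]
  | nu C ih => simp [subst, ih]

theorem mem_fv_subst {σ : V → Term S W} {C : Con S V} {x : W} :
    x ∈ (C.subst σ).fv ↔ ∃ y ∈ C.fv, x ∈ (σ y).fv := by
  induction C generalizing W with
  | base c => exact Body.mem_fv_subst
  | nu C ih => simp only [subst, fv, Set.mem_ofPred_eq, ih, Proc.some_mem_fv_subst_lift]

theorem mem_fv_map {f : V → W} {C : Con S V} {x : W} :
    x ∈ (C.map f).fv ↔ ∃ y ∈ C.fv, x = f y := by
  simp [map, mem_fv_subst]

@[simp] theorem some_mem_fv_map {C : Con S V} {x : V} : some x ∈ (C.map some).fv ↔ x ∈ C.fv := by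
  simp [mem_fv_map]

theorem map_subst (f : V → W) (σ : W → Term S U) (C : Con S V) :
    (C.map f).subst σ = C.subst (fun x => σ (f x)) := subst_subst _ _ _

theorem subst_map (σ : V → Term S W) (f : W → U) (C : Con S V) :
    (C.subst σ).map f = C.subst (fun x => (σ x).map f) := subst_subst _ _ _

theorem map_map (f : V → W) (g : W → U) (C : Con S V) :
    (C.map f).map g = C.map (fun x => g (f x)) := subst_subst _ _ _

theorem map_nu (f : V → W) (C : Con S (Option V)) : (nu C).map f = nu (C.map (Option.map f)) := by
  simp only [map, subst, lift_var_comp]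

theorem mem_fv_par {b : Bool} {Q : Proc S V} {C : Con S V} {x : V} :
    x ∈ (C.par b Q).fv ↔ x ∈ C.fv ∨ x ∈ Q.fv := by
  induction C with
  | base c => exact Body.mem_fv_par
  | nu C ih => simp [par, fv, ih]

theorem par_subst (b : Bool) (Q : Proc S V) (C : Con S V) (σ : V → Term S W) :
    (C.par b Q).subst σ = (C.subst σ).par b (Q.subst σ) := by
  induction C generalizing W with
  | base c => simp only [par, subst, Body.par_subst]
  | nu C ih => simp [par, subst, ih, Proc.map_subst, Proc.subst_map]

theorem instBound_subst (N : Term S V) (σ : V → Term S W) :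
    (fun x => (instBound N x).subst σ) = fun x => (lift σ x).subst (instBound (N.subst σ)) := by
  funext x
  cases x with
  | none => rfl
  | some x =>
    simp only [instBound, lift_some, Term.map_subst]
    exact (Term.subst_var _).symm

theorem recv_subst (b : Bool) (N : Term S V) (P : Proc S V) (C : Con S V) (σ : V → Term S W) :
    (C.recv b N P).subst σ = (C.subst σ).recv b (N.subst σ) (P.subst σ) := by
  induction C generalizing W with
  | base c =>
    cases c with
    | inp Q => simp [recv, subst, Body.subst, Proc.subst_subst, instBound_subst]
    | _ => rfl
  | nu C ih => simp [recv, subst, ih, Proc.map_subst, Proc.subst_map, Term.map_subst, Term.subst_map]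

theorem close_subst (b : Bool) (A B : Con S V) (σ : V → Term S W) :
    (A.close b B).subst σ = (A.subst σ).close b (B.subst σ) := by
  induction A generalizing W with
  | base c =>
    cases c with
    | out N P => simp [close, subst, Body.subst, recv_subst]
    | _ => rfl
  | nu C ih => simp [close, subst, ih, map_subst, subst_map]

theorem fv_recv_subset {b : Bool} {N : Term S V} {P : Proc S V} {C : Con S V} :
    (C.recv b N P).fv ⊆ C.fv ∪ N.fv ∪ P.fv := by
  induction C with
  | base c =>
    cases c with
    | inp Q =>
      intro x hx
      simp only [recv, fv, Body.fv, Proc.mem_fv_pr, Proc.mem_fv_subst] at hx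
      rcases hx with hx | ⟨y, hy, hx⟩
      · exact Or.inr hx
      · cases y with
        | none => exact Or.inl (Or.inr hx)
        | some y =>
          obtain rfl : x = y := hx
          exact Or.inl (Or.inl hy)
    | _ => intro x hx; simp [recv, fv, Body.fv, Proc.fv] at hx
  | nu C ih =>
    intro x hx
    have := ih hx
    simpa [fv] using this

theorem fv_close_subset {b : Bool} {A B : Con S V} : (A.close b B).fv ⊆ A.fv ∪ B.fv := by
  induction A with
  | base c =>
    cases c with
    | out N P =>
      intro x hx
      have := fv_recv_subset hx
      simp only [fv, Body.fv, Set.mem_union] at this ⊢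
      tauto
    | _ => intro x hx; simp [close, fv, Body.fv, Proc.fv] at hx
  | nu C ih =>
    intro x hx
    have := ih hx
    simpa [fv] using this

end Con

/-- Symbolic transitions of a process `P` under a substitution `θ`. -/
inductive RStep (Ax : Term S Name → Term S Name → Prop) :
    {V W : Type} → (V → Term S W) → Proc S V → NLab S W → Con S V → Prop
  | inp {V W : Type} {θ : V → Term S W} {M : Term S V} {M' : Term S W} {P : Proc S (Option V)} :
      EqE Ax (M.subst θ) M' → RStep Ax θ (Proc.inp M P) (NLab.inp M') (Con.base (Body.inp P))
  | out {V W : Type} {θ : V → Term S W} {M N : Term S V} {M' : Term S W} {P : Proc S V} :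
      EqE Ax (M.subst θ) M' →
      RStep Ax θ (Proc.out M N P) (NLab.out M') (Con.base (Body.out N P))
  | sumL {V W : Type} {θ : V → Term S W} {P Q : Proc S V} {κ : NLab S W} {C : Con S V} :
      RStep Ax θ P κ C → RStep Ax θ (Proc.sum P Q) κ C
  | sumR {V W : Type} {θ : V → Term S W} {P Q : Proc S V} {κ : NLab S W} {C : Con S V} :
      RStep Ax θ Q κ C → RStep Ax θ (Proc.sum P Q) κ C
  | mat {V W : Type} {θ : V → Term S W} {M N : Term S V} {P : Proc S V} {κ : NLab S W}
      {C : Con S V} : EqE Ax (M.subst θ) (N.subst θ) → RStep Ax θ P κ C →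
      RStep Ax θ (Proc.mat M N P) κ C
  | res {V W : Type} {θ : V → Term S W} {P : Proc S (Option V)} {κ : NLab S W}
      {C : Con S (Option V)} : RStep Ax (lift θ) P (κ.map some) C →
      RStep Ax θ (Proc.nu P) κ (Con.nu C)
  | parL {V W : Type} {θ : V → Term S W} {P Q : Proc S V} {κ : NLab S W} {C : Con S V} :
      RStep Ax θ P κ C → RStep Ax θ (Proc.par P Q) κ (C.par true Q)
  | parR {V W : Type} {θ : V → Term S W} {P Q : Proc S V} {κ : NLab S W} {C : Con S V} :
      RStep Ax θ Q κ C → RStep Ax θ (Proc.par P Q) κ (C.par false P)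
  | rep {V W : Type} {θ : V → Term S W} {P : Proc S V} {κ : NLab S W} {C : Con S V} :
      RStep Ax θ P κ C → RStep Ax θ (Proc.rep P) κ (C.par true (Proc.rep P))
  | closeL {V W : Type} {θ : V → Term S W} {P Q : Proc S V} {M M' : Term S W} {A B : Con S V} :
      RStep Ax θ P (NLab.out M) A → RStep Ax θ Q (NLab.inp M') B → EqE Ax M M' →
      RStep Ax θ (Proc.par P Q) NLab.tau (A.close true B)
  | closeR {V W : Type} {θ : V → Term S W} {P Q : Proc S V} {M M' : Term S W} {A B : Con S V} :
      RStep Ax θ Q (NLab.out M) A → RStep Ax θ P (NLab.inp M') B → EqE Ax M M' →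
      RStep Ax θ (Proc.par P Q) NLab.tau (A.close false B)
  | repClose {V W : Type} {θ : V → Term S W} {P : Proc S V} {M M' : Term S W} {A B : Con S V} :
      RStep Ax θ P (NLab.out M) A → RStep Ax θ P (NLab.inp M') B → EqE Ax M M' →
      RStep Ax θ (Proc.rep P) NLab.tau ((A.close true B).par true (Proc.rep P))

namespace RStep

variable {Ax : Term S Name → Term S Name → Prop} {U V W : Type}

/-- A derivation sees messages only through tests evaluated by the substitution and otherwise
follows the syntax of the process. Hence a transition of an instance is one of the uninstantiated
process under the composite substitution, and its result is an instance too. -/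
theorem of_subst {θ : V → Term S W} {σ : W → Term S U} {P : Proc S V} {κ : NLab S U} {D : Con S W}
    (h : RStep Ax σ (P.subst θ) κ D) :
    ∃ C, RStep Ax (fun x => (θ x).subst σ) P κ C ∧ D = C.subst θ := by
  generalize hQ : P.subst θ = Q at h
  induction h generalizing V with
  | inp h =>
    cases P <;> simp only [Proc.subst, Proc.inp.injEq, reduceCtorEq] at hQ
    obtain ⟨rfl, rfl⟩ := hQ
    rw [Term.subst_subst] at h
    exact ⟨_, .inp h, rfl⟩
  | out h =>
    cases P <;> simp only [Proc.subst, Proc.out.injEq, reduceCtorEq] at hQ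
    obtain ⟨rfl, rfl, rfl⟩ := hQ
    rw [Term.subst_subst] at h
    exact ⟨_, .out h, rfl⟩
  | sumL _ ih =>
    cases P <;> simp only [Proc.subst, Proc.sum.injEq, reduceCtorEq] at hQ
    obtain ⟨rfl, rfl⟩ := hQ
    obtain ⟨C, h, rfl⟩ := ih rfl
    exact ⟨_, .sumL h, rfl⟩
  | sumR _ ih =>
    cases P <;> simp only [Proc.subst, Proc.sum.injEq, reduceCtorEq] at hQ
    obtain ⟨rfl, rfl⟩ := hQ
    obtain ⟨C, h, rfl⟩ := ih rfl
    exact ⟨_, .sumR h, rfl⟩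
  | mat he _ ih =>
    cases P <;> simp only [Proc.subst, Proc.mat.injEq, reduceCtorEq] at hQ
    obtain ⟨rfl, rfl, rfl⟩ := hQ
    obtain ⟨C, h, rfl⟩ := ih rfl
    rw [Term.subst_subst, Term.subst_subst] at he
    exact ⟨_, .mat he h, rfl⟩
  | res _ ih =>
    cases P <;> simp only [Proc.subst, Proc.nu.injEq, reduceCtorEq] at hQ
    obtain rfl := hQ
    obtain ⟨C, h, rfl⟩ := ih rfl
    rw [lift_subst] at h
    exact ⟨_, .res h, rfl⟩
  | parL _ ih =>
    cases P <;> simp only [Proc.subst, Proc.par.injEq, reduceCtorEq] at hQ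
    obtain ⟨rfl, rfl⟩ := hQ
    obtain ⟨C, h, rfl⟩ := ih rfl
    exact ⟨_, .parL h, (Con.par_subst _ _ _ _).symm⟩
  | parR _ ih =>
    cases P <;> simp only [Proc.subst, Proc.par.injEq, reduceCtorEq] at hQ
    obtain ⟨rfl, rfl⟩ := hQ
    obtain ⟨C, h, rfl⟩ := ih rfl
    exact ⟨_, .parR h, (Con.par_subst _ _ _ _).symm⟩
  | rep _ ih =>
    cases P <;> simp only [Proc.subst, Proc.rep.injEq, reduceCtorEq] at hQ
    obtain rfl := hQ
    obtain ⟨C, h, rfl⟩ := ih rfl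
    exact ⟨_, .rep h, by rw [Con.par_subst]; rfl⟩
  | closeL _ _ he ih1 ih2 =>
    cases P <;> simp only [Proc.subst, Proc.par.injEq, reduceCtorEq] at hQ
    obtain ⟨rfl, rfl⟩ := hQ
    obtain ⟨C, h1, rfl⟩ := ih1 rfl
    obtain ⟨C, h2, rfl⟩ := ih2 rfl
    exact ⟨_, .closeL h1 h2 he, (Con.close_subst _ _ _ _).symm⟩
  | closeR _ _ he ih1 ih2 =>
    cases P <;> simp only [Proc.subst, Proc.par.injEq, reduceCtorEq] at hQ
    obtain ⟨rfl, rfl⟩ := hQ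
    obtain ⟨C, h1, rfl⟩ := ih1 rfl
    obtain ⟨C, h2, rfl⟩ := ih2 rfl
    exact ⟨_, .closeR h1 h2 he, (Con.close_subst _ _ _ _).symm⟩
  | repClose _ _ he ih1 ih2 =>
    cases P <;> simp only [Proc.subst, Proc.rep.injEq, reduceCtorEq] at hQ
    obtain rfl := hQ
    obtain ⟨C, h1, rfl⟩ := ih1 rfl
    obtain ⟨C, h2, rfl⟩ := ih2 rfl
    exact ⟨_, .repClose h1 h2 he, by rw [Con.par_subst, Con.close_subst]; rfl⟩

/-- Converse of `of_subst`. The composite is a variable `τ` with an equation, so that the induction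
passes under `lift`. -/
theorem to_subst {θ : V → Term S W} {σ : W → Term S U} {τ : V → Term S U} {P : Proc S V}
    {κ : NLab S U} {C : Con S V} (h : RStep Ax τ P κ C) (hτ : τ = fun x => (θ x).subst σ) :
    RStep Ax σ (P.subst θ) κ (C.subst θ) := by
  induction h generalizing W with
  | inp h => subst hτ; rw [← Term.subst_subst] at h; exact .inp h
  | out h => subst hτ; rw [← Term.subst_subst] at h; exact .out h
  | sumL _ ih => exact .sumL (ih hτ)
  | sumR _ ih => exact .sumR (ih hτ)
  | mat he _ ih =>
    refine .mat ?_ (ih hτ)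
    subst hτ
    rwa [← Term.subst_subst, ← Term.subst_subst] at he
  | res _ ih => exact .res (ih (by rw [hτ, lift_subst]))
  | parL _ ih => rw [Con.par_subst]; exact .parL (ih hτ)
  | parR _ ih => rw [Con.par_subst]; exact .parR (ih hτ)
  | rep _ ih => rw [Con.par_subst]; exact .rep (ih hτ)
  | closeL _ _ he ih1 ih2 => rw [Con.close_subst]; exact .closeL (ih1 hτ) (ih2 hτ) he
  | closeR _ _ he ih1 ih2 => rw [Con.close_subst]; exact .closeR (ih1 hτ) (ih2 hτ) he
  | repClose _ _ he ih1 ih2 =>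
    rw [Con.par_subst, Con.close_subst]; exact .repClose (ih1 hτ) (ih2 hτ) he

/-- Guards and subjects are tested for equality only, and equality is closed under substitution. A
mismatch guard would break this. -/
theorem inst {θ : V → Term S W} {P : Proc S V} {κ : NLab S W} {C : Con S V}
    (h : RStep Ax θ P κ C) (σ : W → Term S U) :
    RStep Ax (fun x => (θ x).subst σ) P (κ.subst σ) C := by
  induction h generalizing U with
  | inp h => exact .inp (by simpa only [Term.subst_subst] using h.subst σ)
  | out h => exact .out (by simpa only [Term.subst_subst] using h.subst σ)
  | sumL _ ih => exact .sumL (ih σ)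
  | sumR _ ih => exact .sumR (ih σ)
  | mat he _ ih => exact .mat (by simpa only [Term.subst_subst] using he.subst σ) (ih σ)
  | res _ ih =>
    refine .res ?_
    have := ih (lift σ)
    rw [lift_subst, NLab.map_subst] at this
    rw [NLab.subst_map]
    exact this
  | parL _ ih => exact .parL (ih σ)
  | parR _ ih => exact .parR (ih σ)
  | rep _ ih => exact .rep (ih σ)
  | closeL _ _ he ih1 ih2 => exact .closeL (ih1 σ) (ih2 σ) (he.subst σ)
  | closeR _ _ he ih1 ih2 => exact .closeR (ih1 σ) (ih2 σ) (he.subst σ)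
  | repClose _ _ he ih1 ih2 => exact .repClose (ih1 σ) (ih2 σ) (he.subst σ)

/-- Instantiation with a left inverse of `f` undoes the renaming. -/
theorem of_map {θ : V → Term S W} {f : W → U} (hf : f.Injective) [Nonempty W] {P : Proc S V}
    {κ : NLab S W} {C : Con S V} (h : RStep Ax (fun x => (θ x).map f) P (κ.map f) C) :
    RStep Ax θ P κ C := by
  have := h.inst (fun x => Term.var (Function.invFun f x))
  simp only [Term.map_subst, NLab.map_subst, Function.leftInverse_invFun hf _] at this
  simpa using this

/-- The prefix rules fix the subject only up to the equational theory, so the change of label is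
pushed to the leaves of the derivation; communications have no subject to change. -/
theorem relabel {θ : V → Term S W} {P : Proc S V} {κ κ' : NLab S W} {C : Con S V}
    (h : RStep Ax θ P κ C) (hκ : NLab.Eqv Ax κ κ') : RStep Ax θ P κ' C := by
  induction h with
  | inp h => cases hκ with | inp he => exact .inp (h.trans he)
  | out h => cases hκ with | out he => exact .out (h.trans he)
  | sumL _ ih => exact .sumL (ih hκ)
  | sumR _ ih => exact .sumR (ih hκ)
  | mat he _ ih => exact .mat he (ih hκ)
  | res _ ih => exact .res (ih (hκ.subst _))
  | parL _ ih => exact .parL (ih hκ)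
  | parR _ ih => exact .parR (ih hκ)
  | rep _ ih => exact .rep (ih hκ)
  | closeL h1 h2 he => cases hκ; exact .closeL h1 h2 he
  | closeR h1 h2 he => cases hκ; exact .closeR h1 h2 he
  | repClose h1 h2 he => cases hκ; exact .repClose h1 h2 he

theorem fv_subset {θ : V → Term S W} {P : Proc S V} {κ : NLab S W} {C : Con S V}
    (h : RStep Ax θ P κ C) : C.fv ⊆ P.fv := by
  induction h with
  | inp h => exact fun x hx => Or.inr hx
  | out h =>
    rintro x (hx | hx)
    · exact Or.inl (Or.inr hx)
    · exact Or.inr hx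
  | sumL _ ih => exact fun x hx => Or.inl (ih hx)
  | sumR _ ih => exact fun x hx => Or.inr (ih hx)
  | mat he _ ih => exact fun x hx => Or.inr (ih hx)
  | res _ ih => exact fun x hx => ih hx
  | parL _ ih => exact fun x hx => (Con.mem_fv_par.1 hx).imp (@ih x) id
  | parR _ ih => exact fun x hx => (Con.mem_fv_par.1 hx).symm.imp id (@ih x)
  | rep _ ih => exact fun x hx => (Con.mem_fv_par.1 hx).elim (@ih x) id
  | closeL _ _ he ih1 ih2 => exact fun x hx => (Con.fv_close_subset hx).imp (@ih1 x) (@ih2 x)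
  | closeR _ _ he ih1 ih2 => exact fun x hx => (Con.fv_close_subset hx).symm.imp (@ih2 x) (@ih1 x)
  | repClose _ _ he ih1 ih2 =>
    exact fun x hx => (Con.mem_fv_par.1 hx).elim
      (fun hx => (Con.fv_close_subset hx).elim (@ih1 x) (@ih2 x)) id

end RStep

/-- The label fits the body of the result. -/
def Con.Fits : {V W : Type} → NLab S W → Con S V → Prop
  | _, _, .tau, .base (.tau _) => True
  | _, _, .out _, .base (.out _ _) => True
  | _, _, .inp _, .base (.inp _) => True
  | _, _, _, .base _ => False
  | _, _, κ, .nu C => C.Fits κ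

namespace Con

variable {U V W : Type}

theorem Fits.par {κ : NLab S W} {C : Con S V} (h : C.Fits κ) (b : Bool) (Q : Proc S V) :
    (C.par b Q).Fits κ := by
  induction C with
  | base c => cases c <;> cases κ <;> first | exact trivial | exact h.elim
  | nu C ih => cases κ <;> exact ih h _

theorem fits_subst {κ : NLab S W} {C : Con S V} {σ : V → Term S U} :
    (C.subst σ).Fits κ ↔ C.Fits κ := by
  induction C generalizing U with
  | base c => cases c <;> cases κ <;> rfl
  | nu C ih => cases κ <;> exact ih

theorem fits_label {κ : NLab S W} {C : Con S V} {σ : W → Term S U} :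
    C.Fits (κ.subst σ) ↔ C.Fits κ := by
  induction C with
  | base c => cases c <;> cases κ <;> rfl
  | nu C ih => cases κ <;> exact ih

theorem fits_recv {b : Bool} {N : Term S V} {P : Proc S V} {C : Con S V} :
    (C.recv b N P).Fits (NLab.tau : NLab S W) := by
  induction C with
  | base c => cases c <;> exact trivial
  | nu C ih => exact ih

theorem fits_close {b : Bool} {A B : Con S V} : (A.close b B).Fits (NLab.tau : NLab S W) := by
  induction A with
  | base c =>
    cases c with
    | out N P => exact fits_recv
    | _ => exact trivial
  | nu C ih => exact ih

end Con

namespace RStep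

variable {Ax : Term S Name → Term S Name → Prop} {U V W : Type}

theorem fits {θ : V → Term S W} {P : Proc S V} {κ : NLab S W} {C : Con S V}
    (h : RStep Ax θ P κ C) : C.Fits κ := by
  induction h with
  | inp h => exact trivial
  | out h => exact trivial
  | sumL _ ih => exact ih
  | sumR _ ih => exact ih
  | mat he _ ih => exact ih
  | @res _ _ _ _ κ _ _ ih =>
    have := Con.fits_label.1 ih
    cases κ <;> exact this
  | parL _ ih => exact ih.par _ _
  | parR _ ih => exact ih.par _ _
  | rep _ ih => exact ih.par _ _
  | closeL _ _ he ih1 ih2 => exact Con.fits_close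
  | closeR _ _ he ih1 ih2 => exact Con.fits_close
  | repClose _ _ he ih1 ih2 => exact Con.fits_close.par _ _

/-- The subject of a visible symbolic transition is given by a message over the variables of
the process. -/
theorem subject {θ : V → Term S W} {P : Proc S V} {κ : NLab S W} {C : Con S V}
    (h : RStep Ax θ P κ C) (v : V) : ∃ μ : NLab S V, NLab.Eqv Ax κ (μ.subst θ) := by
  induction h with
  | inp h => exact ⟨.inp _, .inp h.symm⟩
  | out h => exact ⟨.out _, .out h.symm⟩
  | sumL _ ih => exact ih v
  | sumR _ ih => exact ih v
  | mat he _ ih => exact ih v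
  | @res _ _ θ _ κ _ _ ih =>
    obtain ⟨μ, hμ⟩ := ih none
    -- The recipe found below the restriction may mention the restricted variable, but the label
    -- does not. Any variable `v` can therefore be put in its place without changing the value of
    -- the label.
    refine ⟨μ.subst (instBound (Term.var v)), ?_⟩
    have := hμ.subst (instBound ((Term.var v : Term S _).subst θ))
    rw [NLab.subst_subst, NLab.map_subst, ← Con.instBound_subst, ← NLab.subst_subst] at this
    rwa [show (fun x => instBound ((Term.var v : Term S _).subst θ) (some x)) = Term.var from rfl,
      NLab.subst_var] at this
  | parL _ ih => exact ih v
  | parR _ ih => exact ih v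
  | rep _ ih => exact ih v
  | closeL _ _ he ih1 ih2 => exact ⟨.tau, .tau⟩
  | closeR _ _ he ih1 ih2 => exact ⟨.tau, .tau⟩
  | repClose _ _ he ih1 ih2 => exact ⟨.tau, .tau⟩

end RStep

/-- Every finite set of variables has a variable outside that `φ` maps to a variable which is
fresh for the image of the set. -/
def Generic {V W : Type} (φ : V → Term S W) : Prop :=
  ∀ K : Set V, K.Finite → ∃ v, v ∉ K ∧ ∃ w, φ v = Term.var w ∧ ∀ u ∈ K, w ∉ (φ u).fv

/-- All equations that hold under `θ` hold under `φ`. -/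
def Implies (Ax : Term S Name → Term S Name → Prop) {V W W' : Type} (θ : V → Term S W)
    (φ : V → Term S W') : Prop :=
  ∀ M N : Term S V, EqE Ax (M.subst θ) (N.subst θ) → EqE Ax (M.subst φ) (N.subst φ)

/-! ### Transfer of symbolic transitions along implications between equations. -/

section Transfer

variable {Ax : Term S Name → Term S Name → Prop} {V W W' : Type}

theorem Generic.lift {φ : V → Term S W} (h : Generic φ) : Generic (AppliedPi.lift φ) := by
  intro K hK
  obtain ⟨v, hv, w, hw, hu⟩ := h {x | some x ∈ K} (hK.preimage (Option.some_injective _).injOn)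
  refine ⟨some v, hv, some w, by simp [hw], fun u huK => ?_⟩
  rw [some_mem_fv_lift]
  rintro ⟨z, rfl, hz⟩
  exact hu z huK hz

/-- A test below a restriction may mention the restricted variable. Such a test is replaced by one
outside the restriction, with a variable `v` for the restricted one that `φ` sends to a variable `w`
occurring in none of the other images involved. Once the test has been transferred to `φ`, renaming
`w` to `none` gives the test under `lift φ`. -/
theorem Implies.lift {θ : V → Term S W} {φ : V → Term S W'} (h : Implies Ax θ φ)
    (hφ : Generic φ) : Implies Ax (lift θ) (lift φ) := by
  classical
  intro M N hMN
  obtain ⟨v, hv, w, hw, hu⟩ := hφ {x | some x ∈ M.fv ∪ N.fv}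
    ((M.fv_finite.union N.fv_finite).preimage (Option.some_injective _).injOn)
  have h1 := hMN.subst (instBound ((Term.var v : Term S V).subst θ))
  simp only [Term.subst_subst, ← Con.instBound_subst] at h1
  rw [← Term.subst_subst, ← Term.subst_subst] at h1
  have h2 := (h _ _ h1).subst (fun x => Term.var (if x = w then none else some x))
  have key (K : Term S (Option V)) (hK : ∀ x, some x ∈ K.fv → w ∉ (φ x).fv) :
      ((K.subst (instBound (Term.var v))).subst φ).subst
        (fun x => Term.var (if x = w then none else some x)) = K.subst (AppliedPi.lift φ) := by
    rw [Term.subst_subst, Term.subst_subst]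
    refine Term.subst_congr fun x hx => ?_
    cases x with
    | none => simp [instBound, hw]
    | some x =>
      simp only [instBound, Term.subst_var_apply, lift_some]
      refine Term.subst_congr fun y hy => ?_
      rw [if_neg]
      rintro rfl
      exact hK x hx hy
  rwa [key M fun x hx => hu x (Or.inl hx), key N fun x hx => hu x (Or.inr hx)] at h2

theorem NLab.Eqv.subst_lift {κ : NLab S W} {μ : NLab S V} {θ : V → Term S W}
    (h : NLab.Eqv Ax κ (μ.subst θ)) :
    NLab.Eqv Ax (κ.map some) ((μ.map some).subst (AppliedPi.lift θ)) := by
  have := h.subst (fun x => Term.var (some x))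
  rw [NLab.subst_subst] at this
  rw [NLab.map_subst]
  exact this

/-- Every test in a derivation compares two messages evaluated by `θ`, so it holds under `φ` as
well. Only the subjects need care: they are messages over `W`, and the label is transported through
a recipe `μ` for it. -/
theorem RStep.transfer {θ : V → Term S W} {P : Proc S V} {κ : NLab S W} {C : Con S V}
    (h : RStep Ax θ P κ C) {φ : V → Term S W'} (hi : Implies Ax θ φ) (hφ : Generic φ)
    {μ : NLab S V} (hμ : NLab.Eqv Ax κ (μ.subst θ)) : RStep Ax φ P (μ.subst φ) C := by
  induction h generalizing W' with
  | inp h =>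
    cases μ with
    | inp M => cases hμ with | inp he => exact .inp (hi _ _ (h.trans he))
    | _ => cases hμ
  | out h =>
    cases μ with
    | out M => cases hμ with | out he => exact .out (hi _ _ (h.trans he))
    | _ => cases hμ
  | sumL _ ih => exact .sumL (ih hi hφ hμ)
  | sumR _ ih => exact .sumR (ih hi hφ hμ)
  | mat he _ ih => exact .mat (hi _ _ he) (ih hi hφ hμ)
  | res _ ih =>
    refine .res ?_
    have := ih (hi.lift hφ) hφ.lift (μ := μ.map some) hμ.subst_lift
    rw [NLab.map_subst] at this
    rw [NLab.subst_map]
    exact this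
  | parL _ ih => exact .parL (ih hi hφ hμ)
  | parR _ ih => exact .parR (ih hi hφ hμ)
  | rep _ ih => exact .rep (ih hi hφ hμ)
  | closeL h1 h2 he ih1 ih2 =>
    -- The subjects of the two partners do not appear in the label, so recipes for them come from
    -- `subject`, which needs some variable `v`. The partners then meet because the two recipes are
    -- equal under `θ`, hence under `φ`.
    obtain ⟨v, -⟩ := hφ ∅ Set.finite_empty
    obtain ⟨μ1, hμ1⟩ := h1.subject v
    obtain ⟨μ2, hμ2⟩ := h2.subject v
    have r1 := ih1 hi hφ hμ1
    have r2 := ih2 hi hφ hμ2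
    cases μ <;> cases hμ
    cases μ1 <;> cases hμ1
    cases μ2 <;> cases hμ2
    rename_i h1 _ h2
    exact .closeL r1 r2 (hi _ _ ((h1.symm.trans he).trans h2))
  | closeR h1 h2 he ih1 ih2 =>
    obtain ⟨v, -⟩ := hφ ∅ Set.finite_empty
    obtain ⟨μ1, hμ1⟩ := h1.subject v
    obtain ⟨μ2, hμ2⟩ := h2.subject v
    have r1 := ih1 hi hφ hμ1
    have r2 := ih2 hi hφ hμ2
    cases μ <;> cases hμ
    cases μ1 <;> cases hμ1
    cases μ2 <;> cases hμ2
    rename_i h1 _ h2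
    exact .closeR r1 r2 (hi _ _ ((h1.symm.trans he).trans h2))
  | repClose h1 h2 he ih1 ih2 =>
    obtain ⟨v, -⟩ := hφ ∅ Set.finite_empty
    obtain ⟨μ1, hμ1⟩ := h1.subject v
    obtain ⟨μ2, hμ2⟩ := h2.subject v
    have r1 := ih1 hi hφ hμ1
    have r2 := ih2 hi hφ hμ2
    cases μ <;> cases hμ
    cases μ1 <;> cases hμ1
    cases μ2 <;> cases hμ2
    rename_i h1 _ h2
    exact .repClose r1 r2 (hi _ _ ((h1.symm.trans he).trans h2))

end Transfer

/-! ### Active substitutions -/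

theorem lift_single {V : Type} (x : V) (N : Term S V) :
    lift (single x N) = single (some x) (N.map some) := by
  funext y
  cases y with
  | none => simp [single]
  | some y =>
    by_cases h : y = x <;> simp [single, h]

@[simp] theorem single_self {V : Type} (x : V) (N : Term S V) : single x N x = N := by simp [single]

theorem single_of_ne {V : Type} {x y : V} (N : Term S V) (h : y ≠ x) :
    single x N y = Term.var y := by simp [single, h]

namespace Frame

variable {U V W : Type}

@[simp] theorem app_nil : app ([] : Frame S V) = Term.var := rfl

theorem app_cons_self (x : V) (N : Term S V) (θ : Frame S V) : app ((x, N) :: θ) x = N := by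
  simp [app]

theorem app_cons_ne {x y : V} (N : Term S V) (θ : Frame S V) (h : y ≠ x) :
    app ((x, N) :: θ) y = app θ y := by
  simp [app, h]

theorem mem_dom_cons {x y : V} {N : Term S V} {θ : Frame S V} :
    y ∈ dom ((x, N) :: θ) ↔ y = x ∨ y ∈ dom θ := by
  simp [dom, exists_or]

theorem app_of_notMem {θ : Frame S V} {x : V} (h : x ∉ θ.dom) : θ.app x = Term.var x := by
  induction θ with
  | nil => rfl
  | cons p θ ih =>
    obtain ⟨y, N⟩ := p
    rw [mem_dom_cons, not_or] at h
    rw [app_cons_ne _ _ h.1, ih h.2]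

theorem app_mem {θ : Frame S V} {x : V} (h : x ∈ θ.dom) : (x, θ.app x) ∈ θ := by
  induction θ with
  | nil => simp [dom] at h
  | cons p θ ih =>
    obtain ⟨y, N⟩ := p
    by_cases hx : x = y
    · subst hx; rw [app_cons_self]; exact List.mem_cons_self
    · rw [app_cons_ne _ _ hx]
      exact List.mem_cons_of_mem _ (ih ((mem_dom_cons.1 h).resolve_left hx))

@[simp] theorem rename_nil (f : V → W) : rename f ([] : Frame S V) = [] := rfl

@[simp] theorem rename_cons (f : V → W) (x : V) (N : Term S V) (θ : Frame S V) :
    rename f ((x, N) :: θ) = (f x, N.map f) :: rename f θ := rfl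

theorem rename_append (f : V → W) (θ θ' : Frame S V) :
    rename f (θ ++ θ') = rename f θ ++ rename f θ' := List.map_append

theorem rename_rename (f : V → W) (g : W → U) (θ : Frame S V) :
    rename g (rename f θ) = rename (fun x => g (f x)) θ := by
  simp [rename, Term.map_map]

theorem rename_congr {f g : V → W} {θ : Frame S V} (h : ∀ x ∈ θ.fv, f x = g x) :
    rename f θ = rename g θ := by
  refine List.map_congr_left fun p hp => ?_
  rw [h p.1 ⟨p, hp, Or.inl rfl⟩]
  congr 1
  exact Term.subst_congr fun x hx => congrArg Term.var (h x ⟨p, hp, Or.inr hx⟩)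

@[simp] theorem rename_id (θ : Frame S V) : rename (fun x => x) θ = θ := by
  have (M : Term S V) : M.map (fun x => x) = M := Term.subst_var M
  simp [rename, this]

theorem app_rename {f : V → W} (hf : f.Injective) (θ : Frame S V) (x : V) :
    (θ.rename f).app (f x) = (θ.app x).map f := by
  induction θ with
  | nil => rfl
  | cons p θ ih =>
    obtain ⟨y, N⟩ := p
    by_cases hx : x = y
    · subst hx; rw [rename_cons, app_cons_self, app_cons_self]
    · rw [rename_cons, app_cons_ne _ _ hx, app_cons_ne _ _ (hf.ne hx), ih]

theorem mem_dom_rename {f : V → W} {θ : Frame S V} {x : W} :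
    x ∈ (θ.rename f).dom ↔ ∃ y ∈ θ.dom, x = f y := by
  simp only [dom, rename, List.mem_map, Prod.exists, Prod.mk.injEq, Set.mem_ofPred_eq]
  constructor
  · rintro ⟨_, y, N, h, rfl, rfl⟩; exact ⟨y, ⟨N, h⟩, rfl⟩
  · rintro ⟨y, ⟨N, h⟩, rfl⟩; exact ⟨_, y, N, h, rfl, rfl⟩

/-- This identity carries inductions on restrictions: below a restriction the active substitution
acts as the lifted one. -/
theorem app_rename_some (θ : Frame S V) : (θ.rename some).app = lift θ.app := by
  funext x
  cases x with
  | none => exact app_of_notMem (by simp [mem_dom_rename])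
  | some x => exact app_rename (Option.some_injective V) θ x

theorem fv_finite (θ : Frame S V) : θ.fv.Finite := by
  have : θ.fv = ⋃ p ∈ {p | p ∈ θ}, ({p.1} ∪ p.2.fv) := by
    ext x; simp [fv]
  rw [this]
  exact (List.finite_toSet θ).biUnion fun p _ => (Set.finite_singleton _).union p.2.fv_finite

theorem dom_subset_fv (θ : Frame S V) : θ.dom ⊆ θ.fv := fun _ ⟨_, h⟩ => ⟨_, h, Or.inl rfl⟩

theorem fv_app_subset {θ : Frame S V} {x y : V} (h : y ∈ (θ.app x).fv) : y = x ∨ y ∈ θ.fv := by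
  by_cases hx : x ∈ θ.dom
  · exact Or.inr ⟨_, app_mem hx, Or.inr h⟩
  · rw [app_of_notMem hx] at h
    exact Or.inl h

end Frame

/-! ### Results as extended processes -/

namespace Con

variable {U V W : Type}

/-- The extended process with active substitution `θ` obtained from the result of a transition by
naming its output or input variable `x`. -/
def toExt : {V : Type} → Con S V → Frame S V → V → Ext S V
  | _, base (Body.tau P), θ, _ => Ext.base θ P
  | _, base (Body.out N P), θ, x => Ext.base ((x, N) :: θ) P
  | _, base (Body.inp P), θ, x => Ext.base θ (P.subst (instBound (Term.var x)))
  | _, nu C, θ, x => Ext.nu (C.toExt (θ.rename some) (some x))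

theorem toExt_activate (C : Con S V) (θ θ' : Frame S V) (x : V) :
    (C.toExt θ x).activate θ' = C.toExt (θ ++ θ') x := by
  induction C with
  | base c => cases c <;> rfl
  | nu C ih => simp [toExt, Ext.activate, ih, Frame.rename_append]

theorem instBound_map (f : V → W) (x : V) (P : Proc S (Option V)) :
    (P.subst (instBound (Term.var x))).map f =
      (P.map (Option.map f)).subst (instBound (Term.var (f x))) := by
  rw [Proc.subst_map, Proc.map_subst]
  congr 1
  funext y
  cases y <;> rfl

theorem toExt_map (C : Con S V) (f : V → W) (θ : Frame S V) (x : V) :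
    (C.toExt θ x).map f = (C.map f).toExt (θ.rename f) (f x) := by
  induction C generalizing W with
  | base c =>
    cases c with
    | inp P =>
      simp only [toExt, Ext.map, map, subst, Body.subst, lift_var_comp]
      rw [instBound_map]
      rfl
    | _ => rfl
  | nu C ih => simp [toExt, Ext.map, map_nu, ih, Frame.rename_rename]

theorem toExt_parR (C : Con S V) (Q : Proc S V) (θ : Frame S V) (x : V) :
    (C.toExt θ x).parR Q = (C.par true Q).toExt θ x := by
  induction C with
  | base c =>
    cases c with
    | inp P =>
      simp only [toExt, Ext.parR, par, Body.par, Proc.pr, Proc.subst, Proc.map_subst]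
      congr 2
      exact (Proc.subst_var Q).symm
    | _ => rfl
  | nu C ih => simp [toExt, Ext.parR, par, ih]

theorem toExt_parL (C : Con S V) (Q : Proc S V) (θ : Frame S V) (x : V) :
    (C.toExt θ x).parL Q = (C.par false Q).toExt θ x := by
  induction C with
  | base c =>
    cases c with
    | inp P =>
      simp only [toExt, Ext.parL, par, Body.par, Proc.pr, Proc.subst, Proc.map_subst]
      congr 2
      exact (Proc.subst_var Q).symm
    | _ => rfl
  | nu C ih => simp [toExt, Ext.parL, par, ih]

theorem instBound_single {x : V} {N : Term S V} {P : Proc S (Option V)} (h : some x ∉ P.fv) :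
    (P.subst (instBound (Term.var x))).subst (single x N) = P.subst (instBound N) := by
  rw [Proc.subst_subst]
  refine Proc.subst_congr fun y hy => ?_
  cases y with
  | none => simp [instBound]
  | some y =>
    simp only [instBound, Term.subst_var_apply]
    exact single_of_ne _ (by rintro rfl; exact h hy)

/-- Since `x` is fresh for the receiver, naming its input variable `x` and then substituting `N` for
`x` is the same as instantiating the bound variable with `N`. The variable `y` is arbitrary because
the result of a communication has no variable to name. -/
theorem toExt_recv (b : Bool) {C : Con S V} {K : Term S W} (hC : C.Fits (NLab.inp K)) {x : V}
    (hx : x ∉ C.fv) (y : V) (N : Term S V) (P : Proc S V) :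
    (bif b then ((C.toExt [] x).subst (single x N)).parL P
      else ((C.toExt [] x).subst (single x N)).parR P) = (C.recv b N P).toExt [] y := by
  induction C with
  | base c =>
    cases c with
    | inp Q =>
      cases b <;>
      simp [toExt, Ext.subst, recv, Frame.subst, Ext.parL, Ext.parR, instBound_single hx, Proc.pr]
    | _ => exact hC.elim
  | nu C ih =>
    have := ih hC (x := some x) hx (some y) (N.map some) (P.map some)
    cases b <;> simp [toExt, Ext.subst, recv, Ext.parL, Ext.parR, lift_single] at this ⊢ <;>
      exact this

theorem toExt_close {A B : Con S V} {M : Term S U} {N : Term S W} (hA : A.Fits (NLab.out M))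
    (hB : B.Fits (NLab.inp N)) {x : V} (hx : x ∉ B.fv) (y : V) :
    (A.toExt [] x).closeL x (B.toExt [] x) = (A.close true B).toExt [] y ∧
    (A.toExt [] x).closeR x (B.toExt [] x) = (A.close false B).toExt [] y := by
  induction A with
  | base c =>
    cases c with
    | out K P =>
      have h1 := toExt_recv true hB hx y K P
      have h2 := toExt_recv false hB hx y K P
      simp only [toExt, Ext.closeL, Ext.closeR, close, Frame.app_cons_self]
      exact ⟨h1, h2⟩
    | _ => exact hA.elim
  | nu A ih =>
    have := ih (B := B.map some) hA (fits_subst.2 hB) (x := some x) (by simpa using hx) (some y)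
    simp only [toExt, Ext.closeL, Ext.closeR, close, Frame.rename_nil]
    rw [toExt_map, Frame.rename_nil, this.1, this.2]
    exact ⟨rfl, rfl⟩

end Con

/-! ### Transitions of processes -/

namespace Label

variable {V W : Type}

def strip : Label S V → NLab S V
  | tau => .tau
  | out M _ => .out M
  | inp M _ => .inp M

/-- `x` is the bound variable of the label, if it has one. -/
def At : Label S V → V → Prop
  | tau, _ => True
  | out _ y, x => x = y
  | inp _ y, x => x = y

end Label

/-- The label with the bound variable `x`. -/
def NLab.at {V : Type} : NLab S V → V → Label S V
  | tau, _ => .tau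
  | out M, x => .out M x
  | inp M, x => .inp M x

namespace NLab

variable {V W : Type}

theorem at_map (κ : NLab S V) (f : V → W) (x : V) : (κ.at x).map f = (κ.map f).at (f x) := by
  cases κ <;> rfl

theorem at_subst (κ : NLab S V) (σ : V → Term S V) (x : V) :
    (κ.at x).subst σ = (κ.subst σ).at x := by
  cases κ <;> rfl

theorem at_bn_subset (κ : NLab S V) (x : V) : (κ.at x).bn ⊆ {x} := by
  cases κ <;> simp [NLab.at, Label.bn]

end NLab

section PStep

variable {Ax : Term S Name → Term S Name → Prop} {V W : Type}

theorem Label.At.map {π : Label S V} {x : V} (h : π.At x) (f : V → W) : (π.map f).At (f x) := by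
  cases π
  · trivial
  · exact congrArg f h
  · exact congrArg f h

theorem Label.strip_map (π : Label S V) (f : V → W) : (π.map f).strip = π.strip.map f := by
  cases π <;> rfl

theorem Label.bn_map {π : Label S V} {f : V → W} {x : V} (h : x ∈ π.bn) : f x ∈ (π.map f).bn := by
  cases π
  · exact h
  · exact congrArg f h
  · exact congrArg f h

/-- Freshness of the bound variable for the result is carried along because the communication rules
need it: there the variable is eliminated from the receiver by substitution. For a silent label,
`Label.At` holds of every variable. -/
theorem PStep.to_rstep {P : Proc S V} {π : Label S V} {A : Ext S V} (h : PStep Ax P π A) :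
    ∃ C, RStep Ax Term.var P π.strip C ∧ (∀ x, π.At x → A = C.toExt [] x) ∧
      ∀ x ∈ π.bn, x ∉ C.fv := by
  have par_fresh {V : Type} {π : Label S V} {Q : Proc S V} {C : Con S V} {b : Bool}
      (h1 : ∀ x ∈ π.bn, x ∉ C.fv) (h2 : π.bn ∩ Q.fv = ∅) : ∀ x ∈ π.bn, x ∉ (C.par b Q).fv := by
    intro x hx hm
    rcases Con.mem_fv_par.1 hm with hm | hm
    · exact h1 x hx hm
    · exact Set.notMem_empty x (h2 ▸ ⟨hx, hm⟩)
  induction h with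
  | inp he hx =>
    refine ⟨_, .inp (by simpa using he), ?_, ?_⟩
    · rintro x rfl; rfl
    · rintro x rfl hm; exact hx (Or.inr (Or.inr hm))
  | out he hx =>
    refine ⟨_, .out (by simpa using he), ?_, ?_⟩
    · rintro x rfl; rfl
    · rintro x rfl (hm | hm)
      · exact hx (Or.inr (Or.inl (Or.inr hm)))
      · exact hx (Or.inr (Or.inr hm))
  | sumL _ ih => obtain ⟨C, h, h1⟩ := ih; exact ⟨C, .sumL h, h1⟩
  | sumR _ ih => obtain ⟨C, h, h1⟩ := ih; exact ⟨C, .sumR h, h1⟩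
  | mat he _ ih => obtain ⟨C, h, h1⟩ := ih; exact ⟨C, .mat (by simpa using he) h, h1⟩
  | res _ ih =>
    obtain ⟨C, h, h1, h2⟩ := ih
    refine ⟨.nu C, .res (by rw [lift_var]; rwa [Label.strip_map] at h), fun x hx => ?_,
      fun x hx => h2 _ (Label.bn_map hx)⟩
    rw [h1 _ (hx.map some)]; rfl
  | parL _ hf ih =>
    obtain ⟨C, h, h1, h2⟩ := ih
    exact ⟨_, .parL h, fun x hx => by rw [h1 x hx, Con.toExt_parR], par_fresh h2 hf⟩
  | parR _ hf ih =>
    obtain ⟨C, h, h1, h2⟩ := ih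
    exact ⟨_, .parR h, fun x hx => by rw [h1 x hx, Con.toExt_parL], par_fresh h2 hf⟩
  | repAct _ hf ih =>
    obtain ⟨C, h, h1, h2⟩ := ih
    exact ⟨_, .rep h, fun x hx => by rw [h1 x hx, Con.toExt_parR], par_fresh h2 hf⟩
  | closeL _ _ he ih1 ih2 =>
    obtain ⟨C, h, h1, h2⟩ := ih1
    obtain ⟨D, k, k1, k2⟩ := ih2
    refine ⟨_, .closeL h k he, fun y _ => ?_, fun x hx => hx.elim⟩
    rw [h1 _ rfl, k1 _ rfl]
    exact (Con.toExt_close h.fits k.fits (k2 _ rfl) y).1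
  | closeR _ _ he ih1 ih2 =>
    obtain ⟨C, h, h1, h2⟩ := ih1
    obtain ⟨D, k, k1, k2⟩ := ih2
    refine ⟨_, .closeR h k he, fun y _ => ?_, fun x hx => hx.elim⟩
    rw [h1 _ rfl, k1 _ rfl]
    exact (Con.toExt_close h.fits k.fits (k2 _ rfl) y).2
  | repClose _ _ he ih1 ih2 =>
    obtain ⟨C, h, h1, h2⟩ := ih1
    obtain ⟨D, k, k1, k2⟩ := ih2
    refine ⟨_, .repClose h k he, fun y _ => ?_, fun x hx => hx.elim⟩
    rw [h1 _ rfl, k1 _ rfl, (Con.toExt_close h.fits k.fits (k2 _ rfl) y).1, Con.toExt_parR]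

/-- The only choice to be made is the variable through which two partners communicate. Infinitely
many variables are available, one avoids the processes and the subjects, and the result does not
depend on it. -/
theorem RStep.to_pstep [hV : Infinite V] {θ : V → Term S V} (hθ : θ = Term.var) {P : Proc S V}
    {κ : NLab S V} {C : Con S V} (h : RStep Ax θ P κ C) :
    ∀ x, x ∉ P.fv → x ∉ κ.fv → PStep Ax P (κ.at x) (C.toExt [] x) := by
  have fresh {V : Type} {κ : NLab S V} {x : V} {Q : Proc S V} (hx : x ∉ Q.fv) :
      (κ.at x).bn ∩ Q.fv = ∅ := by
    ext y
    simp only [Set.mem_inter_iff, Set.mem_empty_iff_false, iff_false, not_and]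
    intro hy
    obtain rfl := κ.at_bn_subset x hy
    exact hx
  have avoid {V : Type} [Infinite V] (P Q : Proc S V) (M N : Term S V) :
      ∃ y, y ∉ P.fv ∧ y ∉ Q.fv ∧ y ∉ M.fv ∧ y ∉ N.fv := by
    obtain ⟨y, hy⟩ := (((P.fv_finite.union Q.fv_finite).union M.fv_finite).union
      N.fv_finite).exists_notMem
    simp only [Set.mem_union, not_or] at hy
    exact ⟨y, hy.1.1.1, hy.1.1.2, hy.1.2, hy.2⟩
  -- The two variable types of `RStep` are independent indices, so for the induction their equality
  -- and that of the labels become hypotheses.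
  have main : ∀ {V W : Type} {θ : V → Term S W} {P : Proc S V} {κ : NLab S W} {C : Con S V},
      RStep Ax θ P κ C → ∀ (e : W = V) [Infinite V], (∀ x, θ x = Term.var (cast e.symm x)) →
      ∀ x, x ∉ P.fv → ∀ κ' : NLab S V, HEq κ κ' → x ∉ κ'.fv →
      PStep Ax P (κ'.at x) (C.toExt [] x) := by
    clear hV hθ h θ P κ C
    intro V W θ P κ C h
    induction h with
    | inp he =>
      intro e _ hθ x hx κ' hκ hk
      subst e
      obtain rfl := eq_of_heq hκ
      obtain rfl : _ = Term.var := funext hθ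
      rw [Term.subst_var] at he
      exact PStep.inp he (by rintro (h | h); exacts [hk h, hx h])
    | out he =>
      intro e _ hθ x hx κ' hκ hk
      subst e
      obtain rfl := eq_of_heq hκ
      obtain rfl : _ = Term.var := funext hθ
      rw [Term.subst_var] at he
      exact PStep.out he (by rintro (h | h); exacts [hk h, hx h])
    | sumL _ ih =>
      intro e _ hθ x hx κ' hκ hk
      exact .sumL (ih e hθ x (fun h => hx (Or.inl h)) κ' hκ hk)
    | sumR _ ih =>
      intro e _ hθ x hx κ' hκ hk
      exact .sumR (ih e hθ x (fun h => hx (Or.inr h)) κ' hκ hk)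
    | mat he _ ih =>
      intro e _ hθ x hx κ' hκ hk
      refine .mat ?_ (ih e hθ x (fun h => hx (Or.inr h)) κ' hκ hk)
      subst e
      obtain rfl : _ = Term.var := funext hθ
      simpa using he
    | res _ ih =>
      intro e _ hθ x hx κ' hκ hk
      subst e
      obtain rfl := eq_of_heq hκ
      obtain rfl : _ = Term.var := funext hθ
      refine .res ?_
      rw [NLab.at_map]
      exact ih rfl (fun x => by rw [lift_var]; rfl) (some x) hx _ HEq.rfl
        (fun h => hk ((NLab.map_mem_fv_map (Option.some_injective _)).1 h))
    | parL _ ih =>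
      intro e _ hθ x hx κ' hκ hk
      rw [← Con.toExt_parR]
      exact .parL (ih e hθ x (fun h => hx (Or.inl h)) κ' hκ hk) (fresh fun h => hx (Or.inr h))
    | parR _ ih =>
      intro e _ hθ x hx κ' hκ hk
      rw [← Con.toExt_parL]
      exact .parR (ih e hθ x (fun h => hx (Or.inr h)) κ' hκ hk) (fresh fun h => hx (Or.inl h))
    | rep _ ih =>
      intro e _ hθ x hx κ' hκ hk
      rw [← Con.toExt_parR]
      exact .repAct (ih e hθ x hx κ' hκ hk) (fresh hx)
    | @closeL V W θ P Q M M' A B h1 h2 he ih1 ih2 =>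
      intro e _ hθ x hx κ' hκ hk
      subst e
      obtain rfl := eq_of_heq hκ
      obtain ⟨y, hy1, hy2, hy3, hy4⟩ := avoid P Q M M'
      rw [← (Con.toExt_close h1.fits h2.fits (fun h => hy2 (h2.fv_subset h)) x).1]
      exact .closeL (ih1 rfl hθ y hy1 _ HEq.rfl hy3) (ih2 rfl hθ y hy2 _ HEq.rfl hy4) he
    | @closeR V W θ P Q M M' A B h1 h2 he ih1 ih2 =>
      intro e _ hθ x hx κ' hκ hk
      subst e
      obtain rfl := eq_of_heq hκ
      obtain ⟨y, hy1, hy2, hy3, hy4⟩ := avoid Q P M M'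
      rw [← (Con.toExt_close h1.fits h2.fits (fun h => hy2 (h2.fv_subset h)) x).2]
      exact .closeR (ih1 rfl hθ y hy1 _ HEq.rfl hy3) (ih2 rfl hθ y hy2 _ HEq.rfl hy4) he
    | @repClose V W θ P M M' A B h1 h2 he ih1 ih2 =>
      intro e _ hθ x hx κ' hκ hk
      subst e
      obtain rfl := eq_of_heq hκ
      obtain ⟨y, hy1, hy2, hy3, hy4⟩ := avoid P P M M'
      rw [← Con.toExt_parR, ← (Con.toExt_close h1.fits h2.fits (fun h => hy2 (h2.fv_subset h)) x).1]
      exact .repClose (ih1 rfl hθ y hy1 _ HEq.rfl hy3) (ih2 rfl hθ y hy2 _ HEq.rfl hy4) he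
  intro x hx hk
  exact main h rfl (fun x => congrFun hθ x) x hx κ HEq.rfl hk

end PStep

/-! ### Abstract histories -/

/-- The variables in the image of a set under a substitution. -/
def img {V W : Type} (σ : V → Term S W) (X : Set V) : Set W := {w | ∃ y ∈ X, w ∈ (σ y).fv}

theorem img_mono {V W : Type} (σ : V → Term S W) {X Y : Set V} (h : X ⊆ Y) : img σ X ⊆ img σ Y :=
  fun _ ⟨y, hy, hw⟩ => ⟨y, h hy, hw⟩

theorem img_finite {V W : Type} (σ : V → Term S W) {X : Set V} (h : X.Finite) :
    (img σ X).Finite := by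
  have : img σ X = ⋃ y ∈ X, (σ y).fv := by ext; simp [img]
  rw [this]
  exact h.biUnion fun y _ => (σ y).fv_finite

/-- The variables over `Option V` that are `none` or come from `X`. -/
def upS {V : Type} (X : Set V) : Set (Option V) := insert none (some '' X)

@[simp] theorem none_mem_upS {V : Type} {X : Set V} : none ∈ upS X := Or.inl rfl

@[simp] theorem some_mem_upS {V : Type} {X : Set V} {x : V} : some x ∈ upS X ↔ x ∈ X := by
  simp [upS]

theorem upS_mono {V : Type} {X Y : Set V} (h : X ⊆ Y) : upS X ⊆ upS Y := by
  intro x hx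
  cases x with
  | none => simp
  | some x => simpa using h (by simpa using hx)

/-- The part of a history that matters for open bisimilarity: the known variables, and the output
variables, the most recent one first, each with the variables known before that output. -/
structure Hy (V : Type) where
  known : Set V
  outs : List (V × Set V)

/-- The output variables. -/
def ovars {V : Type} (l : List (V × Set V)) : Set V := {x | ∃ p ∈ l, x = p.1}

theorem mem_ovars_cons {V : Type} {l : List (V × Set V)} {p : V × Set V} {x : V} :
    x ∈ ovars (p :: l) ↔ x = p.1 ∨ x ∈ ovars l := by
  simp [ovars]

@[simp] theorem ovars_nil {V : Type} : ovars ([] : List (V × Set V)) = ∅ := by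
  ext; simp [ovars]

/-- Consistency of the output variables with the known variables. -/
def GoodL {V : Type} : Set V → List (V × Set V) → Prop
  | F, [] => F.Finite
  | F, (z, X) :: l => F.Finite ∧ z ∈ F ∧ X ⊆ F ∧ z ∉ X ∧ GoodL X l

theorem GoodL.finite {V : Type} {F : Set V} {l : List (V × Set V)} (h : GoodL F l) : F.Finite := by
  cases l with
  | nil => exact h
  | cons p l => exact h.1

theorem GoodL.ovars_subset {V : Type} {F : Set V} {l : List (V × Set V)} (h : GoodL F l) :
    ovars l ⊆ F := by
  induction l generalizing F with
  | nil => simp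
  | cons p l ih =>
    intro x hx
    rcases mem_ovars_cons.1 hx with rfl | hx
    · exact h.2.1
    · exact h.2.2.1 (ih h.2.2.2.2 hx)

theorem GoodL.subset {V : Type} {F : Set V} {l : List (V × Set V)} (h : GoodL F l) :
    ∀ p ∈ l, p.2 ⊆ F := by
  induction l generalizing F with
  | nil => simp
  | cons q l ih =>
    intro p hp
    rcases List.mem_cons.1 hp with rfl | hp
    · exact h.2.2.1
    · exact (ih h.2.2.2.2 p hp).trans h.2.2.1

namespace Hy

variable {U V W : Type}

def Good (a : Hy V) : Prop := GoodL a.known a.outs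

def Respects (a : Hy V) (σ : V → Term S V) : Prop :=
  ∀ p ∈ a.outs, σ p.1 = Term.var p.1 ∧ ∀ y ∈ p.2, p.1 ∉ (σ y).fv

def subst (a : Hy V) (σ : V → Term S V) : Hy V :=
  ⟨img σ a.known, a.outs.map fun p => (p.1, img σ p.2)⟩

def map (f : V → W) (a : Hy V) : Hy W := ⟨f '' a.known, a.outs.map fun p => (f p.1, f '' p.2)⟩

/-- The history under a binder, where the bound variable is the first input. -/
def up (a : Hy V) : Hy (Option V) := ⟨upS a.known, a.outs.map fun p => (some p.1, upS p.2)⟩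

/-- The history after a transition with a given label. -/
def after (a : Hy V) : NLab S W → V → Hy V
  | .tau, _ => a
  | .out _, x => ⟨insert x a.known, (x, a.known) :: a.outs⟩
  | .inp _, x => ⟨insert x a.known, a.outs⟩

/-- `b` has the same outputs as `a`, and more known variables. -/
instance : LE (Hy V) :=
  ⟨fun a b => a.known ⊆ b.known ∧ List.Forall₂ (fun p q => p.1 = q.1 ∧ p.2 ⊆ q.2) a.outs b.outs⟩

theorem le_refl (a : Hy V) : a ≤ a :=
  ⟨subset_rfl, List.forall₂_same.2 fun _ _ => ⟨rfl, subset_rfl⟩⟩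

theorem le_of_map {a b : Hy V} (hk : a.known ⊆ b.known) {ι : Type*} {l : List ι}
    {f g : ι → V × Set V} (ha : a.outs = l.map f) (hb : b.outs = l.map g)
    (h : ∀ i ∈ l, (f i).1 = (g i).1 ∧ (f i).2 ⊆ (g i).2) : a ≤ b := by
  refine ⟨hk, ?_⟩
  rw [ha, hb, List.forall₂_map_left_iff, List.forall₂_map_right_iff]
  exact List.forall₂_same.2 h

theorem ovars_eq_of_le {l l' : List (V × Set V)}
    (h : List.Forall₂ (fun p q => p.1 = q.1 ∧ p.2 ⊆ q.2) l l') : ovars l = ovars l' := by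
  induction h with
  | nil => rfl
  | cons h _ ih => ext x; rw [mem_ovars_cons, mem_ovars_cons, h.1, ih]

/-- More variables known before an output mean more constraints on `σ`. This is why known sets may
be enlarged in a bisimilarity. -/
theorem Respects.of_le {a b : Hy V} (hab : a ≤ b) {σ : V → Term S V} (h : b.Respects σ) :
    a.Respects σ := by
  obtain ⟨-, hab⟩ := hab
  unfold Respects at *
  generalize a.outs = l, b.outs = l' at *
  induction hab with
  | nil => simp
  | cons h1 _ ih =>
    intro p hp
    rcases List.mem_cons.1 hp with rfl | hp
    · rw [h1.1]
      have := h _ List.mem_cons_self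
      exact ⟨this.1, fun y hy => this.2 y (h1.2 hy)⟩
    · exact ih (fun p hp => h p (List.mem_cons_of_mem _ hp)) p hp

theorem after_le {a b : Hy V} (hab : a ≤ b) (κ : NLab S W) (x : V) : a.after κ x ≤ b.after κ x := by
  cases κ with
  | tau => exact hab
  | out M => exact ⟨Set.insert_subset_insert hab.1, .cons ⟨rfl, hab.1⟩ hab.2⟩
  | inp M => exact ⟨Set.insert_subset_insert hab.1, hab.2⟩

theorem after_subst_label (a : Hy V) (κ : NLab S W) (σ : W → Term S U) (x : V) :
    a.after (κ.subst σ) x = a.after κ x := by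
  cases κ <;> rfl

theorem after_map_label (a : Hy V) (κ : NLab S W) (f : W → U) (x : V) :
    a.after (κ.map f) x = a.after κ x := a.after_subst_label κ _ x

theorem upS_insert (X : Set V) (x : V) : upS (insert x X) = insert (some x) (upS X) := by
  ext y; cases y <;> simp

theorem up_after (a : Hy V) (κ : NLab S W) (x : V) :
    (a.after κ x).up = a.up.after κ (some x) := by
  cases κ <;> simp [after, up, upS_insert]

theorem map_after (a : Hy V) (κ : NLab S W) (x : V) (f : V → U) :
    (a.after κ x).map f = (a.map f).after κ (f x) := by
  cases κ <;> simp [after, map, Set.image_insert_eq]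

theorem img_lift (σ : V → Term S W) (X : Set V) : img (lift σ) (upS X) = upS (img σ X) := by
  ext y
  cases y with
  | none => simpa [img] using ⟨none, by simp⟩
  | some y =>
    simp only [some_mem_upS]
    constructor
    · rintro ⟨z, hz, hy⟩
      obtain ⟨z, rfl, h⟩ := some_mem_fv_lift.1 hy
      exact ⟨z, by simpa using hz, h⟩
    · rintro ⟨z, hz, hy⟩
      exact ⟨some z, by simpa using hz, by simpa using hy⟩

theorem up_subst (a : Hy V) (σ : V → Term S V) : (a.subst σ).up = a.up.subst (lift σ) := by
  simp [subst, up, img_lift]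

theorem Respects.up {a : Hy V} {σ : V → Term S V} (h : a.Respects σ) : a.up.Respects (lift σ) := by
  intro p hp
  simp only [Hy.up, List.mem_map] at hp
  obtain ⟨p, hp, rfl⟩ := hp
  refine ⟨by simp [(h p hp).1], fun y hy hm => ?_⟩
  obtain ⟨z, rfl, hz⟩ := some_mem_fv_lift.1 hm
  exact (h p hp).2 z (by simpa using hy) hz

theorem map_up (a : Hy V) (f : V → W) : (a.map f).up = a.up.map (Option.map f) := by
  have (X : Set V) : upS (f '' X) = Option.map f '' upS X := by
    ext y; cases y <;> simp [upS]
  simp [map, up, this]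

theorem up_le {a b : Hy V} (h : a ≤ b) : a.up ≤ b.up := by
  refine ⟨upS_mono h.1, ?_⟩
  simp only [Hy.up, List.forall₂_map_left_iff, List.forall₂_map_right_iff]
  exact h.2.imp fun p q h => ⟨congrArg some h.1, upS_mono h.2⟩

theorem subst_le {a b : Hy V} (h : a ≤ b) (σ : V → Term S V) : a.subst σ ≤ b.subst σ := by
  refine ⟨img_mono σ h.1, ?_⟩
  simp only [Hy.subst, List.forall₂_map_left_iff, List.forall₂_map_right_iff]
  exact h.2.imp fun p q h => ⟨h.1, img_mono σ h.2⟩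

theorem map_le_up (a : Hy V) : a.map some ≤ a.up :=
  le_of_map (fun x hx => Or.inr hx) rfl rfl fun _ _ => ⟨rfl, fun x hx => Or.inr hx⟩

theorem ovars_map {ι : Type*} {l : List (V × Set V)} {g : V × Set V → ι → Set W} {f : V → W} {i : ι} :
    ovars (l.map fun p => (f p.1, g p i)) = f '' ovars l := by
  ext x; simp only [ovars, List.mem_map, Set.mem_image, Set.mem_ofPred_eq]
  constructor
  · rintro ⟨_, ⟨p, hp, rfl⟩, rfl⟩; exact ⟨_, ⟨p, hp, rfl⟩, rfl⟩
  · rintro ⟨_, ⟨p, hp, rfl⟩, rfl⟩; exact ⟨_, ⟨p, hp, rfl⟩, rfl⟩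

theorem ovars_hmap (a : Hy V) (f : V → W) : ovars (a.map f).outs = f '' ovars a.outs :=
  ovars_map (ι := Unit) (g := fun p _ => f '' p.2) (i := ())

theorem ovars_up (a : Hy V) : ovars a.up.outs = some '' ovars a.outs :=
  ovars_map (ι := Unit) (g := fun p _ => upS p.2) (i := ())

theorem ovars_subst (a : Hy V) (σ : V → Term S V) : ovars (a.subst σ).outs = ovars a.outs := by
  have := ovars_map (ι := Unit) (l := a.outs) (f := id) (g := fun p _ => img σ p.2) (i := ())
  simpa [Hy.subst] using this

theorem Good.map {a : Hy V} (h : a.Good) {f : V → W} (hf : f.Injective) : (a.map f).Good := by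
  obtain ⟨F, l⟩ := a
  simp only [Good, Hy.map] at h ⊢
  induction l generalizing F with
  | nil => exact Set.Finite.image f h
  | cons p l ih =>
    refine ⟨h.1.image f, Set.mem_image_of_mem f h.2.1, Set.image_mono h.2.2.1, ?_, ih _ h.2.2.2.2⟩
    rintro ⟨y, hy, he⟩
    exact h.2.2.2.1 (hf he ▸ hy)

theorem upS_finite {X : Set V} : (upS X).Finite ↔ X.Finite := by
  constructor
  · intro h
    exact (h.preimage (Option.some_injective _).injOn).subset fun x hx => some_mem_upS.2 hx
  · intro h
    exact (h.image some).insert none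

theorem upS_subset {X Y : Set V} : upS X ⊆ upS Y ↔ X ⊆ Y :=
  ⟨fun h x hx => some_mem_upS.1 (h (some_mem_upS.2 hx)), upS_mono⟩

theorem good_up {a : Hy V} : a.up.Good ↔ a.Good := by
  obtain ⟨F, l⟩ := a
  simp only [Good, Hy.up]
  induction l generalizing F with
  | nil => exact upS_finite
  | cons p l ih => simp only [List.map_cons, GoodL, upS_finite, some_mem_upS, ih, upS_subset]

/-- A respectful `σ` fixes each output variable, which thus stays known, and keeps it out of the
images of the variables known earlier. -/
theorem Good.subst {a : Hy V} (h : a.Good) {σ : V → Term S V} (hσ : a.Respects σ) :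
    (a.subst σ).Good := by
  obtain ⟨F, l⟩ := a
  simp only [Good, Hy.subst, Respects] at h hσ ⊢
  induction l generalizing F with
  | nil => exact img_finite σ h
  | cons p l ih =>
    have hp := hσ p List.mem_cons_self
    refine ⟨img_finite σ h.1, ⟨p.1, h.2.1, by rw [hp.1]; rfl⟩, img_mono σ h.2.2.1, ?_,
      ih _ h.2.2.2.2 fun q hq => hσ q (List.mem_cons_of_mem _ hq)⟩
    rintro ⟨y, hy, he⟩
    exact hp.2 y hy he

theorem Good.after {a : Hy V} (h : a.Good) (κ : NLab S W) {x : V} (hx : x ∉ a.known) :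
    (a.after κ x).Good := by
  cases κ with
  | tau => exact h
  | out M => exact ⟨h.finite.insert x, Set.mem_insert _ _, Set.subset_insert _ _, hx, h⟩
  | inp M =>
    obtain ⟨F, l⟩ := a
    cases l with
    | nil => exact Set.Finite.insert x h
    | cons p l =>
      exact ⟨h.1.insert x, Or.inr h.2.1, h.2.2.1.trans (Set.subset_insert _ _), h.2.2.2⟩

end Hy

/-! ### Well-formed extended processes -/

/-- The active substitution `θ` has the output variables `l`; its messages contain only variables
known at the time of the output, and none of the variables `O`. -/
def FrameWF {V : Type} (O : Set V) (l : List (V × Set V)) (θ : Frame S V) : Prop :=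
  List.Forall₂ (fun p q => p.1 = q.1 ∧ p.2.fv ⊆ q.2 \ O) θ l

/-- `A` is in normal form and its variables are those of the history. -/
def Ext.WF : {V : Type} → Hy V → Ext S V → Prop
  | _, a, base θ P => a.Good ∧ FrameWF (ovars a.outs) a.outs θ ∧ P.fv ⊆ a.known \ ovars a.outs
  | _, a, nu A => A.WF a.up

namespace FrameWF

variable {V W : Type} {O : Set V} {l : List (V × Set V)} {θ : Frame S V}

theorem dom_eq (h : FrameWF O l θ) : θ.dom = ovars l := by
  induction h with
  | nil => ext; simp [Frame.dom]
  | cons h _ ih => ext x; rw [Frame.mem_dom_cons, mem_ovars_cons, ih, h.1]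

theorem mono {l' : List (V × Set V)} (h : FrameWF O l θ)
    (hl : List.Forall₂ (fun p q => p.1 = q.1 ∧ p.2 ⊆ q.2) l l') : FrameWF O l' θ := by
  induction hl generalizing θ with
  | nil => exact h
  | cons h1 _ ih =>
    cases h with
    | cons h2 h3 =>
      exact .cons ⟨h2.1.trans h1.1, h2.2.trans (Set.sdiff_subset_sdiff_left h1.2)⟩ (ih h3)

theorem rename {O' : Set W} {f : V → W} {g : Set V → Set W} (hg : ∀ X, f '' X ⊆ g X)
    (hO : ∀ x, f x ∈ O' → x ∈ O) (h : FrameWF O l θ) :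
    FrameWF O' (l.map fun p => (f p.1, g p.2)) (θ.rename f) := by
  unfold FrameWF Frame.rename
  rw [List.forall₂_map_left_iff, List.forall₂_map_right_iff]
  refine h.imp fun p q h => ⟨congrArg f h.1, fun x hx => ?_⟩
  obtain ⟨y, hy, rfl⟩ := Term.mem_fv_map.1 hx
  exact ⟨hg _ ⟨y, (h.2 hy).1, rfl⟩, fun ho => (h.2 hy).2 (hO y ho)⟩

theorem rename_some (h : FrameWF O l θ) :
    FrameWF (some '' O) (l.map fun p => (some p.1, upS p.2)) (θ.rename some) :=
  h.rename (fun X x hx => Or.inr hx) (by simp)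

theorem fv_app (h : FrameWF (ovars l) l θ) {F : Set V} (hF : GoodL F l) {v : V} (hv : v ∈ F) :
    (θ.app v).fv ⊆ F \ ovars l := by
  by_cases hd : v ∈ θ.dom
  · have hm := Frame.app_mem hd
    generalize θ.app v = N at hm
    -- The excluded set is separated from `ovars l`, since it must stay fixed while the induction
    -- shortens `l`.
    have : ∀ O, FrameWF O l θ → (v, N) ∈ θ → N.fv ⊆ F \ O := by
      clear h hd hv hm
      intro O h hm
      induction h generalizing F with
      | nil => simp at hm
      | cons h _ ih =>
        rcases List.mem_cons.1 hm with rfl | hm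
        · exact h.2.trans (Set.sdiff_subset_sdiff_left hF.2.2.1)
        · exact (ih hF.2.2.2.2 hm).trans (Set.sdiff_subset_sdiff_left hF.2.2.1)
    exact this _ h hm
  · rw [Frame.app_of_notMem hd]
    rintro x rfl
    exact ⟨hv, by rwa [← h.dom_eq]⟩

theorem dom_subst (σ : V → Term S V) (θ : Frame S V) : (θ.subst σ).dom = θ.dom := by
  induction θ with
  | nil => rfl
  | cons p θ ih => obtain ⟨y, M⟩ := p; ext x; simp only [Frame.subst, Frame.mem_dom_cons, ih]

/-- The set `O` stays fixed while the list shrinks. The hypothesis `hO` records what remains true of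
an output already passed: its variable does not occur in the image of what was known before it,
because `σ` respects the history. The second conclusion is what makes the next entry avoid `O`. -/
theorem subst {σ : V → Term S V} {F : Set V} (h : FrameWF O l θ) (hF : GoodL F l)
    (hσ : ∀ p ∈ l, σ p.1 = Term.var p.1 ∧ ∀ y ∈ p.2, p.1 ∉ (σ y).fv)
    (hO : ∀ w ∈ O, w ∈ ovars l ∨ w ∉ img σ F) :
    FrameWF O (l.map fun p => (p.1, img σ p.2)) (θ.subst σ) ∧
      ∀ v ∈ img σ F, ((θ.subst σ).app v).fv ⊆ img σ F \ O := by
  induction h generalizing F with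
  | nil =>
    refine ⟨.nil, ?_⟩
    rintro v hv x rfl
    exact ⟨hv, fun hx => (hO x hx).elim (by simp) fun h => h hv⟩
  | @cons p q θ l h1 h2 ih =>
    obtain ⟨z, M⟩ := p
    obtain ⟨z', X⟩ := q
    obtain ⟨rfl, h1⟩ := h1
    have hz := hσ _ List.mem_cons_self
    have hXF := img_mono σ hF.2.2.1
    obtain ⟨ih1, ih2⟩ := ih hF.2.2.2.2 (fun p hp => hσ p (List.mem_cons_of_mem _ hp)) (by
      intro w hw
      rcases hO w hw with h | h
      · rcases mem_ovars_cons.1 h with rfl | h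
        · exact Or.inr fun ⟨y, hy, hm⟩ => hz.2 y hy hm
        · exact Or.inl h
      · exact Or.inr fun hm => h (hXF hm))
    have hM : ((M.subst σ).subst (Frame.app (Frame.subst σ θ))).fv ⊆ img σ X \ O := by
      intro x hx
      obtain ⟨v, hv, hx⟩ := Term.mem_fv_subst.1 hx
      obtain ⟨y, hy, hv⟩ := Term.mem_fv_subst.1 hv
      exact ih2 v ⟨y, (h1 hy).1, hv⟩ hx
    refine ⟨.cons ⟨rfl, hM⟩ ih1, fun v hv => ?_⟩
    simp only [Frame.subst]
    by_cases hvz : v = z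
    · rw [hvz, Frame.app_cons_self]
      exact hM.trans (Set.sdiff_subset_sdiff_left hXF)
    · rw [Frame.app_cons_ne _ _ hvz]
      by_cases hvX : v ∈ img σ X
      · exact (ih2 v hvX).trans (Set.sdiff_subset_sdiff_left hXF)
      · have hvl : v ∉ ovars l := by
          intro hvl
          refine hvX ⟨v, GoodL.ovars_subset hF.2.2.2.2 hvl, ?_⟩
          obtain ⟨p, hp, rfl⟩ := hvl
          rw [(hσ p (List.mem_cons_of_mem _ hp)).1]
          rfl
        rw [Frame.app_of_notMem (by rw [dom_subst, dom_eq h2]; exact hvl)]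
        rintro x rfl
        refine ⟨hv, fun hx => ?_⟩
        rcases hO x hx with h | h
        · rcases mem_ovars_cons.1 h with h | h
          · exact hvz h
          · exact hvl h
        · exact h hv

/-- The application of a substitution to an active substitution is fully applied. -/
theorem app_subst {σ : V → Term S V} {F : Set V} (h : FrameWF O l θ) (hF : GoodL F l)
    (hσ : ∀ p ∈ l, σ p.1 = Term.var p.1 ∧ ∀ y ∈ p.2, p.1 ∉ (σ y).fv) (v : V) :
    ((θ.app v).subst σ).subst (θ.subst σ).app = (σ v).subst (θ.subst σ).app := by
  induction h generalizing F with
  | nil => rfl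
  | @cons p q θ l h1 h2 ih =>
    obtain ⟨z, M⟩ := p
    obtain ⟨z', X⟩ := q
    obtain ⟨rfl, h1⟩ := h1
    have hz := hσ _ List.mem_cons_self
    -- The newest output variable does not occur in the image of a message over the variables known
    -- before it, so its entry has no effect there.
    have drop {K : Term S V} (hK : K.fv ⊆ X) {N : Term S V} :
        (K.subst σ).subst (Frame.app ((z, N) :: Frame.subst σ θ)) =
          (K.subst σ).subst (Frame.app (Frame.subst σ θ)) := by
      refine Term.subst_congr fun w hw => Frame.app_cons_ne _ _ ?_
      rintro rfl
      obtain ⟨y, hy, hw⟩ := Term.mem_fv_subst.1 hw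
      exact hz.2 y (hK hy) hw
    simp only [Frame.subst]
    by_cases hvz : v = z
    · subst hvz
      rw [Frame.app_cons_self, drop (h1.trans Set.sdiff_subset), hz.1, Term.subst_var_apply,
        Frame.app_cons_self]
    · rw [Frame.app_cons_ne _ _ hvz]
      by_cases hd : v ∈ Frame.dom θ
      · have hv : v ∈ ovars l := by rwa [← dom_eq h2]
        have hK : (Frame.app θ v).fv ⊆ X := by
          have hm := Frame.app_mem hd
          generalize Frame.app θ v = N at hm
          have hF' := hF.2.2.2.2
          clear ih hF hv hd drop hz hσ h1
          induction h2 generalizing X with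
          | nil => simp at hm
          | cons h _ ih =>
            rcases List.mem_cons.1 hm with rfl | hm
            · exact (h.2.trans Set.sdiff_subset).trans hF'.2.2.1
            · exact (ih _ hm hF'.2.2.2.2).trans hF'.2.2.1
        rw [drop hK, ih hF.2.2.2.2 fun p hp => hσ p (List.mem_cons_of_mem _ hp)]
        obtain ⟨p, hp, rfl⟩ := hv
        rw [(hσ p (List.mem_cons_of_mem _ hp)).1, Term.subst_var_apply, Term.subst_var_apply,
          Frame.app_cons_ne _ _ hvz]
      · rw [Frame.app_of_notMem hd, Term.subst_var_apply]

end FrameWF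

namespace Ext

variable {U V W : Type}

theorem WF.good {a : Hy V} {A : Ext S V} (h : A.WF a) : a.Good := by
  induction A with
  | base θ P => exact h.1
  | nu A ih => exact Hy.good_up.1 (ih h)

theorem WF.mono {a b : Hy V} {A : Ext S V} (h : A.WF a) (hab : a ≤ b) (hb : b.Good) : A.WF b := by
  induction A with
  | base θ P =>
    have ho := Hy.ovars_eq_of_le hab.2
    refine ⟨hb, ?_, ?_⟩
    · rw [← ho]; exact h.2.1.mono hab.2
    · rw [← ho]; exact h.2.2.trans (Set.sdiff_subset_sdiff_left hab.1)
  | nu A ih => exact ih h (Hy.up_le hab) (Hy.good_up.2 hb)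

theorem map_map (A : Ext S V) (f : V → W) (g : W → U) :
    (A.map f).map g = A.map (fun x => g (f x)) := by
  induction A generalizing W U with
  | base θ P => simp [map, Frame.rename_rename, Proc.map_map]
  | nu A ih => simp only [map, ih]; congr 2; funext x; cases x <;> rfl

theorem map_congr {A : Ext S V} {f g : V → W} (h : ∀ x ∈ A.fv, f x = g x) : A.map f = A.map g := by
  induction A generalizing W with
  | base θ P =>
    simp only [map, Frame.rename_congr fun x hx => h x (Or.inl hx)]
    congr 1
    exact Proc.subst_congr fun x hx => congrArg Term.var (h x (Or.inr hx))
  | nu A ih =>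
    simp only [map]
    rw [ih]
    intro x hx
    cases x with
    | none => rfl
    | some x => exact congrArg some (h x hx)

theorem map_id (A : Ext S V) : A.map (fun x => x) = A := by
  induction A with
  | base θ P => simp only [map, Frame.rename_id]; congr 1; exact Proc.subst_var P
  | nu A ih =>
    simp only [map]
    rw [show Option.map (fun x => x) = (fun x => x) from funext fun x => by cases x <;> rfl, ih]

theorem WF.map {a : Hy V} {A : Ext S V} (h : A.WF a) {f : V → W} (hf : f.Injective) :
    (A.map f).WF (a.map f) := by
  induction A generalizing W with
  | base θ P =>
    refine ⟨h.1.map hf, ?_, ?_⟩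
    · rw [Hy.ovars_hmap]
      exact h.2.1.rename (g := fun X => f '' X) (fun X => subset_rfl) fun x ⟨y, hy, he⟩ => hf he ▸ hy
    · rw [Hy.ovars_hmap]
      intro x hx
      obtain ⟨y, hy, rfl⟩ := Proc.mem_fv_map.1 hx
      exact ⟨⟨y, (h.2.2 hy).1, rfl⟩, fun ⟨z, hz, he⟩ => (h.2.2 hy).2 (hf he ▸ hz)⟩
  | nu A ih =>
    simp only [Ext.map, WF]
    rw [Hy.map_up]
    exact ih h (Option.map_injective hf)

theorem WF.fv_subset {a : Hy V} {A : Ext S V} (h : A.WF a) : A.fv ⊆ a.known := by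
  induction A with
  | base θ P =>
    obtain ⟨hg, hθ, hP⟩ := h
    rintro x (⟨p, hp, hx⟩ | hx)
    · rcases hx with rfl | hx
      · exact hg.ovars_subset (hθ.dom_eq ▸ ⟨p.2, hp⟩)
      · have : ∀ O l F, GoodL F l → FrameWF O l θ → p.2.fv ⊆ F := by
          intro O l F hF h
          clear hg hθ hP
          induction h generalizing F with
          | nil => simp at hp
          | cons h _ ih =>
            rcases List.mem_cons.1 hp with rfl | hp
            · exact (h.2.trans Set.sdiff_subset).trans hF.2.2.1
            · exact (ih hp _ hF.2.2.2.2).trans hF.2.2.1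
        exact this _ _ _ hg hθ hx
    · exact (hP hx).1
  | nu A ih => exact fun x hx => some_mem_upS.1 (ih h hx)

theorem WF.dom_eq {a : Hy V} {A : Ext S V} (h : A.WF a) : A.dom = ovars a.outs := by
  induction A with
  | base θ P => exact h.2.1.dom_eq
  | nu A ih => ext x; simp [dom, ih h, Hy.ovars_up]

theorem WF.normal {a : Hy V} {A : Ext S V} (h : A.WF a) : A.Normal := by
  induction A with
  | base θ P =>
    obtain ⟨hg, hθ, hP⟩ := h
    refine ⟨?_, fun x hx => ⟨fun hm => ?_, fun y hm => ?_⟩⟩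
    · have : ∀ O l F, GoodL F l → FrameWF O l θ → (List.map Prod.fst θ).Nodup := by
        intro O l F hF h
        clear hg hθ hP
        induction h generalizing F with
        | nil => simp
        | @cons p q θ l h h2 ih =>
          rw [List.map_cons, List.nodup_cons]
          refine ⟨fun hm => hF.2.2.2.1 ?_, ih _ hF.2.2.2.2⟩
          obtain ⟨p', hp', he⟩ := List.mem_map.1 hm
          refine GoodL.ovars_subset hF.2.2.2.2 ?_
          rw [← FrameWF.dom_eq h2]
          exact ⟨p'.2, by rw [← h.1, ← he]; exact hp'⟩
      exact this _ _ _ hg hθ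
    · exact (hP hm).2 (hθ.dom_eq ▸ hx)
    · by_cases hy : y ∈ θ.dom
      · exact (hθ.fv_app hg (hg.ovars_subset (hθ.dom_eq ▸ hy)) hm).2 (hθ.dom_eq ▸ hx)
      · rw [Frame.app_of_notMem hy] at hm
        obtain rfl : x = y := hm
        exact hy hx
  | nu A ih =>
    refine ⟨?_, ih h⟩
    rw [dom_eq (a := a.up) h, Hy.ovars_up]
    simp

theorem WF.subst {a : Hy V} {A : Ext S V} (h : A.WF a) {σ : V → Term S V} (hσ : a.Respects σ) :
    (A.subst σ).WF (a.subst σ) := by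
  induction A with
  | base θ P =>
    obtain ⟨hg, hθ, hP⟩ := h
    obtain ⟨h1, h2⟩ := hθ.subst hg hσ fun w hw => Or.inl hw
    refine ⟨hg.subst hσ, by rwa [Hy.ovars_subst], ?_⟩
    rw [Hy.ovars_subst]
    intro x hx
    obtain ⟨v, hv, hx⟩ := Proc.mem_fv_subst.1 hx
    obtain ⟨y, hy, hv⟩ := Proc.mem_fv_subst.1 hv
    exact h2 v ⟨y, (hP hy).1, hv⟩ hx
  | nu A ih =>
    simp only [Ext.subst, WF]
    rw [Hy.up_subst]
    exact ih h hσ.up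

end Ext

/-! ### Transitions of extended processes with nameless labels -/

/-- Transitions of extended processes; `x` is the bound variable of the label. -/
def Ext.XStep (Ax : Term S Name → Term S Name → Prop) :
    {V : Type} → Ext S V → NLab S V → V → Ext S V → Prop
  | _, base θ P, μ, x, A' => ∃ C, RStep Ax Term.var P (μ.subst θ.app) C ∧ A' = C.toExt θ x
  | _, nu A, μ, x, A' => ∃ A1, A.XStep Ax (μ.map some) (some x) A1 ∧ A' = nu A1

section XStep

variable {Ax : Term S Name → Term S Name → Prop} {U V W : Type}

/-- Results use only variables of the source, and the label's variable is new. An output therefore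
contributes a newest entry over the old known set, and an input a new known variable. -/
theorem Con.toExt_wf {a : Hy V} {C : Con S V} {θ : Frame S V} {κ : NLab S W} {x : V}
    (ha : a.Good) (hθ : FrameWF (ovars a.outs) a.outs θ) (hC : C.fv ⊆ a.known \ ovars a.outs)
    (hκ : C.Fits κ) (hx : x ∉ a.known) : (C.toExt θ x).WF (a.after κ x) := by
  induction C with
  | base c =>
    have hxo : x ∉ ovars a.outs := fun h => hx (ha.ovars_subset h)
    cases c <;> cases κ <;> try exact hκ.elim
    · exact ⟨ha, hθ, hC⟩
    · rename_i N P M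
      have key : ∀ y ∈ a.known \ ovars a.outs, y ∉ ovars (a.after (NLab.out M) x).outs := by
        rintro y hy hm
        rcases mem_ovars_cons.1 hm with rfl | hm
        · exact hx hy.1
        · exact hy.2 hm
      refine ⟨ha.after _ hx, .cons ⟨rfl, fun y hy => ⟨(hC (Or.inl hy)).1, key y (hC (Or.inl hy))⟩⟩ ?_,
        fun y hy => ⟨Or.inr (hC (Or.inr hy)).1, key y (hC (Or.inr hy))⟩⟩
      -- The new output variable joins the excluded set; older messages avoid it because it was not
      -- known to them.
      have : ∀ F l, GoodL F l → x ∉ F → ∀ O, FrameWF O l θ → FrameWF (insert x O) l θ := by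
        intro F l hF hxF O h
        clear hθ hC hκ key
        induction h generalizing F with
        | nil => exact .nil
        | cons h _ ih =>
          refine .cons ⟨h.1, fun y hy => ⟨(h.2 hy).1, ?_⟩⟩
            (ih _ hF.2.2.2.2 fun hm => hxF (hF.2.2.1 hm))
          rintro (rfl | hm)
          · exact hxF (hF.2.2.1 (h.2 hy).1)
          · exact (h.2 hy).2 hm
      have := this _ _ ha hx _ hθ
      rwa [show insert x (ovars a.outs) = ovars (a.after (NLab.out M) x).outs from
        Set.ext fun y => (mem_ovars_cons (p := (x, a.known))).symm] at this
    · rename_i P M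
      refine ⟨ha.after _ hx, hθ, fun y hy => ?_⟩
      obtain ⟨z, hz, hy⟩ := Proc.mem_fv_subst.1 hy
      cases z with
      | none =>
        obtain rfl : y = x := hy
        exact ⟨Or.inl rfl, hxo⟩
      | some z =>
        obtain rfl : y = z := hy
        exact ⟨Or.inr (hC hz).1, (hC hz).2⟩
  | nu C ih =>
    simp only [toExt, Ext.WF]
    rw [Hy.up_after]
    refine ih (Hy.good_up.2 ha) ?_ ?_ (by cases κ <;> exact hκ) (by simpa [Hy.up] using hx)
    · rw [Hy.ovars_up]; exact hθ.rename_some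
    · rw [Hy.ovars_up]
      intro y hy
      cases y with
      | none => simp [Hy.up]
      | some y => simpa [Hy.up] using hC hy

namespace Ext

theorem WF.step {a : Hy V} {A A' : Ext S V} {μ : NLab S V} {x : V} (h : A.WF a)
    (hs : A.XStep Ax μ x A') (hx : x ∉ a.known) : A'.WF (a.after μ x) := by
  induction A with
  | base θ P =>
    obtain ⟨C, hC, rfl⟩ := hs
    rw [← Hy.after_subst_label]
    exact Con.toExt_wf h.1 h.2.1 (hC.fv_subset.trans h.2.2) hC.fits hx
  | nu A ih =>
    obtain ⟨A1, h1, rfl⟩ := hs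
    have := ih (a := a.up) h h1 (by simpa [Hy.up] using hx)
    rwa [Hy.after_map_label, ← Hy.up_after] at this

theorem XStep.map {A A' : Ext S V} {μ : NLab S V} {x : V} (h : A.XStep Ax μ x A') {f : V → W}
    (hf : f.Injective) : (A.map f).XStep Ax (μ.map f) (f x) (A'.map f) := by
  induction A generalizing W with
  | base θ P =>
    obtain ⟨C, hC, rfl⟩ := h
    refine ⟨C.map f, ?_, Con.toExt_map _ _ _ _⟩
    have := RStep.to_subst (hC.inst fun y => Term.var (f y)) (θ := fun y => Term.var (f y))
      (σ := Term.var) rfl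
    rw [NLab.map_subst]
    simp only [Frame.app_rename hf]
    rw [NLab.subst_subst] at this
    exact this
  | nu A ih =>
    obtain ⟨A1, h1, rfl⟩ := h
    refine ⟨_, ?_, rfl⟩
    have := ih h1 (Option.map_injective hf)
    rwa [NLab.map_map] at this ⊢

end Ext

theorem PStep.label_fresh {P : Proc S V} {π : Label S V} {A : Ext S V} (h : PStep Ax P π A) :
    ∀ x ∈ π.bn, x ∉ π.strip.fv := by
  induction h with
  | inp _ hx => rintro x rfl h; exact hx (Or.inl h)
  | out _ hx => rintro x rfl h; exact hx (Or.inl h)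
  | sumL _ ih => exact ih
  | sumR _ ih => exact ih
  | mat _ _ ih => exact ih
  | res _ ih =>
    intro x hx hm
    refine ih _ (Label.bn_map hx) ?_
    rw [Label.strip_map]
    exact (NLab.map_mem_fv_map (Option.some_injective _)).2 hm
  | parL _ _ ih => exact ih
  | parR _ _ ih => exact ih
  | repAct _ _ ih => exact ih
  | closeL => exact fun x hx => hx.elim
  | closeR => exact fun x hx => hx.elim
  | repClose => exact fun x hx => hx.elim

theorem Label.strip_subst (π : Label S V) (σ : V → Term S V) :
    (π.subst σ).strip = π.strip.subst σ := by
  cases π <;> rfl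

theorem Label.bn_subst (π : Label S V) (σ : V → Term S V) : (π.subst σ).bn = π.bn := by
  cases π <;> rfl

theorem Label.at_subst {π : Label S V} {x : V} (h : π.At x) (σ : V → Term S V) :
    (π.subst σ).At x := by
  cases π <;> exact h

/-- The second conclusion recovers freshness of the bound variable for the unevaluated subject: the
active substitution fixes that variable, so an occurrence in the subject would survive evaluation.
-/
theorem EStep.to_xstep {A A' : Ext S V} {π : Label S V} (h : EStep Ax A π A') {x : V}
    (hx : π.At x) : A.XStep Ax π.strip x A' ∧ (x ∈ π.bn → x ∉ π.strip.fv) := by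
  induction h with
  | act h hf =>
    obtain ⟨C, hC, h1, -⟩ := h.to_rstep
    rw [Label.strip_subst] at hC
    refine ⟨⟨C, hC, ?_⟩, fun hb hm => ?_⟩
    · rw [h1 x (Label.at_subst hx _), Con.toExt_activate]; rfl
    · refine h.label_fresh x (by rwa [Label.bn_subst]) ?_
      rw [Label.strip_subst, NLab.mem_fv_subst]
      exact ⟨x, hm, by rw [hf.1 x hb]; rfl⟩
  | res _ ih =>
    obtain ⟨h1, h2⟩ := ih (hx.map some)
    rw [Label.strip_map] at h1 h2
    refine ⟨⟨_, h1, rfl⟩, fun hb hm => h2 (Label.bn_map hb) ?_⟩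
    exact (NLab.map_mem_fv_map (Option.some_injective _)).2 hm

/-- Freshness for `A` covers the domain and messages of the active substitution, so evaluating the
label cannot introduce `x`. This gives the side conditions of both layers of transitions. -/
theorem Ext.XStep.to_estep [hV : Infinite V] {A A' : Ext S V} {μ : NLab S V} {x : V}
    (h : A.XStep Ax μ x A') (hx : x ∉ A.fv) (hμ : x ∉ μ.fv) : EStep Ax A (μ.at x) A' := by
  revert hV
  induction A with
  | base θ P =>
    intro hV
    obtain ⟨C, hC, rfl⟩ := h
    have hθ : x ∉ θ.fv := fun h => hx (Or.inl h)
    have key : ∀ y, x ∈ (θ.app y).fv → x = y := fun y hy =>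
      (Frame.fv_app_subset hy).resolve_right hθ
    have hs := hC.to_pstep rfl x (fun h => hx (Or.inr h)) (by
      rw [NLab.mem_fv_subst]
      rintro ⟨y, hy, hm⟩
      exact hμ (key y hm ▸ hy))
    have := Con.toExt_activate C [] θ x
    rw [List.nil_append] at this
    rw [← this]
    refine EStep.act (by rwa [NLab.at_subst]) ⟨fun y hy => ?_, fun y hy => ?_⟩
    · obtain rfl := μ.at_bn_subset x hy
      exact Frame.app_of_notMem fun h => hθ (θ.dom_subset_fv h)
    · ext z
      simp only [Set.mem_inter_iff, Set.mem_empty_iff_false, iff_false, not_and]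
      intro hz hm
      obtain rfl := μ.at_bn_subset x hm
      exact hy (key y hz ▸ hm)
  | nu A ih =>
    intro hV
    obtain ⟨A1, h1, rfl⟩ := h
    refine .res ?_
    rw [NLab.at_map]
    exact ih h1 hx fun h => hμ ((NLab.map_mem_fv_map (Option.some_injective _)).1 h)

end XStep

/-! ### Application of substitutions and renamings to extended processes -/

section Rename

variable {Ax : Term S Name → Term S Name → Prop} {U V W : Type}

theorem lift_rename {f : V → W} {σ : V → Term S V} {τ : W → Term S W}
    (h : ∀ v, τ (f v) = (σ v).map f) (v : Option V) :
    lift τ (Option.map f v) = (lift σ v).map (Option.map f) := by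
  cases v with
  | none => rfl
  | some v => simp [h, Term.map_map]

theorem Frame.subst_rename {f : V → W} (hf : f.Injective) {σ : V → Term S V} {τ : W → Term S W}
    (h : ∀ v, τ (f v) = (σ v).map f) (θ : Frame S V) :
    Frame.subst τ (θ.rename f) = (Frame.subst σ θ).rename f := by
  induction θ with
  | nil => rfl
  | cons p θ ih =>
    obtain ⟨x, M⟩ := p
    have ih : Frame.subst τ (Frame.rename f θ) = (Frame.subst σ θ).rename f := ih
    simp only [Frame.rename_cons, Frame.subst, ih]
    congr 2
    simp only [Term.map_subst, Term.subst_map, Term.subst_subst, h, Frame.app_rename hf]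

theorem Proc.subst_rename {f : V → W} (hf : f.Injective) {σ : V → Term S V} {τ : W → Term S W}
    (h : ∀ v, τ (f v) = (σ v).map f) {θ : Frame S V} {θ' : Frame S W}
    (hθ : ∀ v, θ'.app (f v) = (θ.app v).map f) (P : Proc S V) :
    ((P.map f).subst τ).subst θ'.app = ((P.subst σ).subst θ.app).map f := by
  simp only [Proc.map_subst, Proc.subst_map, Proc.subst_subst, h, Term.map_subst, hθ,
    Term.subst_map]

theorem Ext.subst_rename (A : Ext S V) {f : V → W} (hf : f.Injective) {σ : V → Term S V}
    {τ : W → Term S W} (h : ∀ v, τ (f v) = (σ v).map f) :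
    (A.map f).subst τ = (A.subst σ).map f := by
  induction A generalizing W with
  | base θ P =>
    simp only [Ext.map, Ext.subst]
    rw [Frame.subst_rename hf h, Proc.subst_rename hf h (Frame.app_rename hf _)]
  | nu A ih =>
    simp only [Ext.map, Ext.subst]
    rw [ih (Option.map_injective hf) (lift_rename h)]

theorem Ext.equates_map {A : Ext S V} {f : V → W} (hf : f.Injective) [Nonempty V] {M N : Term S V} :
    (A.map f).Equates Ax (M.map f) (N.map f) ↔ A.Equates Ax M N := by
  rename_i hV
  revert hV
  induction A generalizing W with
  | base θ P =>
    intro hV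
    simp only [Ext.map, Ext.Equates, Term.map_subst, Frame.app_rename hf]
    rw [← Term.subst_map, ← Term.subst_map, EqE.map_iff hf]
  | nu A ih =>
    intro hV
    simp only [Ext.map, Ext.Equates]
    rw [← ih (Option.map_injective hf), Term.map_map, Term.map_map, Term.map_map, Term.map_map]
    rfl

end Rename

/-! ### Restricting the variable `none` at some place -/

/-- Exchange of the two outermost bound variables. -/
def swapO {V : Type} : Option (Option V) → Option (Option V)
  | none => some none
  | some none => none
  | some (some x) => some (some x)

@[simp] theorem swapO_swapO {V : Type} (x : Option (Option V)) : swapO (swapO x) = x := by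
  rcases x with _ | _ | x <;> rfl

theorem swapO_injective {V : Type} : (swapO : Option (Option V) → _).Injective :=
  fun x y h => by rw [← swapO_swapO x, h, swapO_swapO]

/-- `C` restricts the variable `none` of `A`, possibly under some of the restrictions of `A`. -/
inductive NuAt : {V : Type} → Ext S (Option V) → Ext S V → Prop
  | here {V : Type} {A : Ext S (Option V)} : NuAt A (Ext.nu A)
  | there {V : Type} {A : Ext S (Option (Option V))} {C : Ext S (Option V)} :
      NuAt (A.map swapO) C → NuAt (Ext.nu A) (Ext.nu C)

namespace NuAt

variable {Ax : Term S Name → Term S Name → Prop} {V W : Type}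

/-- Restricted variables count as known before every output, so two of them are indistinguishable
for the history. -/
theorem up_up_swap (a : Hy V) : a.up.up.map swapO = a.up.up := by
  have (X : Set V) : swapO '' upS (upS X) = upS (upS X) := by
    ext x
    constructor
    · rintro ⟨y, hy, rfl⟩
      rcases y with _ | _ | y <;> simpa [swapO] using hy
    · intro hx
      refine ⟨swapO x, ?_, swapO_swapO x⟩
      rcases x with _ | _ | x <;> simpa [swapO] using hx
  simp [Hy.up, Hy.map, this, swapO]

theorem wf {A : Ext S (Option V)} {C : Ext S V} (h : NuAt A C) {a : Hy V} (hA : A.WF a.up) :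
    C.WF a := by
  induction h with
  | here => exact hA
  | there _ ih =>
    refine ih (a := a.up) ?_
    have := Ext.WF.map (a := a.up.up) hA swapO_injective
    rwa [up_up_swap] at this

theorem swap_lift (σ : V → Term S V) (v : Option (Option V)) :
    lift (lift σ) (swapO v) = (lift (lift σ) v).map swapO := by
  rcases v with _ | _ | v
  · rfl
  · rfl
  · simp [swapO, Term.map_map]

theorem subst {A : Ext S (Option V)} {C : Ext S V} (h : NuAt A C) (σ : V → Term S V) :
    NuAt (A.subst (lift σ)) (C.subst σ) := by
  induction h with
  | here => exact .here
  | there _ ih =>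
    refine .there ?_
    rw [← Ext.subst_rename _ swapO_injective (swap_lift σ)]
    exact ih _

theorem equates [Nonempty V] {A : Ext S (Option V)} {C : Ext S V} (h : NuAt A C) {M N : Term S V} :
    C.Equates Ax M N ↔ A.Equates Ax (M.map some) (N.map some) := by
  rename_i hV
  revert hV
  induction h with
  | here => exact Iff.rfl
  | @there V A C _ ih =>
    intro hV
    have := Ext.equates_map (Ax := Ax) (A := A) (M := (M.map some).map some)
      (N := (N.map some).map some) swapO_injective
    simp only [Term.map_map] at this
    simp only [Ext.Equates]
    rw [ih]
    simp only [Term.map_map]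
    exact this

theorem label_swap (μ : NLab S V) : ((μ.map some).map some).map swapO = (μ.map some).map some := by
  simp only [NLab.map_map]; rfl

/-- Exchanging adjacent restrictions is an injective renaming below both of them, and it leaves
labels from outside unchanged. Hence transitions do not see where the restriction stands. -/
theorem step {A : Ext S (Option V)} {C C' : Ext S V} (h : NuAt A C) {μ : NLab S V} {x : V}
    (hs : C.XStep Ax μ x C') : ∃ A', A.XStep Ax (μ.map some) (some x) A' ∧ NuAt A' C' := by
  induction h with
  | here =>
    obtain ⟨A1, h1, rfl⟩ := hs
    exact ⟨A1, h1, .here⟩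
  | there _ ih =>
    obtain ⟨C1, h1, rfl⟩ := hs
    obtain ⟨A1, h2, h3⟩ := ih h1
    have := h2.map swapO_injective
    rw [label_swap, Ext.map_map] at this
    simp only [swapO_swapO, Ext.map_id] at this
    refine ⟨_, ⟨_, this, rfl⟩, .there ?_⟩
    rw [Ext.map_map]
    simpa only [swapO_swapO, Ext.map_id] using h3

theorem step_inv {A A' : Ext S (Option V)} {C : Ext S V} (h : NuAt A C) {μ : NLab S V} {x : V}
    (hs : A.XStep Ax (μ.map some) (some x) A') : ∃ C', C.XStep Ax μ x C' ∧ NuAt A' C' := by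
  induction h with
  | here => exact ⟨_, ⟨_, hs, rfl⟩, .here⟩
  | there _ ih =>
    obtain ⟨A1, h1, rfl⟩ := hs
    have := h1.map swapO_injective
    rw [label_swap] at this
    obtain ⟨C1, h2, h3⟩ := ih this
    exact ⟨_, ⟨_, h2, rfl⟩, .there h3⟩

end NuAt

/-! ### Hiding an output variable -/

theorem GoodL.notMem {V : Type} {F : Set V} {l : List (V × Set V)} (h : GoodL F l) :
    ∀ p ∈ l, p.1 ∉ p.2 := by
  induction l generalizing F with
  | nil => simp
  | cons q l ih =>
    intro p hp
    rcases List.mem_cons.1 hp with rfl | hp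
    · exact h.2.2.2.1
    · exact ih h.2.2.2.2 p hp

/-- `B` is the renamed `A` with an additional entry for `y`, before the first `i` outputs. -/
inductive InsN : {V W : Type} → (V → W) → W → ℕ → Ext S V → Ext S W → Prop
  | base {V W : Type} {f : V → W} {y : W} {θ θ' : Frame S V} {N : Term S W} {P : Proc S V} :
      InsN f y θ'.length (Ext.base (θ ++ θ') P)
        (Ext.base (θ.rename f ++ (y, N) :: θ'.rename f) (P.map f))
  | nu {V W : Type} {f : V → W} {y : W} {i : ℕ} {A : Ext S (Option V)} {B : Ext S (Option W)} :
      InsN (Option.map f) (some y) i A B → InsN f y i (Ext.nu A) (Ext.nu B)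

/-- The history `a` results from `b` by forgetting the output of `y`. -/
def HidRel {V W : Type} (f : V → W) (y : W) (i : ℕ) (a : Hy V) (b : Hy W) : Prop :=
  f ⁻¹' b.known ⊆ a.known ∧ ∃ l l' m m' X, a.outs = l ++ l' ∧ b.outs = m ++ (y, X) :: m' ∧
    l'.length = i ∧ List.Forall₂ (fun p q => q.1 = f p.1 ∧ f ⁻¹' q.2 ⊆ p.2) l m ∧
    List.Forall₂ (fun p q => q.1 = f p.1 ∧ f ⁻¹' q.2 ⊆ p.2) l' m'

theorem ovars_append {V : Type} (l l' : List (V × Set V)) :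
    ovars (l ++ l') = ovars l ∪ ovars l' := by
  ext x
  simp only [ovars, List.mem_append, Set.mem_union, Set.mem_ofPred_eq]
  constructor
  · rintro ⟨p, h | h, rfl⟩
    · exact Or.inl ⟨p, h, rfl⟩
    · exact Or.inr ⟨p, h, rfl⟩
  · rintro (⟨p, h, rfl⟩ | ⟨p, h, rfl⟩)
    · exact ⟨p, Or.inl h, rfl⟩
    · exact ⟨p, Or.inr h, rfl⟩

theorem forall₂_split {α β : Type*} {R : α → β → Prop} {l l' : List α} {m m' : List β}
    (h : List.Forall₂ R (l ++ l') (m ++ m')) (hl : l'.length = m'.length) :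
    List.Forall₂ R l m ∧ List.Forall₂ R l' m' := by
  have hlen : l.length = m.length := by
    have := h.length_eq
    simp only [List.length_append] at this
    omega
  have h1 := List.forall₂_take_append _ _ _ h
  have h2 := List.forall₂_drop_append _ _ _ h
  rw [← hlen] at h1 h2
  simpa using And.intro h1 h2

theorem forall₂_append {α β : Type*} {R : α → β → Prop} {l l' : List α} {m m' : List β}
    (h : List.Forall₂ R l m) (h' : List.Forall₂ R l' m') :
    List.Forall₂ R (l ++ l') (m ++ m') := by
  induction h with
  | nil => exact h'
  | cons h _ ih => exact .cons h ih

namespace HidRel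

variable {V W U : Type} {f : V → W} {y : W} {i : ℕ} {a : Hy V} {b : Hy W}

theorem up (h : HidRel f y i a b) : HidRel (Option.map f) (some y) i a.up b.up := by
  have key {X : Set W} {Y : Set V} (h : f ⁻¹' X ⊆ Y) : Option.map f ⁻¹' upS X ⊆ upS Y := by
    intro x hx
    cases x with
    | none => simp
    | some x => simpa using h (by simpa using hx)
  obtain ⟨hk, l, l', m, m', X, ha, hb, hl, h1, h2⟩ := h
  refine ⟨key hk, l.map fun p => (some p.1, upS p.2), l'.map fun p => (some p.1, upS p.2),
    m.map fun p => (some p.1, upS p.2), m'.map fun p => (some p.1, upS p.2), upS X, ?_⟩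
  simp only [Hy.up, ha, hb, List.map_append, List.map_cons, List.length_map, hl, true_and,
    List.forall₂_map_left_iff, List.forall₂_map_right_iff]
  exact ⟨h1.imp fun p q h => ⟨by simp [h.1], key h.2⟩, h2.imp fun p q h => ⟨by simp [h.1], key h.2⟩⟩

theorem after (h : HidRel f y i a b) (hf : f.Injective) (κ : NLab S U) (x : V) :
    HidRel f y i (a.after κ x) (b.after κ (f x)) := by
  obtain ⟨hk, l, l', m, m', X, ha, hb, hl, h1, h2⟩ := h
  have hk' : f ⁻¹' insert (f x) b.known ⊆ insert x a.known := by
    rintro v (hv | hv)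
    · exact Or.inl (hf hv)
    · exact Or.inr (hk hv)
  cases κ with
  | tau => exact ⟨hk, l, l', m, m', X, ha, hb, hl, h1, h2⟩
  | out M =>
    exact ⟨hk', (x, a.known) :: l, l', (f x, b.known) :: m, m', X, by simp [Hy.after, ha],
      by simp [Hy.after, hb], hl, .cons ⟨rfl, hk⟩ h1, h2⟩
  | inp M => exact ⟨hk', l, l', m, m', X, ha, hb, hl, h1, h2⟩

theorem subst {b : Hy (Option V)} (h : HidRel some none i a b) (σ : V → Term S V) :
    HidRel some none i (a.subst σ) (b.subst (lift σ)) := by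
  have key {X : Set (Option V)} {Y : Set V} (h : some ⁻¹' X ⊆ Y) :
      some ⁻¹' img (lift σ) X ⊆ img σ Y := by
    rintro x ⟨z, hz, hx⟩
    obtain ⟨z, rfl, hx⟩ := some_mem_fv_lift.1 hx
    exact ⟨z, h hz, by simpa using hx⟩
  obtain ⟨hk, l, l', m, m', X, ha, hb, hl, h1, h2⟩ := h
  refine ⟨key hk, l.map fun p => (p.1, img σ p.2), l'.map fun p => (p.1, img σ p.2),
    m.map fun p => (p.1, img (lift σ) p.2), m'.map fun p => (p.1, img (lift σ) p.2),
    img (lift σ) X, ?_⟩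
  simp only [Hy.subst, ha, hb, List.map_append, List.map_cons, List.length_map, hl, true_and,
    List.forall₂_map_left_iff, List.forall₂_map_right_iff]
  exact ⟨h1.imp fun p q h => ⟨h.1, key h.2⟩, h2.imp fun p q h => ⟨h.1, key h.2⟩⟩

/-- The lifted substitution never uses `none` except on `none` itself, and the consistency of `b`
keeps `none` out of what was known before its own output. -/
theorem respects {b : Hy (Option V)} (h : HidRel some none i a b) (hb : b.Good)
    {σ : V → Term S V} (hσ : a.Respects σ) : b.Respects (lift σ) := by
  obtain ⟨-, l, l', m, m', X, ha, hb', hl, h1, h2⟩ := h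
  have key {l m} (h : List.Forall₂ (fun (p : V × Set V) (q : Option V × Set (Option V)) =>
      q.1 = some p.1 ∧ some ⁻¹' q.2 ⊆ p.2) l m)
      (hl : ∀ p ∈ l, σ p.1 = Term.var p.1 ∧ ∀ y ∈ p.2, p.1 ∉ (σ y).fv) :
      ∀ q ∈ m, lift σ q.1 = Term.var q.1 ∧ ∀ y ∈ q.2, q.1 ∉ (lift σ y).fv := by
    induction h with
    | nil => simp
    | @cons p q l m h _ ih =>
      intro r hr
      rcases List.mem_cons.1 hr with rfl | hr
      · have := hl _ List.mem_cons_self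
        rw [h.1]
        refine ⟨by simp [this.1], fun y hy hm => ?_⟩
        obtain ⟨z, rfl, hz⟩ := some_mem_fv_lift.1 hm
        exact this.2 z (h.2 hy) hz
      · exact ih (fun p hp => hl p (List.mem_cons_of_mem _ hp)) r hr
  intro q hq
  rw [hb', List.mem_append, List.mem_cons] at hq
  rcases hq with hq | rfl | hq
  · exact key h1 (fun p hp => hσ p (ha ▸ List.mem_append_left _ hp)) q hq
  · refine ⟨rfl, fun y hy hm => ?_⟩
    obtain rfl := none_mem_fv_lift.1 hm
    exact hb.notMem (none, X) (by rw [hb']; simp) hy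
  · exact key h2 (fun p hp => hσ p (ha ▸ List.mem_append_right _ hp)) q hq

theorem ovars_subset (h : HidRel f y i a b) {v : V} (hv : v ∈ ovars a.outs) :
    f v ∈ ovars b.outs := by
  obtain ⟨-, l, l', m, m', X, ha, hb', hl, h1, h2⟩ := h
  have key {l m} (h : List.Forall₂ (fun (p : V × Set V) (q : W × Set W) =>
      q.1 = f p.1 ∧ f ⁻¹' q.2 ⊆ p.2) l m) (hv : v ∈ ovars l) : f v ∈ ovars m := by
    induction h with
    | nil => simp at hv
    | cons h _ ih =>
      rw [mem_ovars_cons] at hv ⊢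
      exact hv.imp (fun h' => by rw [h.1, h']) ih
  rw [ha, ovars_append] at hv
  rw [hb', ovars_append]
  exact hv.imp (key h1) fun h => mem_ovars_cons.2 (Or.inr (key h2 h))

end HidRel

namespace InsN

variable {Ax : Term S Name → Term S Name → Prop} {V W : Type} {f : V → W} {y : W} {i : ℕ}

/-- As `y` is outside the range of `f`, the additional entry is invisible to renamed messages. All
properties of hiding rest on this. -/
theorem app_eq (hf : f.Injective) (hy : ∀ v, f v ≠ y) (θ θ' : Frame S V) (N : Term S W) (v : V) :
    Frame.app (θ.rename f ++ (y, N) :: θ'.rename f) (f v) = (Frame.app (θ ++ θ') v).map f := by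
  induction θ with
  | nil =>
    rw [Frame.rename_nil, List.nil_append, List.nil_append, Frame.app_cons_ne _ _ (hy v),
      Frame.app_rename hf]
  | cons p θ ih =>
    obtain ⟨x, M⟩ := p
    simp only [Frame.rename_cons, List.cons_append]
    by_cases hv : v = x
    · subst hv; rw [Frame.app_cons_self, Frame.app_cons_self]
    · rw [Frame.app_cons_ne _ _ hv, Frame.app_cons_ne _ _ (hf.ne hv)]
      exact ih

theorem some_ne (hy : ∀ v, f v ≠ y) (v : Option V) : Option.map f v ≠ some y := by
  cases v with
  | none => simp
  | some v => simpa using hy v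

theorem equates [Nonempty V] {A : Ext S V} {B : Ext S W} (h : InsN f y i A B) (hf : f.Injective)
    (hy : ∀ v, f v ≠ y) {M N : Term S V} :
    A.Equates Ax M N ↔ B.Equates Ax (M.map f) (N.map f) := by
  rename_i hV
  revert hV
  induction h with
  | base =>
    intro hV
    simp only [Ext.Equates, Term.map_subst, app_eq hf hy]
    rw [← Term.subst_map, ← Term.subst_map, EqE.map_iff hf]
  | nu _ ih =>
    intro hV
    simp only [Ext.Equates]
    rw [ih (Option.map_injective hf) (some_ne hy)]
    simp only [Term.map_map]
    rfl

theorem label_eq (hf : f.Injective) (hy : ∀ v, f v ≠ y) (θ θ' : Frame S V) (N : Term S W)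
    (μ : NLab S V) : (μ.map f).subst (Frame.app (θ.rename f ++ (y, N) :: θ'.rename f)) =
      (μ.subst (Frame.app (θ ++ θ'))).map f := by
  simp only [NLab.map_subst, app_eq hf hy]
  rw [NLab.subst_map]

theorem toExt (C : Con S V) (θ θ' : Frame S V) (N : Term S W) (x : V) :
    InsN f y θ'.length (C.toExt (θ ++ θ') x)
      ((C.map f).toExt (θ.rename f ++ (y, N) :: θ'.rename f) (f x)) := by
  induction C generalizing W with
  | base c =>
    cases c with
    | tau P => exact .base
    | out K P => exact .base (θ := (x, K) :: θ)
    | inp P =>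
      simp only [Con.toExt, Con.map, Con.subst, Body.subst, lift_var_comp]
      have := Con.instBound_map f x P
      unfold Proc.map at this
      rw [← this]
      exact .base
  | @nu V C ih =>
    rw [Con.map_nu]
    simp only [Con.toExt]
    refine .nu ?_
    have := ih (f := Option.map f) (y := some y) (θ.rename some) (θ'.rename some) (N.map some)
      (some x)
    rw [show (θ'.rename some).length = θ'.length from List.length_map _] at this
    simp only [Frame.rename_append, Frame.rename_rename, Frame.rename_cons] at this ⊢
    exact this

theorem step [Nonempty V] {A A' : Ext S V} {B : Ext S W} (h : InsN f y i A B) (hf : f.Injective)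
    (hy : ∀ v, f v ≠ y) {μ : NLab S V} {x : V} (hs : A.XStep Ax μ x A') :
    ∃ B', B.XStep Ax (μ.map f) (f x) B' ∧ InsN f y i A' B' := by
  rename_i hV
  revert hV
  induction h with
  | @base V W f y θ θ' N P =>
    intro hV
    obtain ⟨C, hC, rfl⟩ := hs
    refine ⟨_, ⟨C.map f, ?_, rfl⟩, toExt _ _ _ _ _⟩
    rw [label_eq hf hy]
    exact (hC.inst fun y => Term.var (f y)).to_subst rfl
  | nu _ ih =>
    intro hV
    obtain ⟨A1, h1, rfl⟩ := hs
    obtain ⟨B1, h2, h3⟩ := ih (Option.map_injective hf) (some_ne hy) h1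
    rw [NLab.map_map] at h2
    refine ⟨_, ⟨B1, ?_, rfl⟩, .nu h3⟩
    rw [NLab.map_map]
    exact h2

/-- Neither the renamed process nor the label mentions `y`, so `of_subst` pulls the derivation back
along `f` and `of_map` removes the renaming from its tests. -/
theorem step_inv [Nonempty V] {A : Ext S V} {B B' : Ext S W} (h : InsN f y i A B)
    (hf : f.Injective) (hy : ∀ v, f v ≠ y) {μ : NLab S V} {x : V}
    (hs : B.XStep Ax (μ.map f) (f x) B') : ∃ A', A.XStep Ax μ x A' ∧ InsN f y i A' B' := by
  rename_i hV
  revert hV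
  induction h with
  | @base V W f y θ θ' N P =>
    intro hV
    obtain ⟨C, hC, rfl⟩ := hs
    rw [label_eq hf hy] at hC
    obtain ⟨D, hD, rfl⟩ := hC.of_subst
    have hD' : RStep Ax (fun x => (Term.var x : Term S V).map f) P
      ((μ.subst (Frame.app (θ ++ θ'))).map f) D := hD
    exact ⟨_, ⟨D, hD'.of_map hf, rfl⟩, toExt _ _ _ _ _⟩
  | @nu V W f y i A B _ ih =>
    intro hV
    obtain ⟨B1, h1, rfl⟩ := hs
    rw [NLab.map_map] at h1
    obtain ⟨A1, h2, h3⟩ := ih (Option.map_injective hf) (some_ne hy) (μ := μ.map some)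
      (x := some x) (by rw [NLab.map_map]; exact h1)
    exact ⟨_, ⟨A1, h2, rfl⟩, .nu h3⟩

/-- The message behind `y` changes to some `N'` that plays no role; the other entries stay renamed
ones, since their images under `τ` do not mention `y`. -/
theorem frame_subst (hf : f.Injective) (hy : ∀ v, f v ≠ y) {σ : V → Term S V} {τ : W → Term S W}
    (h : ∀ v, τ (f v) = (σ v).map f) (θ θ' : Frame S V) (N : Term S W) :
    ∃ (η η' : Frame S V) (N' : Term S W), Frame.subst σ (θ ++ θ') = η ++ η' ∧
      η'.length = θ'.length ∧
      Frame.subst τ (θ.rename f ++ (y, N) :: θ'.rename f) =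
        η.rename f ++ (y, N') :: η'.rename f := by
  induction θ with
  | nil =>
    refine ⟨[], Frame.subst σ θ', (N.subst τ).subst (Frame.app (Frame.subst τ (θ'.rename f))), rfl,
      ?_, ?_⟩
    · induction θ' with
      | nil => rfl
      | cons p θ ih => simp [Frame.subst, ih]
    · simp only [Frame.rename_nil, List.nil_append, Frame.subst]
      rw [Frame.subst_rename hf h]
  | cons p θ ih =>
    obtain ⟨x, M⟩ := p
    obtain ⟨η, η', N', h1, h2, h3⟩ := ih
    refine ⟨(x, (M.subst σ).subst (Frame.app (η ++ η'))) :: η, η', N', ?_, h2, ?_⟩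
    · simp only [List.cons_append, Frame.subst, h1]
    · simp only [List.cons_append, Frame.rename_cons, Frame.subst]
      erw [h3]
      congr 2
      simp only [Term.map_subst, Term.subst_map, Term.subst_subst, h, app_eq hf hy]

theorem subst {A : Ext S V} {B : Ext S W} (hi : InsN f y i A B) (hf : f.Injective)
    (hy : ∀ v, f v ≠ y) {σ : V → Term S V} {τ : W → Term S W} (h : ∀ v, τ (f v) = (σ v).map f) :
    InsN f y i (A.subst σ) (B.subst τ) := by
  induction hi with
  | @base V W f y θ θ' N P =>
    obtain ⟨η, η', N', h1, h2, h3⟩ := frame_subst hf hy h θ θ' N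
    simp only [Ext.subst]
    rw [h3, h1, ← h2, Proc.subst_rename hf h (app_eq hf hy η η' N')]
    exact .base
  | nu _ ih => exact .nu (ih (Option.map_injective hf) (some_ne hy) (lift_rename h))

theorem wf {A : Ext S V} {B : Ext S W} (h : InsN f y i A B) (hf : f.Injective) {a : Hy V} {b : Hy W}
    (hab : HidRel f y i a b) (ha : a.Good) (hB : B.WF b) : A.WF a := by
  induction h with
  | @base V W f y θ θ' N P =>
    obtain ⟨-, hθ, hP⟩ := hB
    have ho := fun v => hab.ovars_subset (v := v)
    refine ⟨ha, ?_, fun x hx => ?_⟩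
    · obtain ⟨-, l, l', m, m', X, hl, hm, hi, h1, h2⟩ := hab
      generalize ovars a.outs = O at *
      generalize ovars b.outs = O' at *
      rw [hm] at hθ
      rw [hl]
      have h3 := forall₂_split hθ (by
        have := h2.length_eq
        simp only [List.length_cons, Frame.rename, List.length_map]
        omega)
      obtain ⟨h3, h4⟩ := h3
      have h4 : FrameWF O' m' (θ'.rename f) := by cases h4; assumption
      have h3 : FrameWF O' m (θ.rename f) := h3
      have key {l : List (V × Set V)} {m : List (W × Set W)} {θ : Frame S V}
          (h : List.Forall₂ (fun p q => q.1 = f p.1 ∧ f ⁻¹' q.2 ⊆ p.2) l m)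
          (hθ : FrameWF O' m (θ.rename f)) : FrameWF O l θ := by
        induction h generalizing θ with
        | nil => cases θ with
          | nil => exact .nil
          | cons => cases hθ
        | cons h _ ih =>
          cases θ with
          | nil => cases hθ
          | cons p θ =>
            cases hθ with
            | cons h1 h2 =>
              refine .cons ⟨hf (h1.1.trans h.1), fun x hx => ?_⟩ (ih h2)
              have := h1.2 ((Term.map_mem_fv_map hf).2 hx)
              exact ⟨h.2 this.1, fun hxo => this.2 (ho x hxo)⟩
      exact forall₂_append (key h1 h3) (key h2 h4)
    · have := hP ((Proc.map_mem_fv_map hf).2 hx)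
      exact ⟨hab.1 this.1, fun hxo => this.2 (ho x hxo)⟩
  | nu _ ih => exact ih (Option.map_injective hf) hab.up (Hy.good_up.2 ha) hB

end InsN

/-! ### Adding an output variable for a message over the other variables -/

/-- `B` is `A` with an additional entry `x` for the message `M`, after the first `i` outputs. -/
inductive InsE : {V : Type} → V → Term S V → ℕ → Ext S V → Ext S V → Prop
  | base {V : Type} {x : V} {M : Term S V} {θ θ' : Frame S V} {P : Proc S V} : x ∉ Frame.dom θ →
      InsE x M θ'.length (Ext.base (θ ++ θ') P)
        (Ext.base (θ ++ (x, M.subst (Frame.app (θ ++ θ'))) :: θ') P)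
  | nu {V : Type} {x : V} {M : Term S V} {i : ℕ} {A B : Ext S (Option V)} :
      InsE (some x) (M.map some) i A B → InsE x M i (Ext.nu A) (Ext.nu B)

/-- The history `b` results from `a` by adding the output of `x`. -/
def RecRel {V : Type} (x : V) (M : Term S V) (i : ℕ) (a b : Hy V) : Prop :=
  a.known ⊆ b.known ∧ x ∉ a.known ∧ ∃ l l' m m' X, a.outs = l ++ l' ∧ b.outs = m ++ (x, X) :: m' ∧
    l'.length = i ∧ List.Forall₂ (fun p q => p.1 = q.1 ∧ p.2 ⊆ q.2) l m ∧
    List.Forall₂ (fun p q => p.1 = q.1 ∧ p.2 ⊆ q.2) l' m' ∧ M.fv ⊆ X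

open Classical in
/-- The substitution `σ`, followed by the substitution of `K` for `x`, except on `x`. -/
noncomputable def recSub {V : Type} (x : V) (K : Term S V) (σ : V → Term S V) : V → Term S V :=
  fun v => if v = x then Term.var x else (σ v).subst (single x K)

/-! ### Replacing an output variable by its recipe in a substitution. -/

section RecSub

variable {V : Type} {x : V} {K : Term S V} {σ : V → Term S V}

theorem recSub_ne {v : V} (h : v ≠ x) : recSub x K σ v = (σ v).subst (single x K) := by
  simp [recSub, h]

theorem subst_single_eq_self {N : Term S V} (h : x ∉ N.fv) : N.subst (single x K) = N :=
  Term.subst_eq_self fun y hy => single_of_ne _ (by rintro rfl; exact h hy)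

theorem recSub_eq {v : V} (h : v ≠ x) (hx : x ∉ (σ v).fv) : recSub x K σ v = σ v := by
  rw [recSub_ne h, subst_single_eq_self hx]

theorem map_single (N : Term S V) :
    (N.map some).subst (single (some x) (K.map some)) = (N.subst (single x K)).map some := by
  rw [← lift_single, Term.map_subst, Term.subst_map]; rfl

theorem lift_recSub : lift (recSub x K σ) = recSub (some x) (K.map some) (lift σ) := by
  funext v
  cases v with
  | none =>
    rw [recSub_ne (by simp), lift_none, lift_none, Term.subst_var_apply, single_of_ne _ (by simp)]
  | some v =>
    by_cases hv : v = x
    · subst hv; simp [recSub]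
    · rw [recSub_ne (by simpa using hv), lift_some, lift_some, recSub_ne hv, map_single]

theorem fv_subst_single {N : Term S V} {y : V} (h : y ∈ (N.subst (single x K)).fv) :
    (y ∈ N.fv ∧ y ≠ x) ∨ (y ∈ K.fv ∧ x ∈ N.fv) := by
  obtain ⟨z, hz, hy⟩ := Term.mem_fv_subst.1 h
  by_cases hzx : z = x
  · subst hzx
    rw [single_self] at hy
    exact Or.inr ⟨hy, hz⟩
  · rw [single_of_ne _ hzx] at hy
    obtain rfl : y = z := hy
    exact Or.inl ⟨hz, hzx⟩

end RecSub

theorem GoodL.of_append {V : Type} {F : Set V} {l l' : List (V × Set V)}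
    (h : GoodL F (l ++ l')) : ∃ G, GoodL G l' ∧ G ⊆ F ∧ ∀ p ∈ l, G ⊆ p.2 := by
  induction l generalizing F with
  | nil => exact ⟨F, h, subset_rfl, by simp⟩
  | cons p l ih =>
    obtain ⟨G, h1, h2, h3⟩ := ih h.2.2.2.2
    refine ⟨G, h1, h2.trans h.2.2.1, fun q hq => ?_⟩
    rcases List.mem_cons.1 hq with rfl | hq
    · exact h2
    · exact h3 q hq

theorem mem_ovars_of_forall₂ {V : Type} {l m : List (V × Set V)}
    (h : List.Forall₂ (fun p q => p.1 = q.1 ∧ p.2 ⊆ q.2) l m) :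
    ∀ p ∈ l, ∃ q ∈ m, p.1 = q.1 ∧ p.2 ⊆ q.2 := by
  induction h with
  | nil => simp
  | cons h _ ih =>
    intro p hp
    rcases List.mem_cons.1 hp with rfl | hp
    · exact ⟨_, List.mem_cons_self, h⟩
    · obtain ⟨q, hq, h⟩ := ih p hp
      exact ⟨q, List.mem_cons_of_mem _ hq, h⟩

namespace RecRel

variable {V W : Type} {x : V} {M : Term S V} {i : ℕ} {a b : Hy V}

theorem up (h : RecRel x M i a b) : RecRel (some x) (M.map some) i a.up b.up := by
  obtain ⟨hk, hx, l, l', m, m', X, ha, hb, hl, h1, h2, hM⟩ := h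
  refine ⟨upS_mono hk, by simpa [Hy.up] using hx, l.map fun p => (some p.1, upS p.2),
    l'.map fun p => (some p.1, upS p.2), m.map fun p => (some p.1, upS p.2),
    m'.map fun p => (some p.1, upS p.2), upS X, ?_⟩
  simp only [Hy.up, ha, hb, List.map_append, List.map_cons, List.length_map, hl, true_and,
    List.forall₂_map_left_iff, List.forall₂_map_right_iff]
  refine ⟨h1.imp fun p q h => ⟨by simp [h.1], upS_mono h.2⟩,
    h2.imp fun p q h => ⟨by simp [h.1], upS_mono h.2⟩, fun v hv => ?_⟩
  obtain ⟨w, hw, rfl⟩ := Term.mem_fv_map.1 hv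
  simpa using hM hw

theorem after (h : RecRel x M i a b) (hb' : b.Good) (κ : NLab S W) {y : V} (hy : y ∉ b.known) :
    RecRel x M i (a.after κ y) (b.after κ y) := by
  obtain ⟨hk, hx, l, l', m, m', X, ha, hb, hl, h1, h2, hM⟩ := h
  have hxb : x ∈ b.known := hb'.ovars_subset ⟨(x, X), by rw [hb]; simp, rfl⟩
  have hx' : x ∉ insert y a.known := by
    rintro (rfl | h)
    · exact hy hxb
    · exact hx h
  cases κ with
  | tau => exact ⟨hk, hx, l, l', m, m', X, ha, hb, hl, h1, h2, hM⟩
  | out N =>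
    exact ⟨Set.insert_subset_insert hk, hx', (y, a.known) :: l, l', (y, b.known) :: m, m', X,
      by simp [Hy.after, ha], by simp [Hy.after, hb], hl, .cons ⟨rfl, hk⟩ h1, h2, hM⟩
  | inp N => exact ⟨Set.insert_subset_insert hk, hx', l, l', m, m', X, ha, hb, hl, h1, h2, hM⟩

/-- Facts about the output variables before and after the additional one. -/
theorem facts (h : RecRel x M i a b) (hb' : b.Good) {σ : V → Term S V} (hσ : b.Respects σ) :
    ∃ l l' X, a.outs = l ++ l' ∧ l'.length = i ∧ M.fv ⊆ X ∧ x ∉ X ∧ σ x = Term.var x ∧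
      (∀ y ∈ X, x ∉ (σ y).fv) ∧ (∀ p ∈ l', p.2 ⊆ X) ∧
      (∀ p ∈ l, p.1 ≠ x ∧ p.1 ∉ X ∧ ∀ y ∈ p.2 ∪ X, p.1 ∉ (σ y).fv) ∧
      (∀ p ∈ a.outs, p.1 ≠ x ∧ σ p.1 = Term.var p.1 ∧ ∀ y ∈ p.2, p.1 ∉ (σ y).fv) := by
  obtain ⟨hk, hx, l, l', m, m', X, ha, hb, hl, h1, h2, hM⟩ := h
  have hg : GoodL b.known (m ++ (x, X) :: m') := hb ▸ hb'
  obtain ⟨G, hG, hGF, hGm⟩ := hg.of_append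
  have hxσ := hσ (x, X) (by rw [hb]; simp)
  have hl1 := mem_ovars_of_forall₂ h1
  have hl2 := mem_ovars_of_forall₂ h2
  have hne : ∀ p ∈ m, p.1 ∉ X ∧ p.1 ≠ x := by
    intro p hp
    have := hg.notMem p (by simp [hp])
    refine ⟨fun h => this (hGm p hp (hG.2.2.1 h)), fun h => this (hGm p hp ?_)⟩
    rw [h]; exact hG.2.1
  refine ⟨l, l', X, ha, hl, hM, hG.2.2.2.1, hxσ.1, hxσ.2, fun p hp => ?_, fun p hp => ?_,
    fun p hp => ?_⟩
  · obtain ⟨q, hq, h⟩ := hl2 p hp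
    exact h.2.trans (GoodL.subset hG.2.2.2.2 q hq)
  · obtain ⟨q, hq, h⟩ := hl1 p hp
    rw [h.1]
    refine ⟨(hne q hq).2, (hne q hq).1, fun y hy => (hσ q (by rw [hb]; simp [hq])).2 y ?_⟩
    exact hy.elim (fun hy => h.2 hy) fun hy => hGm q hq (hG.2.2.1 hy)
  · rw [ha, List.mem_append] at hp
    rcases hp with hp | hp
    · obtain ⟨q, hq, h⟩ := hl1 p hp
      rw [h.1]
      have := hσ q (by rw [hb]; simp [hq])
      exact ⟨(hne q hq).2, this.1, fun y hy => this.2 y (h.2 hy)⟩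
    · obtain ⟨q, hq, h⟩ := hl2 p hp
      rw [h.1]
      have := hσ q (by rw [hb]; simp [hq])
      refine ⟨?_, this.1, fun y hy => this.2 y (h.2 hy)⟩
      intro he
      refine hG.2.2.2.1 (GoodL.ovars_subset hG.2.2.2.2 ⟨q, hq, he.symm⟩)

/-- Two kinds of output occur. A later one cannot appear in the instantiated recipe, whose original
variables were known before `x`. For an earlier one, the images under `σ` of the variables known
before it do not mention `x`, so the recipe is not used there. -/
theorem respects (h : RecRel x M i a b) (ha' : a.Good) (hb' : b.Good) {σ : V → Term S V}
    (hσ : b.Respects σ) : a.Respects (recSub x (M.subst σ) σ) := by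
  have hx := h.2.1
  obtain ⟨l, l', X, ha, hl, hM, hxX, hxσ, hX, hl', hl1, hall⟩ := h.facts hb' hσ
  intro p hp
  have h1 := hall p hp
  refine ⟨?_, fun y hy hm => ?_⟩
  · rw [recSub_eq h1.1 (by rw [h1.2.1]; exact fun h => h1.1 h.symm), h1.2.1]
  · have hyx : y ≠ x := by
      rintro rfl
      exact hx (ha'.subset p hp hy)
    rw [recSub_ne hyx] at hm
    rcases fv_subst_single hm with hm | ⟨hm, hxy⟩
    · exact h1.2.2 y hy hm.1
    · rw [ha, List.mem_append] at hp
      rcases hp with hp | hp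
      · obtain ⟨z, hz, hm⟩ := Term.mem_fv_subst.1 hm
        exact (hl1 p hp).2.2 z (Or.inr (hM hz)) hm
      · exact hX y (hl' p hp hy) hxy

theorem subst (h : RecRel x M i a b) (ha' : a.Good) (hb' : b.Good) {σ : V → Term S V}
    (hσ : b.Respects σ) :
    RecRel x (M.subst σ) i (a.subst (recSub x (M.subst σ) σ)) (b.subst σ) := by
  have hfacts := h.facts hb' hσ
  have hg := hb'
  obtain ⟨hk, hx, l, l', m, m', X, ha, hb, hl, h1, h2, hM⟩ := h
  have hgl : GoodL b.known (m ++ (x, X) :: m') := hb ▸ hg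
  obtain ⟨G, hG, hGF, hGm⟩ := hgl.of_append
  have hxσ := hσ (x, X) (by rw [hb]; simp)
  have hMX : (M.subst σ).fv ⊆ img σ X := by
    intro v hv
    obtain ⟨w, hw, hv⟩ := Term.mem_fv_subst.1 hv
    exact ⟨w, hM hw, hv⟩
  -- For the whole known set and for outputs after `x`: the recipe adds only variables from the
  -- image of `X`, which are known by then.
  have key1 {Y Z : Set V} (hYZ : Y ⊆ Z) (hXZ : X ⊆ Z) (hxY : x ∉ Y) :
      img (recSub x (M.subst σ) σ) Y ⊆ img σ Z := by
    rintro v ⟨y, hy, hv⟩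
    rw [recSub_ne (by rintro rfl; exact hxY hy)] at hv
    rcases fv_subst_single hv with hv | ⟨hv, -⟩
    · exact ⟨y, hYZ hy, hv.1⟩
    · exact img_mono σ hXZ (hMX hv)
  -- For outputs before `x`: images of variables from `X` do not mention `x`, so both substitutions
  -- agree on them.
  have key2 {Y Z : Set V} (hYZ : Y ⊆ Z) (hXZ : Z ⊆ X) :
      img (recSub x (M.subst σ) σ) Y ⊆ img σ Z := by
    rintro v ⟨y, hy, hv⟩
    rw [recSub_eq (by rintro rfl; exact hG.2.2.2.1 (hXZ (hYZ hy)))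
      (hxσ.2 y (hXZ (hYZ hy)))] at hv
    exact ⟨y, hYZ hy, hv⟩
  have hXb : X ⊆ b.known := hG.2.2.1.trans hGF
  refine ⟨key1 hk hXb hx, ?_, l.map fun p => (p.1, img (recSub x (M.subst σ) σ) p.2),
    l'.map fun p => (p.1, img (recSub x (M.subst σ) σ) p.2), m.map fun p => (p.1, img σ p.2),
    m'.map fun p => (p.1, img σ p.2), img σ X, ?_⟩
  · rintro ⟨y, hy, hv⟩
    rw [recSub_ne (by rintro rfl; exact hx hy)] at hv
    rcases fv_subst_single hv with hv | ⟨hv, -⟩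
    · exact hv.2 rfl
    · obtain ⟨w, hw, hv⟩ := hMX hv
      exact hxσ.2 w hw hv
  · have hla : ∀ p ∈ l, x ∉ p.2 := fun p hp hm =>
      hx (ha'.subset p (by rw [ha]; simp [hp]) hm)
    simp only [Hy.subst, ha, hb, List.map_append, List.map_cons, List.length_map, hl, true_and,
      List.forall₂_map_left_iff, List.forall₂_map_right_iff]
    refine ⟨?_, ?_, hMX⟩
    · clear hfacts ha hb hgl
      induction h1 with
      | nil => exact .nil
      | @cons p q l m h _ ih =>
        refine .cons ⟨h.1, key1 h.2 ?_ (hla p List.mem_cons_self)⟩ (ih ?_ ?_)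
        · exact hG.2.2.1.trans (hGm q List.mem_cons_self)
        · exact fun q hq => hGm q (List.mem_cons_of_mem _ hq)
        · exact fun q hq => hla q (List.mem_cons_of_mem _ hq)
    · have : ∀ q ∈ m', q.2 ⊆ X := GoodL.subset hG.2.2.2.2
      clear hfacts ha hb hgl hG hl hGm
      induction h2 with
      | nil => exact .nil
      | cons h _ ih =>
        exact .cons ⟨h.1, key2 h.2 (this _ List.mem_cons_self)⟩
          (ih fun q hq => this q (List.mem_cons_of_mem _ hq))

end RecRel

namespace InsE

variable {Ax : Term S Name → Term S Name → Prop} {V W : Type} {x : V} {M : Term S V} {i : ℕ}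

theorem app_insert (θ θ' : Frame S V) (E : Term S V) (hx : x ∉ θ.dom) :
    Frame.app (θ ++ (x, E) :: θ') x = E ∧
      ∀ v, v ≠ x → Frame.app (θ ++ (x, E) :: θ') v = Frame.app (θ ++ θ') v := by
  induction θ with
  | nil => exact ⟨Frame.app_cons_self _ _ _, fun v hv => Frame.app_cons_ne _ _ hv⟩
  | cons p θ ih =>
    obtain ⟨y, N⟩ := p
    rw [Frame.mem_dom_cons, not_or] at hx
    obtain ⟨h1, h2⟩ := ih hx.2
    simp only [List.cons_append]
    refine ⟨by rw [Frame.app_cons_ne _ _ hx.1]; exact h1, fun v hv => ?_⟩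
    by_cases hvy : v = y
    · subst hvy; rw [Frame.app_cons_self, Frame.app_cons_self]
    · rw [Frame.app_cons_ne _ _ hvy, Frame.app_cons_ne _ _ hvy]
      exact h2 v hv

/-- The new variable is an abbreviation: evaluation with the additional entry means replacing `x` by
its recipe and evaluating as before. Tests and labels of the larger process thus become tests and
labels of the smaller one. -/
theorem app_eq {θ θ' : Frame S V} (hx : x ∉ θ.dom) (M : Term S V) (v : V) :
    Frame.app (θ ++ (x, M.subst (Frame.app (θ ++ θ'))) :: θ') v =
      (single x M v).subst (Frame.app (θ ++ θ')) := by
  obtain ⟨h1, h2⟩ := app_insert θ θ' (M.subst (Frame.app (θ ++ θ'))) hx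
  by_cases hv : v = x
  · subst hv; rw [h1, single_self]
  · rw [h2 v hv, single_of_ne _ hv, Term.subst_var_apply]

theorem equates {A B : Ext S V} (h : InsE x M i A B) {K N : Term S V} :
    B.Equates Ax K N ↔ A.Equates Ax (K.subst (single x M)) (N.subst (single x M)) := by
  induction h with
  | base hx =>
    simp only [Ext.Equates, Term.subst_subst]
    rw [funext (app_eq hx _)]
  | nu _ ih =>
    simp only [Ext.Equates]
    rw [ih, map_single, map_single]

/-- A later output `y` does not occur in the recipe, so its entry does not change the value of the
recipe. -/
theorem toExt (C : Con S V) {θ θ' : Frame S V} (hx : x ∉ θ.dom) {y : V} (hy : y ≠ x)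
    (hM : y ∉ M.fv) : InsE x M θ'.length (C.toExt (θ ++ θ') y)
      (C.toExt (θ ++ (x, M.subst (Frame.app (θ ++ θ'))) :: θ') y) := by
  induction C with
  | base c =>
    cases c with
    | tau P => exact .base hx
    | inp P => exact .base hx
    | out N P =>
      have := InsE.base (M := M) (θ := (y, N) :: θ) (θ' := θ') (P := P) (x := x) (by
        rw [Frame.mem_dom_cons, not_or]; exact ⟨hy.symm, hx⟩)
      have he : M.subst (Frame.app (((y, N) :: θ) ++ θ')) = M.subst (Frame.app (θ ++ θ')) :=
        Term.subst_congr fun v hv => Frame.app_cons_ne _ _ (by rintro rfl; exact hM hv)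
      rw [he] at this
      exact this
  | @nu V C ih =>
    simp only [Con.toExt]
    refine .nu ?_
    have := ih (x := some x) (M := M.map some) (θ := θ.rename some) (θ' := θ'.rename some)
      (y := some y) (by simpa [Frame.mem_dom_rename] using hx) (by simpa using hy) (by simpa using hM)
    rw [show (θ'.rename some).length = θ'.length from List.length_map _, ← Frame.rename_append,
      Frame.app_rename_some, Term.map_subst] at this
    simp only [Frame.rename_append, Frame.rename_cons, Term.subst_map] at this ⊢
    exact this

theorem step {A A' B : Ext S V} (h : InsE x M i A B) {μ : NLab S V} {y : V} (hy : y ≠ x)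
    (hM : y ∉ M.fv) (hs : A.XStep Ax (μ.subst (single x M)) y A') :
    ∃ B', B.XStep Ax μ y B' ∧ InsE x M i A' B' := by
  induction h with
  | base hx =>
    obtain ⟨C, hC, rfl⟩ := hs
    refine ⟨_, ⟨C, ?_, rfl⟩, toExt C hx hy hM⟩
    rwa [NLab.subst_subst, ← funext (app_eq hx _)] at hC
  | @nu V x M i A B _ ih =>
    obtain ⟨A1, h1, rfl⟩ := hs
    have e : (μ.subst (single x M)).map some = (μ.map some).subst (single (some x) (M.map some)) := by
      rw [← lift_single, NLab.map_subst, NLab.subst_map]; rfl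
    rw [e] at h1
    obtain ⟨B1, h2, h3⟩ := ih (by simpa using hy) (by simpa using hM) h1
    exact ⟨_, ⟨B1, h2, rfl⟩, .nu h3⟩

theorem step_inv {A B B' : Ext S V} (h : InsE x M i A B) {μ : NLab S V} {y : V} (hy : y ≠ x)
    (hM : y ∉ M.fv) (hs : B.XStep Ax μ y B') :
    ∃ A', A.XStep Ax (μ.subst (single x M)) y A' ∧ InsE x M i A' B' := by
  induction h with
  | base hx =>
    obtain ⟨C, hC, rfl⟩ := hs
    refine ⟨_, ⟨C, ?_, rfl⟩, toExt C hx hy hM⟩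
    rwa [NLab.subst_subst, ← funext (app_eq hx _)]
  | @nu V x M i A B _ ih =>
    obtain ⟨A1, h1, rfl⟩ := hs
    obtain ⟨B1, h2, h3⟩ := ih (by simpa using hy) (by simpa using hM) h1
    have e : (μ.subst (single x M)).map some = (μ.map some).subst (single (some x) (M.map some)) := by
      rw [← lift_single, NLab.map_subst, NLab.subst_map]; rfl
    rw [← e] at h2
    exact ⟨_, ⟨B1, h2, rfl⟩, .nu h3⟩

/-- On the side without the entry for `x`, a message that refers to `x` through `σ` must contain the
recipe `K` instead, so `recSub` is applied there. The hypotheses say that `E` evaluates like `K`,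
that older entries are not affected by `recSub`, and that newer output variables stay out of `K`
while newer messages avoid `x`. -/
theorem frame_subst {σ : V → Term S V} {K E : Term S V} {θ θ' : Frame S V}
    (hE : (E.subst σ).subst (Frame.app (Frame.subst σ θ')) =
      K.subst (Frame.app (Frame.subst σ θ')))
    (h2 : Frame.subst σ θ' = Frame.subst (recSub x K σ) θ')
    (h1 : ∀ p ∈ θ, p.1 ≠ x ∧ p.1 ∉ K.fv ∧ x ∉ p.2.fv) :
    ∃ η η' : Frame S V, Frame.subst (recSub x K σ) (θ ++ θ') = η ++ η' ∧
      η'.length = θ'.length ∧ x ∉ η.dom ∧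
      Frame.subst σ (θ ++ (x, E) :: θ') = η ++ (x, K.subst (Frame.app (η ++ η'))) :: η' := by
  induction θ with
  | nil =>
    refine ⟨[], Frame.subst σ θ', h2.symm, ?_, by simp [Frame.dom], ?_⟩
    · clear hE h2
      induction θ' with
      | nil => rfl
      | cons p θ ih => simp [Frame.subst, ih]
    · simp only [List.nil_append, Frame.subst, hE]
  | cons p θ ih =>
    obtain ⟨z, N⟩ := p
    obtain ⟨η, η', e1, e2, e3, e4⟩ := ih fun p hp => h1 p (List.mem_cons_of_mem _ hp)
    obtain ⟨hz, hzK, hxN⟩ := h1 _ List.mem_cons_self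
    refine ⟨(z, (N.subst (recSub x K σ)).subst (Frame.app (η ++ η'))) :: η, η', ?_, e2, ?_, ?_⟩
    · simp only [List.cons_append, Frame.subst, e1]
    · rw [Frame.mem_dom_cons, not_or]; exact ⟨Ne.symm hz, e3⟩
    · simp only [List.cons_append, Frame.subst, e4]
      congr 2
      · rw [funext (app_eq e3 K), Term.subst_subst, Term.subst_subst]
        refine Term.subst_congr fun v hv => ?_
        rw [recSub_ne (by rintro rfl; exact hxN hv), Term.subst_subst]
      · congr 2
        refine Term.subst_congr fun v hv => (Frame.app_cons_ne _ _ ?_).symm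
        rintro rfl
        exact hzK hv

theorem subst {A B : Ext S V} (h : InsE x M i A B) {a b : Hy V} (hA : A.WF a)
    (hab : RecRel x M i a b) (hb : b.Good) {σ : V → Term S V} (hσ : b.Respects σ) :
    InsE x (M.subst σ) i (A.subst (recSub x (M.subst σ) σ)) (B.subst σ) := by
  induction h with
  | @base V x M θ θ' P hx =>
    obtain ⟨hg, hθ, hP⟩ := hA
    have hxa := hab.2.1
    obtain ⟨l, l', X, ha, hl, hM, hxX, hxσ, hX, hl', hl1, hall⟩ := hab.facts hb hσ
    have hg' : GoodL a.known (l ++ l') := ha ▸ hg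
    obtain ⟨G, hG, hGF, hGl⟩ := hg'.of_append
    generalize ovars a.outs = O at *
    rw [ha] at hθ
    obtain ⟨hθ1, hθ2⟩ := forall₂_split hθ hl.symm
    replace hθ2 : FrameWF O l' θ' := hθ2
    replace hθ1 : FrameWF O l θ := hθ1
    have hdom : ∀ v ∈ X, v ∉ Frame.dom θ := by
      rintro v hv hd
      rw [hθ1.dom_eq] at hd
      obtain ⟨p, hp, rfl⟩ := hd
      exact (hl1 p hp).2.1 hv
    -- Variables of the recipe were known before `x`, so none of them is an output made after it.
    have hMθ : M.subst (Frame.app (θ ++ θ')) = M.subst θ'.app := by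
      refine Term.subst_congr fun v hv => ?_
      have := hdom v (hM hv)
      clear hdom hx hl1
      revert this
      clear * -
      intro this
      induction θ with
      | nil => rfl
      | cons p θ ih =>
        obtain ⟨y, N⟩ := p
        rw [Frame.mem_dom_cons, not_or] at this
        rw [List.cons_append, Frame.app_cons_ne _ _ this.1]
        exact ih this.2
    have hfr : ∀ {F : Set V} {l : List (V × Set V)} {θ : Frame S V}, GoodL F l → FrameWF O l θ → ∀ p ∈ θ, p.2.fv ⊆ F := by
      intro F l θ hF h
      clear hθ1 hdom hθ hx hMθ hθ2 hl hl1
      induction h generalizing F with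
      | nil => simp
      | cons h _ ih =>
        intro p hp
        rcases List.mem_cons.1 hp with rfl | hp
        · exact (h.2.trans Set.sdiff_subset).trans hF.2.2.1
        · exact (ih hF.2.2.2.2 p hp).trans hF.2.2.1
    obtain ⟨η, η', e1, e2, e3, e4⟩ := frame_subst (x := x) (σ := σ) (K := M.subst σ)
      (E := M.subst (Frame.app (θ ++ θ'))) (θ := θ) (θ' := θ') (by
        rw [hMθ, Term.subst_subst, Term.subst_subst, Term.subst_subst]
        congr 1
        funext v
        have := hθ2.app_subst hG (fun p hp => (hall p (by rw [ha]; simp [hp])).2) v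
        rwa [Term.subst_subst] at this)
      (by
        have : ∀ p ∈ θ', p.2.fv ⊆ X := by
          clear hθ hMθ hl hG hx hall hg' hGl ha hab
          induction hθ2 with
          | nil => simp
          | @cons p q θ' l' h _ ih =>
            intro r hr
            rcases List.mem_cons.1 hr with rfl | hr
            · exact (h.2.trans Set.sdiff_subset).trans (hl' q List.mem_cons_self)
            · exact ih (fun p hp => hl' p (List.mem_cons_of_mem _ hp)) r hr
        clear hθ hMθ hl hG hx hθ2 hab
        induction θ' with
        | nil => rfl
        | cons p θ' ih =>
          obtain ⟨z, N⟩ := p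
          have hN := this _ List.mem_cons_self
          have e : N.subst σ = N.subst (recSub x (M.subst σ) σ) :=
            Term.subst_congr fun v hv => (recSub_eq (by rintro rfl; exact hxX (hN hv))
              (hX v (hN hv))).symm
          simp only [Frame.subst]
          rw [ih fun p hp => this p (List.mem_cons_of_mem _ hp), e])
      (by
        intro p hp
        have hpd : p.1 ∈ Frame.dom θ := ⟨p.2, hp⟩
        rw [hθ1.dom_eq] at hpd
        obtain ⟨q, hq, he⟩ := hpd
        rw [he]
        refine ⟨(hl1 q hq).1, fun hm => ?_, fun hm => hxa ?_⟩
        · obtain ⟨y, hy, hm⟩ := Term.mem_fv_subst.1 hm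
          exact (hl1 q hq).2.2 y (Or.inr (hM hy)) hm
        · exact hfr hg' hθ p (List.mem_append_left _ hp) hm)
    simp only [Ext.subst]
    rw [e4, e1, ← e2]
    have eP : (P.subst σ).subst (Frame.app (η ++ (x, (M.subst σ).subst (Frame.app (η ++ η'))) :: η')) =
        (P.subst (recSub x (M.subst σ) σ)).subst (Frame.app (η ++ η')) := by
      rw [funext (app_eq e3 (M.subst σ)), Proc.subst_subst, Proc.subst_subst]
      refine Proc.subst_congr fun v hv => ?_
      rw [recSub_ne (by rintro rfl; exact hxa (hP hv).1), Term.subst_subst]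
    rw [eP]
    exact .base e3
  | nu _ ih =>
    refine .nu ?_
    rw [lift_recSub]
    have := ih (a := a.up) (b := b.up) hA hab.up (Hy.good_up.2 hb) hσ.up
    have e (M : Term S _) : (M.map some).subst (lift σ) = (M.subst σ).map some := by
      rw [Term.map_subst, Term.subst_map]; rfl
    rwa [e] at this

theorem wf {A B : Ext S V} (h : InsE x M i A B) {a b : Hy V} (hA : A.WF a)
    (hab : RecRel x M i a b) (hb : b.Good) : B.WF b := by
  induction h with
  | @base V x M θ θ' P hx =>
    obtain ⟨hg, hθ, hP⟩ := hA
    obtain ⟨hk, hxa, l, l', m, m', X, ha, hbo, hl, h1, h2, hM⟩ := hab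
    have hgb : GoodL b.known (m ++ (x, X) :: m') := hbo ▸ hb
    obtain ⟨G, hG, hGF, hGm⟩ := hgb.of_append
    have hO : ∀ v ∈ a.known, v ∉ ovars a.outs → v ∉ ovars b.outs := by
      intro v hv hva hvb
      rw [hbo, ovars_append] at hvb
      rw [ha, ovars_append, Hy.ovars_eq_of_le h1, Hy.ovars_eq_of_le h2] at hva
      rcases hvb with h | h
      · exact hva (Or.inl h)
      · rcases mem_ovars_cons.1 h with rfl | h
        · exact hxa hv
        · exact hva (Or.inr h)
    have hθ' : FrameWF (ovars b.outs) (l ++ l') (θ ++ θ') := by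
      have hga : GoodL a.known (l ++ l') := ha ▸ hg
      rw [ha] at hθ
      rw [ha] at hO
      have : ∀ {F O : Set V} {l : List (V × Set V)} {θ : Frame S V}, GoodL F l → F ⊆ a.known → (∀ v ∈ a.known, v ∉ O → v ∉ ovars b.outs) →
          FrameWF O l θ → FrameWF (ovars b.outs) l θ := by
        intro F O l θ hF hFa hO h
        clear hθ hga
        induction h generalizing F with
        | nil => exact .nil
        | cons h _ ih =>
          refine .cons ⟨h.1, fun v hv => ⟨(h.2 hv).1, ?_⟩⟩ (ih hF.2.2.2.2 (hF.2.2.1.trans hFa))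
          exact hO v (hFa (hF.2.2.1 (h.2 hv).1)) (h.2 hv).2
      exact this hga subset_rfl hO hθ
    obtain ⟨hθ1, hθ2⟩ := forall₂_split hθ' hl.symm
    have hθ1 : FrameWF (ovars b.outs) l θ := hθ1
    have hθ2 : FrameWF (ovars b.outs) l' θ' := hθ2
    refine ⟨hb, ?_, fun v hv => ⟨hk (hP hv).1, hO v (hP hv).1 (hP hv).2⟩⟩
    generalize hO' : ovars b.outs = O' at *
    rw [hbo]
    refine forall₂_append (hθ1.mono h1) (.cons ⟨rfl, fun v hv => ?_⟩ (hθ2.mono h2))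
    obtain ⟨w, hw, hv⟩ := Term.mem_fv_subst.1 hv
    have hwX := hM hw
    by_cases hd : w ∈ Frame.dom (θ ++ θ')
    · have hm := Frame.app_mem hd
      rcases List.mem_append.1 hm with hm | hm
      -- The recipe cannot refer to outputs made after `x`, because their variables are not in `X`.
      · exfalso
        have : w ∈ Frame.dom θ := ⟨_, hm⟩
        rw [hθ1.dom_eq, Hy.ovars_eq_of_le h1] at this
        obtain ⟨q, hq, rfl⟩ := this
        exact hgb.notMem q (by simp [hq]) (hGm q hq (hG.2.2.1 hwX))
      · have key : ∀ {l : List (V × Set V)} {θ : Frame S V}, (∀ p ∈ l, p.2 ⊆ X) → FrameWF O' l θ → ∀ p ∈ θ, p.2.fv ⊆ X \ O' := by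
          intro l θ hX h
          clear hθ hθ1 hθ2 hθ' hm hd hx
          induction h with
          | nil => simp
          | cons h _ ih =>
            intro p hp
            rcases List.mem_cons.1 hp with rfl | hp
            · exact h.2.trans (Set.sdiff_subset_sdiff_left (hX _ List.mem_cons_self))
            · exact ih (fun p hp => hX p (List.mem_cons_of_mem _ hp)) p hp
        refine key (fun p hp => ?_) (hθ2.mono h2) _ hm hv
        exact GoodL.subset hG.2.2.2.2 p hp
    · rw [Frame.app_of_notMem hd] at hv
      obtain rfl : v = w := hv
      refine ⟨hwX, ?_⟩
      rw [← hO', hbo, ovars_append]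
      rintro (h | h)
      · obtain ⟨q, hq, rfl⟩ := h
        exact hgb.notMem q (by simp [hq]) (hGm q hq (hG.2.2.1 hwX))
      · rcases mem_ovars_cons.1 h with rfl | h
        · exact hG.2.2.2.1 hwX
        · refine hd ?_
          have : v ∈ Frame.dom θ' := by rwa [hθ2.dom_eq, Hy.ovars_eq_of_le h2]
          obtain ⟨N, hN⟩ := this
          exact ⟨N, List.mem_append_right _ hN⟩
  | nu _ ih => exact ih (a := a.up) (b := b.up) hA hab.up (Hy.good_up.2 hb)

end InsE

/-! ### The environment of an extended process -/

section RenameApp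

variable {V W : Type} {f : V → W}

theorem Term.map_app_rename (hf : f.Injective) (θ : Frame S V) (M : Term S V) :
    (M.map f).subst (θ.rename f).app = (M.subst θ.app).map f := by
  rw [Term.map_subst, Term.subst_map]; simp only [Frame.app_rename hf]

theorem Proc.map_app_rename (hf : f.Injective) (θ : Frame S V) (P : Proc S V) :
    (P.map f).subst (θ.rename f).app = (P.subst θ.app).map f := by
  rw [Proc.map_subst, Proc.subst_map]; simp only [Frame.app_rename hf]

theorem Con.map_app_rename (hf : f.Injective) (θ : Frame S V) (C : Con S V) :
    (C.map f).subst (θ.rename f).app = (C.subst θ.app).map f := by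
  rw [Con.map_subst, Con.subst_map]; simp only [Frame.app_rename hf]

end RenameApp

namespace Ext

variable {Ax : Term S Name → Term S Name → Prop} {U V W : Type}

/-- The variables of the active substitution, below the restrictions. -/
def Leaf : {V : Type} → Ext S V → Type
  | V, base _ _ => V
  | _, nu A => A.Leaf

/-- The active substitution on the variables outside the restrictions. -/
noncomputable def ev : {V : Type} → (A : Ext S V) → V → Term S A.Leaf
  | _, base θ _ => θ.app
  | _, nu A => fun v => A.ev (some v)

theorem map_some_ev_term (A : Ext S (Option V)) (M : Term S V) :
    (M.map some).subst A.ev = M.subst (nu A).ev := Term.map_subst _ _ _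

theorem equates_iff {A : Ext S V} {M N : Term S V} :
    A.Equates Ax M N ↔ EqE Ax (M.subst A.ev) (N.subst A.ev) := by
  induction A with
  | base θ P => exact Iff.rfl
  | nu A ih => rw [Equates, ih, map_some_ev_term, map_some_ev_term]; exact Iff.rfl

/-- A variable that is outside `K` and absent from the finite active substitution is fixed by it and
occurs in none of the images of `K`. -/
theorem ev_generic [Infinite V] (A : Ext S V) : Generic A.ev := by
  rename_i hV
  revert hV
  induction A with
  | base θ P =>
    intro hV K hK
    obtain ⟨v, hv⟩ := (hK.union θ.fv_finite).exists_notMem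
    rw [Set.mem_union, not_or] at hv
    refine ⟨v, hv.1, v, Frame.app_of_notMem fun h => hv.2 (θ.dom_subset_fv h), fun u hu hm => ?_⟩
    rcases Frame.fv_app_subset hm with rfl | h
    · exact hv.1 hu
    · exact hv.2 h
  | nu A ih =>
    intro hV K hK
    obtain ⟨v, hv, w, hw, hu⟩ := ih (insert none (some '' K)) ((hK.image _).insert _)
    cases v with
    | none => exact (hv (Or.inl rfl)).elim
    | some v =>
      exact ⟨v, fun h => hv (Or.inr ⟨v, h, rfl⟩), w, hw, fun u h => hu _ (Or.inr ⟨u, h, rfl⟩)⟩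

theorem implies_of_static {A B : Ext S V} (h : StaticEq Ax A B) : Implies Ax A.ev B.ev :=
  fun M N hMN => equates_iff.1 ((h M N).1 (equates_iff.2 hMN))

/-- `A` in parallel with `Q`, to which the active substitution is applied; `A` is on the left if
`b` is true. -/
noncomputable def env (b : Bool) : {V : Type} → Ext S V → Proc S V → Ext S V
  | _, base θ P, Q => base θ (Proc.pr b P (Q.subst θ.app))
  | _, nu A, Q => nu (A.env b (Q.map some))

theorem env_map (b : Bool) (A : Ext S V) (Q : Proc S V) {f : V → W} (hf : f.Injective) :
    (A.env b Q).map f = (A.map f).env b (Q.map f) := by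
  induction A generalizing W with
  | base θ P => simp only [env, map, Proc.pr_map, Proc.map_app_rename hf]
  | nu A ih =>
    simp only [env, map]
    rw [ih _ (Option.map_injective hf), Proc.map_map, Proc.map_map]
    rfl

theorem env_wf {b : Bool} {a : Hy V} {A : Ext S V} {Q : Proc S V} (h : A.WF a)
    (hQ : Q.fv ⊆ a.known) : (A.env b Q).WF a := by
  induction A with
  | base θ P =>
    refine ⟨h.1, h.2.1, fun x hx => ?_⟩
    rcases Proc.mem_fv_pr.1 hx with hx | hx
    · exact h.2.2 hx
    · obtain ⟨y, hy, hx⟩ := Proc.mem_fv_subst.1 hx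
      exact h.2.1.fv_app h.1 (hQ hy) hx
  | nu A ih =>
    refine ih (a := a.up) h fun x hx => ?_
    obtain ⟨y, hy, rfl⟩ := Proc.mem_fv_map.1 hx
    exact some_mem_upS.2 (hQ hy)

theorem env_equates {b : Bool} {A : Ext S V} {Q : Proc S V} {M N : Term S V} :
    (A.env b Q).Equates Ax M N ↔ A.Equates Ax M N := by
  induction A with
  | base θ P => exact Iff.rfl
  | nu A ih => exact ih

/-- Evaluating `Q` by the old active substitution and then applying `σ` fully agrees with applying
`σ` to the recipes in `Q` and evaluating by the new one. This is `FrameWF.app_subst`, which depends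
on `σ` respecting the order of outputs. -/
theorem env_subst {b : Bool} {a : Hy V} {A : Ext S V} (h : A.WF a) (Q : Proc S V)
    {σ : V → Term S V} (hσ : a.Respects σ) :
    (A.env b Q).subst σ = (A.subst σ).env b (Q.subst σ) := by
  induction A with
  | base θ P =>
    simp only [env, subst, Proc.pr_subst]
    congr 2
    rw [Proc.subst_subst, Proc.subst_subst, Proc.subst_subst]
    refine Proc.subst_congr fun v _ => ?_
    have := h.2.1.app_subst h.1 hσ v
    rwa [Term.subst_subst] at this
  | nu A ih =>
    simp only [env, subst]
    rw [ih (a := a.up) h _ hσ.up, Proc.map_subst, Proc.subst_map]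
    rfl

/-- The number of messages in the active substitution. -/
def len : {V : Type} → Ext S V → ℕ
  | _, base θ _ => θ.length
  | _, nu A => A.len

theorem WF.len_eq {a : Hy V} {A : Ext S V} (h : A.WF a) : A.len = a.outs.length := by
  induction A with
  | base θ P => exact h.2.1.length_eq
  | nu A ih => rw [len, ih (a := a.up) h, Hy.up, List.length_map]

theorem XStep.relabel {A A' : Ext S V} {μ μ' : NLab S V} {x : V} (h : A.XStep Ax μ x A')
    (hμ : NLab.Eqv Ax (μ.subst A.ev) (μ'.subst A.ev)) : A.XStep Ax μ' x A' := by
  induction A with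
  | base θ P =>
    obtain ⟨C, hC, rfl⟩ := h
    exact ⟨C, hC.relabel hμ, rfl⟩
  | nu A ih =>
    obtain ⟨A1, h1, rfl⟩ := h
    refine ⟨A1, ih h1 ?_, rfl⟩
    rwa [NLab.map_subst, NLab.map_subst]

end Ext

theorem Con.toExt_env (b : Bool) (C : Con S V) (θ : Frame S V) {x : V} {Q : Proc S V}
    (hx : x ∉ Q.fv) : (C.toExt θ x).env b Q = (C.par b (Q.subst θ.app)).toExt θ x := by
  induction C with
  | base c =>
    cases c with
    | tau P => rfl
    | out N P =>
      simp only [toExt, Ext.env, par, Body.par]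
      congr 2
      exact Proc.subst_congr fun v hv => Frame.app_cons_ne _ _ (by rintro rfl; exact hx hv)
    | inp P =>
      simp only [toExt, Ext.env, par, Body.par, Proc.pr_subst]
      congr 2
      rw [Proc.map_subst]
      exact (Proc.subst_var _).symm
  | nu C ih =>
    simp only [toExt, Ext.env, par]
    rw [ih _ (by simpa using hx), Proc.map_app_rename (Option.some_injective _)]

/-! ### Transitions of the environment -/

/-- The results of a transition with restrictions, applied to an extended process: the
restrictions of both are interleaved, and `F` is applied below them. -/
inductive Mix (F : ∀ {V : Type}, V → Ext S V → Body S V → Ext S V) :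
    {V : Type} → V → Ext S V → Con S V → Ext S V → Prop
  | base {V : Type} (x : V) (A : Ext S V) (c : Body S V) : Mix F x A (Con.base c) (F x A c)
  | nuL {V : Type} {x : V} {A : Ext S (Option V)} {C : Con S V} {R : Ext S (Option V)} :
      Mix F (some x) A (C.map some) R → Mix F x (Ext.nu A) C (Ext.nu R)
  | nuR {V : Type} {x : V} {A : Ext S V} {C : Con S (Option V)} {R : Ext S (Option V)} :
      Mix F (some x) (A.map some) C R → Mix F x A (Con.nu C) (Ext.nu R)

/-- An operation that can be moved under restrictions. -/
structure IsMixOp (F : ∀ {V : Type}, V → Ext S V → Body S V → Ext S V) : Prop where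
  nu {V : Type} (x : V) (A : Ext S (Option V)) (c : Body S V) :
    F x (Ext.nu A) c = Ext.nu (F (some x) A (c.subst fun x => Term.var (some x)))
  map {V W : Type} (x : V) (A : Ext S V) (c : Body S V) {f : V → W} (hf : f.Injective) :
    (F x A c).map f = F (f x) (A.map f) (c.subst fun x => Term.var (f x))

namespace Mix

variable {F : ∀ {V : Type}, V → Ext S V → Body S V → Ext S V} {V W : Type}

theorem map (hF : IsMixOp F) {x : V} {A R : Ext S V} {C : Con S V} (h : Mix F x A C R)
    {f : V → W} (hf : f.Injective) : Mix F (f x) (A.map f) (C.map f) (R.map f) := by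
  induction h generalizing W with
  | base x A c => rw [hF.map _ _ _ hf]; exact .base _ _ _
  | @nuL V x A C R _ ih =>
    refine .nuL ?_
    have := ih (Option.map_injective hf)
    rw [Con.map_map] at this ⊢
    exact this
  | @nuR V x A C R _ ih =>
    rw [Con.map_nu]
    refine .nuR ?_
    have := ih (Option.map_injective hf)
    rw [Ext.map_map] at this ⊢
    exact this

theorem base_inv (hF : IsMixOp F) {x : V} {A R : Ext S V} {c : Body S V}
    (h : Mix F x A (Con.base c) R) : R = F x A c := by
  generalize hC : Con.base c = C at h
  induction h with
  | base x A c' => cases hC; rfl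
  | nuL _ ih => subst hC; rw [ih rfl, hF.nu]
  | nuR => cases hC

/-- The outermost restriction of the environment's result may have been placed below some
restrictions of `A`; `NuAt` records that position. -/
theorem nu_inv (hF : IsMixOp F) {x : V} {A R : Ext S V} {C : Con S (Option V)}
    (h : Mix F x A (Con.nu C) R) : ∃ R0, Mix F (some x) (A.map some) C R0 ∧ NuAt R0 R := by
  generalize hD : Con.nu C = D at h
  induction h with
  | base x A c' => cases hD
  | @nuL V x A D R _ ih =>
    subst hD
    obtain ⟨R0, h1, h2⟩ := ih (Con.map_nu some C).symm
    -- The restriction of `A` and the one of the environment trade places, so bound variables are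
    -- exchanged below them.
    refine ⟨Ext.nu (R0.map swapO), .nuL ?_, .there ?_⟩
    · have := h1.map hF swapO_injective
      rw [Ext.map_map, Con.map_map] at this
      have e1 : (fun x : Option V => swapO (some x)) = Option.map some := by
        funext x; cases x <;> rfl
      have e2 : (fun x : Option V => swapO (Option.map some x)) = some := by
        funext x; cases x <;> rfl
      rw [e1, e2] at this
      exact this
    · rw [Ext.map_map]
      simpa only [swapO_swapO, Ext.map_id] using h2
  | nuR h => cases hD; exact ⟨_, h, .here⟩

end Mix

/-- The transition of the environment to `c`, in parallel with `A`. -/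
noncomputable def Ext.act (b : Bool) : {V : Type} → V → Ext S V → Body S V → Ext S V
  | _, x, base θ P, c => (Con.base ((c.subst θ.app).par (!b) P)).toExt θ x
  | _, x, nu A, c => nu (A.act b (some x) (c.subst fun x => Term.var (some x)))

/-- Output of a message by the environment to the input of `A`. -/
noncomputable def Ext.recv (b : Bool) {V : Type} (x : V) (A : Ext S V) : Body S V → Ext S V
  | .out N Q => (A.subst (single x N)).env b Q
  | _ => A

namespace Ext

variable {U U' V W : Type}

theorem isMixOp_act (b : Bool) : IsMixOp (S := S) (Ext.act b) where
  nu _ _ _ := rfl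
  map {V W} x A c f hf := by
    induction A generalizing W with
    | base θ P =>
      simp only [act, Ext.map]
      rw [Con.toExt_map]
      simp only [Con.map, Con.subst, Body.par_subst, Body.subst_subst, Term.subst_var_apply,
        Frame.app_rename hf]
      rfl
    | nu A ih =>
      simp only [act, Ext.map]
      rw [ih _ _ _ (Option.map_injective hf), Body.subst_subst, Body.subst_subst]
      rfl

theorem isMixOp_recv (b : Bool) : IsMixOp (S := S) (Ext.recv b) where
  nu x A c := by
    cases c with
    | out N Q => simp only [recv, Body.subst, Ext.subst, env, lift_single]; rfl
    | _ => rfl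
  map x A c f hf := by
    cases c with
    | out N Q =>
      simp only [recv, Body.subst]
      rw [env_map _ _ _ hf, ← Ext.subst_rename A hf (σ := single x N)]
      · rfl
      · intro v
        by_cases hv : v = x
        · subst hv; rw [single_self, single_self]; rfl
        · rw [single_of_ne _ hv, single_of_ne _ (hf.ne hv)]; rfl
    | _ => rfl

theorem mix_act (b : Bool) (x : V) (θ : Frame S V) (P : Proc S V) (Y : Con S V) :
    Mix (Ext.act b) x (base θ P) Y (((Y.subst θ.app).par (!b) P).toExt θ x) := by
  induction Y with
  | base c => exact .base _ _ _
  | nu Y ih =>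
    refine .nuR ?_
    have := ih (some x) (θ.rename some) (P.map some)
    rwa [Frame.app_rename_some] at this

end Ext

namespace Con

variable {U U' V W : Type}

/-- The result of an input transition, for the input variable `y`. -/
def enter : {V : Type} → Con S V → V → Con S V
  | _, base (Body.inp P), y => base (Body.tau (P.subst (instBound (Term.var y))))
  | _, base c, _ => base c
  | _, nu C, y => nu (C.enter (some y))

theorem enter_map (C : Con S V) (y : V) (f : V → W) : (C.enter y).map f = (C.map f).enter (f y) := by
  induction C generalizing W with
  | base c =>
    cases c with
    | inp P =>
      simp only [enter, map, subst, Body.subst, lift_var_comp]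
      exact congrArg (fun P => base (Body.tau P)) (instBound_map f y P)
    | _ => rfl
  | nu C ih => simp only [enter, map_nu, ih, Option.map_some]

theorem enter_fits {C : Con S V} {K : Term S W} (h : C.Fits (NLab.inp K)) (y : V) :
    (C.enter y).Fits (NLab.tau : NLab S W) := by
  induction C with
  | base c => cases c <;> first | exact trivial | exact h.elim
  | nu C ih => exact ih h _

theorem fv_enter_subset (C : Con S V) (y : V) : (C.enter y).fv ⊆ insert y C.fv := by
  induction C with
  | base c =>
    cases c with
    | inp P =>
      intro x hx
      obtain ⟨z, hz, hx⟩ := Proc.mem_fv_subst.1 hx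
      cases z with
      | none => exact Or.inl hx
      | some z => obtain rfl : x = z := hx; exact Or.inr hz
    | _ => exact fun x hx => Or.inr hx
  | nu C ih =>
    intro x hx
    exact (ih (some y) hx).imp Option.some.inj id

theorem sync_out_recv (b : Bool) {θ : Frame S V} {D : Con S V} {K : Term S U}
    (hD : D.Fits (NLab.inp K)) (x : V) {f : V → W} (hf : f.Injective) {y : W}
    (hy : ∀ v, f v ≠ y) (N : Term S V) (P : Proc S V) :
    ∃ R, InsN f y θ.length (((D.subst θ.app).recv b N P).toExt θ x) R ∧
      Mix (Ext.act b) y (Ext.base ((y, N.map f) :: θ.rename f) (P.map f)) ((D.map f).enter y) R := by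
  induction D generalizing W with
  | base c =>
    cases c with
    | inp Q =>
      refine ⟨_, ?_, .base _ _ _⟩
      have := InsN.base (f := f) (y := y) (θ := []) (θ' := θ) (N := N.map f)
        (P := Proc.pr b P ((Q.subst (lift θ.app)).subst (instBound N)))
      -- Receiving `N` directly gives the same process as receiving `y` and evaluating it by the
      -- entry for `y`.
      have e : ((Q.subst (lift θ.app)).subst (instBound N)).map f =
          ((Q.subst (lift fun x => Term.var (f x))).subst (instBound (Term.var y))).subst
            (Frame.app ((y, N.map f) :: θ.rename f)) := by
        rw [Proc.subst_map, Proc.subst_subst, Proc.subst_subst, Proc.subst_subst]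
        congr 1
        funext v
        cases v with
        | none => simp [instBound, Frame.app_cons_self]
        | some v =>
          simp only [lift_some, Term.map_subst, Term.map_var, Term.subst_var_apply, instBound,
            Frame.app_cons_ne _ _ (hy v), Frame.app_rename hf]
          rfl
      simp only [Con.subst, Body.subst, recv, toExt, Ext.act, Body.par, Proc.pr_not]
      rw [Proc.pr_map, e] at this
      exact this
    | _ => exact hD.elim
  | @nu V D ih =>
    obtain ⟨R, h1, h2⟩ := ih (θ := θ.rename some) hD (some x) (Option.map_injective hf)
      (InsN.some_ne hy) (N.map some) (P.map some)
    refine ⟨Ext.nu R, ?_, ?_⟩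
    · simp only [Con.subst, recv, toExt]
      refine .nu ?_
      rwa [show (θ.rename some).length = θ.length from List.length_map _,
        Frame.app_rename_some] at h1
    · rw [map_nu]
      refine .nuR ?_
      simp only [Ext.map, Frame.rename_cons, Frame.rename_rename, Term.map_map, Proc.map_map,
        Option.map_some] at h2 ⊢
      exact h2

/-- A communication from the process to the environment splits into a bound output of `y`, the
reception of `y` by the environment, and the hiding of `y`. The same `R` serves both descriptions.
-/
theorem sync_out (b : Bool) {θ : Frame S V} {C D : Con S V} {K : Term S U} {K' : Term S U'}
    (hC : C.Fits (NLab.out K)) (hD : D.Fits (NLab.inp K')) (x : V) {f : V → W} (hf : f.Injective)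
    {y : W} (hy : ∀ v, f v ≠ y) :
    ∃ R, InsN f y θ.length ((C.close b (D.subst θ.app)).toExt θ x) R ∧
      Mix (Ext.act b) y ((C.map f).toExt (θ.rename f) y) ((D.map f).enter y) R := by
  induction C generalizing W with
  | base c =>
    cases c with
    | out N P => exact sync_out_recv b hD x hf hy N P
    | _ => exact hC.elim
  | @nu V C ih =>
    obtain ⟨R, h1, h2⟩ := ih (θ := θ.rename some) (D := D.map some) hC (fits_subst.2 hD) (some x)
      (Option.map_injective hf) (InsN.some_ne hy)
    refine ⟨Ext.nu R, ?_, ?_⟩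
    · simp only [close, toExt]
      refine .nu ?_
      rwa [show (θ.rename some).length = θ.length from List.length_map _,
        map_app_rename (Option.some_injective _)] at h1
    · rw [map_nu]
      refine .nuL ?_
      rw [enter_map]
      rw [map_map, Frame.rename_rename] at h2 ⊢
      exact h2

theorem _root_.AppliedPi.Frame.subst_eq_self {σ : V → Term S V} {θ : Frame S V}
    (h : ∀ p ∈ θ, ∀ v ∈ p.2.fv, σ v = Term.var v ∧ v ∉ θ.dom) : Frame.subst σ θ = θ := by
  have : ∀ η : Frame S V, (∀ p ∈ η, ∀ v ∈ p.2.fv, σ v = Term.var v ∧ v ∉ η.dom) →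
      Frame.subst σ η = η := by
    intro η h
    induction η with
    | nil => rfl
    | cons p η ih =>
      obtain ⟨z, M⟩ := p
      simp only [Frame.subst]
      rw [ih fun p hp v hv => ⟨(h p (List.mem_cons_of_mem _ hp) v hv).1, fun hd =>
        (h p (List.mem_cons_of_mem _ hp) v hv).2 (Frame.mem_dom_cons.2 (Or.inr hd))⟩]
      congr 2
      have hM := h _ List.mem_cons_self
      rw [Term.subst_eq_self fun v hv => (hM v hv).1]
      exact Term.subst_eq_self fun v hv => Frame.app_of_notMem fun hd =>
        (hM v hv).2 (Frame.mem_dom_cons.2 (Or.inr hd))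
  exact this θ h

theorem sync_in_recv (b : Bool) {θ : Frame S V} {C : Con S V} {K : Term S U}
    (hC : C.Fits (NLab.inp K)) {y : V} (hyC : y ∉ C.fv) (hyθ : y ∉ θ.fv)
    (hθ : ∀ p ∈ θ, ∀ v ∈ p.2.fv, v ∉ θ.dom) (hCθ : ∀ v ∈ C.fv, v ∉ θ.dom) (x : V)
    (N : Term S V) (Q : Proc S V) :
    (C.recv (!b) (N.subst θ.app) (Q.subst θ.app)).toExt θ x =
      ((C.toExt θ y).subst (single y N)).env b Q := by
  induction C with
  | base c =>
    cases c with
    | inp P =>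
      have e : Frame.subst (single y N) θ = θ := Frame.subst_eq_self fun p hp v hv =>
        ⟨single_of_ne _ (by rintro rfl; exact hyθ ⟨p, hp, Or.inr hv⟩), hθ p hp v hv⟩
      simp only [recv, toExt, Ext.subst, Ext.env, e, Proc.pr_not]
      congr 2
      rw [Proc.subst_subst, Proc.subst_subst]
      refine Proc.subst_congr fun v hv => ?_
      cases v with
      | none => simp [instBound]
      | some v =>
        have h1 : v ∉ θ.dom := hCθ v hv
        simp only [instBound, Term.subst_var_apply]
        rw [single_of_ne _ (by rintro rfl; exact hyC hv), Term.subst_var_apply,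
          Frame.app_of_notMem h1]
    | _ => exact hC.elim
  | @nu V C ih =>
    simp only [recv, toExt, Ext.subst, Ext.env, lift_single]
    have hfv : ∀ {v : V}, some v ∈ (θ.rename some).fv → v ∈ θ.fv := by
      rintro v ⟨p, hp, hv⟩
      obtain ⟨q, hq, rfl⟩ := List.mem_map.1 hp
      exact ⟨q, hq, hv.imp Option.some.inj Term.some_mem_fv_map.1⟩
    have := ih (θ := θ.rename some) hC (y := some y) hyC (fun h => hyθ (hfv h)) (by
        rintro p hp v hv hd
        obtain ⟨q, hq, rfl⟩ := List.mem_map.1 hp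
        obtain ⟨w, hw, rfl⟩ := Term.mem_fv_map.1 hv
        obtain ⟨z, hz, he⟩ := Frame.mem_dom_rename.1 hd
        exact hθ q hq w hw (Option.some.inj he ▸ hz)) (by
        intro v hv hd
        obtain ⟨z, hz, rfl⟩ := Frame.mem_dom_rename.1 hd
        exact hCθ z hv hz) (some x) (N.map some) (Q.map some)
    rw [Term.map_app_rename (Option.some_injective _),
      Proc.map_app_rename (Option.some_injective _)] at this
    rw [this]

/-- In the other direction, the process makes a late input of a fresh `y`, and the message of the
environment is substituted for `y` afterwards. The freshness conditions ensure that this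
substitution touches nothing but the input. -/
theorem sync_in (b : Bool) {θ : Frame S V} {C D : Con S V} {K : Term S U} {K' : Term S U'}
    (hC : C.Fits (NLab.inp K)) (hD : D.Fits (NLab.out K')) {y : V} (hyC : y ∉ C.fv)
    (hyθ : y ∉ θ.fv) (hθ : ∀ p ∈ θ, ∀ v ∈ p.2.fv, v ∉ θ.dom) (hCθ : ∀ v ∈ C.fv, v ∉ θ.dom)
    (x : V) :
    Mix (Ext.recv b) y (C.toExt θ y) D (((D.subst θ.app).close (!b) C).toExt θ x) := by
  induction D with
  | base c =>
    cases c with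
    | out N Q =>
      simp only [subst, Body.subst, close]
      rw [sync_in_recv b hC hyC hyθ hθ hCθ]
      exact .base _ _ _
    | _ => exact hD.elim
  | @nu V D ih =>
    have hfv : ∀ {v : V}, some v ∈ (θ.rename some).fv → v ∈ θ.fv := by
      rintro v ⟨p, hp, hv⟩
      obtain ⟨q, hq, rfl⟩ := List.mem_map.1 hp
      exact ⟨q, hq, hv.imp Option.some.inj Term.some_mem_fv_map.1⟩
    simp only [subst, close, toExt]
    refine .nuR ?_
    rw [toExt_map, ← Frame.app_rename_some]
    refine ih (fits_subst.2 hC) hD (fun h => hyC (some_mem_fv_map.1 h))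
      (fun h => hyθ (hfv h)) ?_ ?_ _
    · rintro p hp v hv hd
      obtain ⟨q, hq, rfl⟩ := List.mem_map.1 hp
      obtain ⟨w, hw, rfl⟩ := Term.mem_fv_map.1 hv
      obtain ⟨z, hz, he⟩ := Frame.mem_dom_rename.1 hd
      exact hθ q hq w hw (Option.some.inj he ▸ hz)
    · intro v hv hd
      obtain ⟨z, hz, rfl⟩ := Frame.mem_dom_rename.1 hd
      exact hCθ z (some_mem_fv_map.1 hv) hz

end Con

/-! ### Transitions of a parallel composition -/

section Par

variable {Ax : Term S Name → Term S Name → Prop} {U U' V W : Type}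

namespace RStep

theorem pr_left {θ : V → Term S W} {P : Proc S V} {κ : NLab S W} {C : Con S V}
    (h : RStep Ax θ P κ C) (b : Bool) (Q : Proc S V) : RStep Ax θ (Proc.pr b P Q) κ (C.par b Q) := by
  cases b
  · exact .parR h
  · exact .parL h

theorem pr_right {θ : V → Term S W} {Q : Proc S V} {κ : NLab S W} {D : Con S V}
    (h : RStep Ax θ Q κ D) (b : Bool) (P : Proc S V) :
    RStep Ax θ (Proc.pr b P Q) κ (D.par (!b) P) := by
  rw [← Proc.pr_not]; exact h.pr_left _ _

theorem pr_close_left {θ : V → Term S W} {P Q : Proc S V} {M : Term S W} {C D : Con S V}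
    (hP : RStep Ax θ P (.out M) C) (hQ : RStep Ax θ Q (.inp M) D) (b : Bool) :
    RStep Ax θ (Proc.pr b P Q) .tau (C.close b D) := by
  cases b
  · exact .closeR hP hQ (.refl _)
  · exact .closeL hP hQ (.refl _)

theorem pr_close_right {θ : V → Term S W} {P Q : Proc S V} {M : Term S W} {C D : Con S V}
    (hP : RStep Ax θ P (.inp M) C) (hQ : RStep Ax θ Q (.out M) D) (b : Bool) :
    RStep Ax θ (Proc.pr b P Q) .tau (D.close (!b) C) := by
  rw [← Proc.pr_not]; exact hQ.pr_close_left hP _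

theorem par_inv {θ : V → Term S W} {P Q : Proc S V} {κ : NLab S W} {E : Con S V}
    (h : RStep Ax θ (Proc.par P Q) κ E) :
    (∃ C, RStep Ax θ P κ C ∧ E = C.par true Q) ∨ (∃ D, RStep Ax θ Q κ D ∧ E = D.par false P) ∨
    (κ = .tau ∧ ∃ M C D, RStep Ax θ P (.out M) C ∧ RStep Ax θ Q (.inp M) D ∧ E = C.close true D) ∨
    (κ = .tau ∧ ∃ M C D, RStep Ax θ P (.inp M) C ∧ RStep Ax θ Q (.out M) D ∧
      E = D.close false C) := by
  cases h with
  | parL h => exact Or.inl ⟨_, h, rfl⟩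
  | parR h => exact Or.inr (Or.inl ⟨_, h, rfl⟩)
  | closeL h1 h2 he =>
    exact Or.inr (Or.inr (Or.inl ⟨rfl, _, _, _, h1, h2.relabel (.inp he.symm), rfl⟩))
  | closeR h1 h2 he =>
    exact Or.inr (Or.inr (Or.inr ⟨rfl, _, _, _, h2.relabel (.inp he.symm), h1, rfl⟩))

theorem pr_inv {θ : V → Term S W} {b : Bool} {P Q : Proc S V} {κ : NLab S W} {E : Con S V}
    (h : RStep Ax θ (Proc.pr b P Q) κ E) :
    (∃ C, RStep Ax θ P κ C ∧ E = C.par b Q) ∨ (∃ D, RStep Ax θ Q κ D ∧ E = D.par (!b) P) ∨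
    (κ = .tau ∧ ∃ M C D, RStep Ax θ P (.out M) C ∧ RStep Ax θ Q (.inp M) D ∧ E = C.close b D) ∨
    (κ = .tau ∧ ∃ M C D, RStep Ax θ P (.inp M) C ∧ RStep Ax θ Q (.out M) D ∧
      E = D.close (!b) C) := by
  cases b with
  | true => exact h.par_inv
  | false =>
    rcases h.par_inv with h | h | ⟨hκ, M, C, D, h1, h2, h3⟩ | ⟨hκ, M, C, D, h1, h2, h3⟩
    · exact Or.inr (Or.inl h)
    · exact Or.inl h
    · exact Or.inr (Or.inr (Or.inr ⟨hκ, M, D, C, h2, h1, h3⟩))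
    · exact Or.inr (Or.inr (Or.inl ⟨hκ, M, D, C, h2, h1, h3⟩))

end RStep

theorem NLab.eq_tau_of_subst {μ : NLab S V} {σ : V → Term S W} (h : μ.subst σ = .tau) : μ = .tau := by
  cases μ <;> first | rfl | cases h

theorem Ext.map_some_ev_label (A : Ext S (Option V)) (μ : NLab S V) :
    (μ.map some).subst A.ev = μ.subst (nu A).ev := NLab.map_subst _ _ _

theorem Ext.sync_in_of_wf (b : Bool) {a : Hy V} {θ : Frame S V} {P : Proc S V}
    (hA : (Ext.base θ P).WF a) {C D : Con S V} {K : Term S U} {K' : Term S U'}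
    (hC : C.Fits (NLab.inp K)) (hD : D.Fits (NLab.out K')) (hCP : C.fv ⊆ P.fv) {y : V}
    (hy : y ∉ a.known) (x : V) :
    Mix (Ext.recv b) y (C.toExt θ y) D (((D.subst θ.app).close (!b) C).toExt θ x) := by
  have hn := hA.normal.2
  refine Con.sync_in b hC hD (fun h => hy (hA.2.2 (hCP h)).1)
    (fun h => hy (hA.fv_subset (Or.inl h))) (fun p hp v hv hd => ?_)
    (fun v hv hd => (hn v hd).1 (hCP hv)) x
  obtain ⟨q, hq⟩ : ∃ q, p.1 = q ∧ p.2.fv ⊆ a.known \ ovars a.outs := by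
    have : ∀ F O l, GoodL F l → FrameWF O l θ → p.2.fv ⊆ F \ O := by
      intro F O l hF h
      clear hA hn hd
      induction h generalizing F with
      | nil => simp at hp
      | cons h _ ih =>
        rcases List.mem_cons.1 hp with rfl | hp
        · exact h.2.trans (Set.sdiff_subset_sdiff_left hF.2.2.1)
        · exact (ih hp _ hF.2.2.2.2).trans (Set.sdiff_subset_sdiff_left hF.2.2.1)
    exact ⟨_, rfl, this _ _ _ hA.1 hA.2.1⟩
  exact (hq.2 hv).2 (hA.2.1.dom_eq ▸ hd)

namespace Ext

theorem env_step_act (b : Bool) {A : Ext S V} {Q : Proc S V} {μ : NLab S V} {Y : Con S V}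
    (h : RStep Ax A.ev Q (μ.subst A.ev) Y) (x : V) :
    ∃ R, (A.env b Q).XStep Ax μ x R ∧ Mix (Ext.act b) x A Y R := by
  induction A with
  | base θ P =>
    refine ⟨_, ⟨_, RStep.pr_right (h.to_subst (θ := θ.app) (σ := Term.var) ?_) b P, rfl⟩,
      mix_act b x θ P Y⟩
    simp [ev]
  | nu A ih =>
    have h := h.to_subst (θ := fun v => Term.var (some v)) (σ := A.ev) rfl
    rw [← map_some_ev_label] at h
    obtain ⟨R, h1, h2⟩ := ih h (some x)
    exact ⟨_, ⟨R, h1, rfl⟩, .nuL h2⟩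

theorem env_step_left {b : Bool} {A A' : Ext S V} {Q : Proc S V} {μ : NLab S V} {x : V}
    (h : A.XStep Ax μ x A') (hx : x ∉ Q.fv) : (A.env b Q).XStep Ax μ x (A'.env b Q) := by
  induction A with
  | base θ P =>
    obtain ⟨C, hC, rfl⟩ := h
    exact ⟨_, hC.pr_left b _, Con.toExt_env b C θ hx⟩
  | nu A ih =>
    obtain ⟨A1, h1, rfl⟩ := h
    exact ⟨_, ih h1 (by simpa using hx), rfl⟩

theorem env_step_out [Nonempty V] (b : Bool) {A : Ext S V} {Q : Proc S V} {M : Term S V}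
    {D : Con S V} {f : V → W} (hf : f.Injective) {y : W} (hy : ∀ v, f v ≠ y) {A' : Ext S W}
    (h : (A.map f).XStep Ax (.out (M.map f)) y A') (hQ : RStep Ax A.ev Q (.inp (M.subst A.ev)) D)
    (x : V) : ∃ R R', (A.env b Q).XStep Ax .tau x R ∧ InsN f y A.len R R' ∧
      Mix (Ext.act b) y A' ((D.map f).enter y) R' := by
  rename_i hV
  revert hV
  induction A generalizing W with
  | base θ P =>
    intro hV
    obtain ⟨C', hC, rfl⟩ := h
    rw [NLab.subst_out, Term.map_app_rename hf] at hC
    obtain ⟨C, hC1, rfl⟩ := hC.of_subst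
    have hC' : RStep Ax (fun x => (Term.var x : Term S _).map f) P
      ((NLab.out (M.subst θ.app)).map f) C := hC1
    have hC := hC'.of_map hf
    obtain ⟨R, h1, h2⟩ := Con.sync_out b hC.fits hQ.fits x hf hy
    refine ⟨_, R, ⟨_, RStep.pr_close_left hC (hQ.to_subst (θ := θ.app) (σ := Term.var) ?_) b, rfl⟩,
      h1, h2⟩
    simp [ev]
  | nu A ih =>
    intro hV
    obtain ⟨A1, h1, rfl⟩ := h
    have hQ := hQ.to_subst (θ := fun v => Term.var (some v)) (σ := A.ev) rfl
    rw [← map_some_ev_term] at hQ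
    obtain ⟨R, R', h2, h3, h4⟩ := ih (M := M.map some) (Option.map_injective hf) (InsN.some_ne hy)
      (by rw [NLab.map_out, Term.map_map] at h1; rw [Term.map_map]; exact h1) hQ (some x)
    refine ⟨_, _, ⟨R, h2, rfl⟩, .nu h3, .nuL ?_⟩
    rw [Con.enter_map, Con.map_map]
    change Mix _ _ _ (((D.map some).map (Option.map f)).enter (some y)) _ at h4
    rw [Con.map_map] at h4
    exact h4

theorem env_step_inp (b : Bool) {a : Hy V} {A A' : Ext S V} (hA : A.WF a) {Q : Proc S V}
    {M : Term S V} {D : Con S V} {y : V} (hy : y ∉ a.known) (h : A.XStep Ax (.inp M) y A')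
    (hQ : RStep Ax A.ev Q (.out (M.subst A.ev)) D) (x : V) :
    ∃ R, (A.env b Q).XStep Ax .tau x R ∧ Mix (Ext.recv b) y A' D R := by
  induction A with
  | base θ P =>
    obtain ⟨C, hC, rfl⟩ := h
    refine ⟨_, ⟨_, RStep.pr_close_right hC (hQ.to_subst (θ := θ.app) (σ := Term.var) ?_) b, rfl⟩, ?_⟩
    · simp [ev]
    · exact sync_in_of_wf b hA hC.fits hQ.fits hC.fv_subset hy x
  | nu A ih =>
    obtain ⟨A1, h1, rfl⟩ := h
    have hQ := hQ.to_subst (θ := fun v => Term.var (some v)) (σ := A.ev) rfl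
    rw [← map_some_ev_term] at hQ
    obtain ⟨R, h2, h3⟩ := ih (a := a.up) hA (y := some y) (by simpa [Hy.up] using hy) h1 hQ (some x)
    exact ⟨_, ⟨R, h2, rfl⟩, .nuL h3⟩

/-- Each case describes the move in terms of `A` and an unevaluated transition of `Q`, so that `A`
can be replaced by a bisimilar process. The output case offers every injection `f` and every `y`
outside its range: the variable to be hidden must be new for the whole type, and the injection
extends under restrictions. -/
theorem env_step [Infinite V] {b : Bool} {a : Hy V} {A R : Ext S V} (hA : A.WF a) {Q : Proc S V}
    {μ : NLab S V} {x : V} (hx : x ∉ Q.fv) (h : (A.env b Q).XStep Ax μ x R) :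
    (∃ A', A.XStep Ax μ x A' ∧ R = A'.env b Q) ∨
    (∃ Y, RStep Ax A.ev Q (μ.subst A.ev) Y ∧ Mix (Ext.act b) x A Y R) ∨
    (μ = .tau ∧ ∃ (M : Term S V) (D : Con S V), RStep Ax A.ev Q (.inp (M.subst A.ev)) D ∧
      ∀ {W : Type} (f : V → W), f.Injective → ∀ y, (∀ v, f v ≠ y) →
        ∃ A' R', (A.map f).XStep Ax (.out (M.map f)) y A' ∧ InsN f y A.len R R' ∧
          Mix (Ext.act b) y A' ((D.map f).enter y) R') ∨
    (μ = .tau ∧ ∃ (M : Term S V) (D : Con S V), RStep Ax A.ev Q (.out (M.subst A.ev)) D ∧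
      ∀ y, y ∉ a.known → ∃ A', A.XStep Ax (.inp M) y A' ∧ Mix (Ext.recv b) y A' D R) := by
  rename_i hV
  revert hV
  induction A with
  | @base V θ P =>
    intro hV
    obtain ⟨E, hE, rfl⟩ := h
    have down {κ : NLab S V} {D : Con S V} (h : RStep Ax Term.var (Q.subst θ.app) κ D) :
        ∃ D', RStep Ax θ.app Q κ D' ∧ D = D'.subst θ.app := by
      obtain ⟨D', h1, h2⟩ := h.of_subst
      exact ⟨D', by simpa only [Term.subst_var] using h1, h2⟩
    rcases hE.pr_inv with ⟨C, hC, rfl⟩ | ⟨D, hD, rfl⟩ | ⟨hκ, M, C, D, hC, hD, rfl⟩ |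
      ⟨hκ, M, C, D, hC, hD, rfl⟩
    · exact Or.inl ⟨_, ⟨C, hC, rfl⟩, (Con.toExt_env b C θ hx).symm⟩
    · obtain ⟨D, hD', rfl⟩ := down hD
      exact Or.inr (Or.inl ⟨D, hD', mix_act b x θ P D⟩)
    · obtain ⟨D, hD', rfl⟩ := down hD
      obtain ⟨v⟩ : Nonempty V := inferInstance
      -- The common subject must be named by a recipe over `V`, as it becomes part of a label of
      -- `A`.
      obtain ⟨μ', hμ'⟩ := hD'.subject v
      cases μ' with
      | inp K =>
        refine Or.inr (Or.inr (Or.inl ⟨NLab.eq_tau_of_subst hκ, K, D,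
          hD'.relabel hμ', fun {W} f hf y hy => ?_⟩))
        obtain ⟨R, h1, h2⟩ := Con.sync_out b hC.fits hD'.fits x hf hy
        refine ⟨_, R, ⟨C.map f, ?_, rfl⟩, h1, h2⟩
        rw [NLab.subst_out, Term.map_app_rename hf]
        cases hμ' with
        | inp he =>
          have := (hC.relabel (.out he)).inst fun y => Term.var (f y)
          exact this.to_subst rfl
      | _ => cases hμ'
    · obtain ⟨D, hD', rfl⟩ := down hD
      obtain ⟨v⟩ : Nonempty V := inferInstance
      obtain ⟨μ', hμ'⟩ := hD'.subject v
      cases μ' with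
      | out K =>
        refine Or.inr (Or.inr (Or.inr ⟨NLab.eq_tau_of_subst hκ, K, D,
          hD'.relabel hμ', fun y hy => ?_⟩))
        refine ⟨_, ⟨C, ?_, rfl⟩, sync_in_of_wf b hA hC.fits hD'.fits hC.fv_subset hy x⟩
        cases hμ' with | out he => exact hC.relabel (.inp he)
      | _ => cases hμ'
  | @nu V A ih =>
    intro hV
    obtain ⟨R1, h1, rfl⟩ := h
    have down {κ : NLab S A.Leaf} {D : Con S (Option V)} (h : RStep Ax A.ev (Q.map some) κ D) :
        ∃ D', RStep Ax (Ext.nu A).ev Q κ D' ∧ D = D'.map some := h.of_subst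
    rcases ih (a := a.up) hA (by simpa using hx) h1 with ⟨A', h2, rfl⟩ | ⟨Y, h2', h3⟩ |
      ⟨hμ, M, D, h2', h3⟩ | ⟨hμ, M, D, h2', h3⟩
    · exact Or.inl ⟨_, ⟨A', h2, rfl⟩, rfl⟩
    · obtain ⟨Y, h2, rfl⟩ := down h2'
      rw [map_some_ev_label] at h2
      exact Or.inr (Or.inl ⟨Y, h2, .nuL h3⟩)
    · obtain ⟨D, h2, rfl⟩ := down h2'
      obtain ⟨v⟩ : Nonempty V := inferInstance
      -- The recipe obtained below the restriction may mention the restricted variable. As `Q` does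
      -- not, an equal recipe without it is read off from the transition of `Q`.
      obtain ⟨μ', hμ'⟩ := h2.subject v
      cases μ' with
      | inp K =>
        refine Or.inr (Or.inr (Or.inl ⟨NLab.eq_tau_of_subst hμ, K, D,
          h2.relabel hμ', fun {W} f hf y hy => ?_⟩))
        obtain ⟨A', R', h4, h5, h6⟩ := h3 (Option.map f) (Option.map_injective hf) (some y)
          (InsN.some_ne hy)
        refine ⟨_, _, ⟨A', h4.relabel ?_, rfl⟩, .nu h5, .nuL ?_⟩
        · cases hμ' with
          | inp he =>
            rw [← map_some_ev_term, ← equates_iff, ← equates_map (Option.map_injective hf),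
              equates_iff, Term.map_map some] at he
            simp only [NLab.map_out, Term.map_map f]
            exact .out he
        · rw [Con.enter_map, Con.map_map]
          change Mix _ _ _ (((D.map some).map (Option.map f)).enter (some y)) _ at h6
          rw [Con.map_map] at h6
          exact h6
      | _ => cases hμ'
    · obtain ⟨D, h2, rfl⟩ := down h2'
      obtain ⟨v⟩ : Nonempty V := inferInstance
      obtain ⟨μ', hμ'⟩ := h2.subject v
      cases μ' with
      | out K =>
        refine Or.inr (Or.inr (Or.inr ⟨NLab.eq_tau_of_subst hμ, K, D,
          h2.relabel hμ', fun y hy => ?_⟩))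
        obtain ⟨A', h4, h5⟩ := h3 (some y) (by simpa [Hy.up] using hy)
        refine ⟨_, ⟨A', h4.relabel ?_, rfl⟩, .nuL h5⟩
        cases hμ' with
        | out he => rw [← map_some_ev_term] at he; exact .inp he
      | _ => cases hμ'

end Ext

end Par

/-! ### The congruence closure of open bisimilarity -/

/-- The abstract history of a history. -/
def History.toHy : History S → Hy Name
  | nil => ⟨∅, []⟩
  | out h x => ⟨insert x h.toHy.known, (x, h.toHy.known) :: h.toHy.outs⟩
  | inp h M => ⟨h.toHy.known ∪ M.fv, h.toHy.outs⟩

/-- The least relation that contains the open bisimulations and is closed under the operations of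
the calculus. -/
inductive Bis (Ax : Term S Name → Term S Name → Prop) :
    {V : Type} → Hy V → Ext S V → Ext S V → Prop
  | bisim {R : History S → Ext S Name → Ext S Name → Prop} {h : History S} {a : Hy Name}
      {A B : Ext S Name} : IsOpenBisim Ax R → R h A B → h.toHy ≤ a → A.WF a → B.WF a → Bis Ax a A B
  | refl {V : Type} {a : Hy V} {A : Ext S V} : Infinite V → A.WF a → Bis Ax a A A
  | trans {V : Type} {a : Hy V} {A B C : Ext S V} : Bis Ax a A B → Bis Ax a B C → Bis Ax a A C
  | mono {V : Type} {a b : Hy V} {A B : Ext S V} : Bis Ax a A B → a ≤ b → b.Good → Bis Ax b A B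
  | iso {V W : Type} {a : Hy V} {A B : Ext S V} (e : V ≃ W) : Bis Ax a A B →
      Bis Ax (a.map e) (A.map e) (B.map e)
  -- The two sides may restrict the variable at different depths, as their own restrictions need not
  -- agree.
  | nu {V : Type} {a : Hy V} {A B : Ext S (Option V)} {C D : Ext S V} : Bis Ax a.up A B →
      NuAt A C → NuAt B D → Bis Ax a C D
  -- Needed after a communication from the process to its environment.
  | hide {V : Type} {a : Hy V} {b : Hy (Option V)} {i : ℕ} {A B : Ext S V}
      {A' B' : Ext S (Option V)} : Bis Ax b A' B' → HidRel some none i a b → a.Good →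
      InsN some none i A A' → InsN some none i B B' → Bis Ax a A B
  | env {V : Type} {a : Hy V} {A B : Ext S V} (b : Bool) {Q : Proc S V} : Bis Ax a A B →
      Q.fv ⊆ a.known → Bis Ax a (A.env b Q) (B.env b Q)
  -- Needed after an output of the environment. The position `i` is arbitrary because further
  -- outputs of the process may follow.
  | recipe {V : Type} {a b : Hy V} {x : V} {M : Term S V} {i : ℕ} {A B A' B' : Ext S V} :
      Bis Ax a A B → RecRel x M i a b → b.Good → InsE x M i A A' → InsE x M i B B' →
      Bis Ax b A' B'
  | out {V : Type} {a : Hy V} {M N : Term S V} {P Q : Proc S V} : a.outs = [] →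
      M.fv ⊆ a.known → N.fv ⊆ a.known → Bis Ax a (Ext.base [] P) (Ext.base [] Q) →
      Bis Ax a (Ext.base [] (Proc.out M N P)) (Ext.base [] (Proc.out M N Q))
  | inp {V : Type} {a : Hy V} {M : Term S V} {P Q : Proc S (Option V)} : a.outs = [] →
      M.fv ⊆ a.known → Bis Ax a.up (Ext.base [] P) (Ext.base [] Q) →
      Bis Ax a (Ext.base [] (Proc.inp M P)) (Ext.base [] (Proc.inp M Q))
  | mat {V : Type} {a : Hy V} {M N : Term S V} {P Q : Proc S V} : a.outs = [] →
      M.fv ⊆ a.known → N.fv ⊆ a.known → Bis Ax a (Ext.base [] P) (Ext.base [] Q) →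
      Bis Ax a (Ext.base [] (Proc.mat M N P)) (Ext.base [] (Proc.mat M N Q))
  | res {V : Type} {a : Hy V} {P Q : Proc S (Option V)} : a.outs = [] →
      Bis Ax a.up (Ext.base [] P) (Ext.base [] Q) →
      Bis Ax a (Ext.base [] (Proc.nu P)) (Ext.base [] (Proc.nu Q))
  | sum {V : Type} {a : Hy V} {P Q P' Q' : Proc S V} : a.outs = [] →
      Bis Ax a (Ext.base [] P) (Ext.base [] Q) → Bis Ax a (Ext.base [] P') (Ext.base [] Q') →
      Bis Ax a (Ext.base [] (Proc.sum P P')) (Ext.base [] (Proc.sum Q Q'))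
  | rep {V : Type} {a : Hy V} {P Q : Proc S V} : a.outs = [] →
      Bis Ax a (Ext.base [] P) (Ext.base [] Q) →
      Bis Ax a (Ext.base [] (Proc.rep P)) (Ext.base [] (Proc.rep Q))

namespace History

theorem toHy_known (h : History S) : h.toHy.known = h.fv := by
  induction h with
  | nil => rfl
  | out h x ih => rw [fv, toHy, ih, Set.union_singleton]
  | inp h M ih => rw [fv, toHy, ih]

theorem respects_toHy {h : History S} {σ : Name → Term S Name} :
    h.toHy.Respects σ ↔ h.Respects σ := by
  induction h with
  | nil => simp [Hy.Respects, toHy, Respects]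
  | out h x ih =>
    simp only [Hy.Respects, toHy, Respects, List.forall_mem_cons, ← ih, toHy_known]
    exact and_comm
  | inp h M ih => exact ih

theorem toHy_subst {h : History S} {σ : Name → Term S Name} (hσ : h.Respects σ) :
    (h.subst σ).toHy = h.toHy.subst σ := by
  induction h with
  | nil => simp [subst, toHy, Hy.subst, img]
  | out h x ih =>
    obtain ⟨h1, h2, -⟩ := hσ
    simp only [subst, toHy, ih h1, Hy.subst, List.map_cons]
    congr 1
    ext y
    simp [img, h2]
  | inp h M ih =>
    simp only [subst, toHy, ih hσ, Hy.subst]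
    congr 1
    ext y
    simp [img, Term.mem_fv_subst, or_and_right, exists_or]

end History

/-! ### Processes with empty active substitution, and substitutions conjugated by bijections. -/

section Base

variable {Ax : Term S Name → Term S Name → Prop} {V W : Type}

theorem Ext.wf_base_nil {a : Hy V} (ha : a.outs = []) {P : Proc S V} :
    (Ext.base [] P).WF a ↔ a.known.Finite ∧ P.fv ⊆ a.known := by
  obtain ⟨F, l⟩ := a
  subst ha
  simp only [Ext.WF, Hy.Good, GoodL, ovars_nil, Set.sdiff_empty]
  exact ⟨fun h => ⟨h.1, h.2.2⟩, fun h => ⟨h.1, .nil, h.2⟩⟩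

theorem Ext.base_nil_subst (P : Proc S V) (σ : V → Term S V) :
    (Ext.base [] P).subst σ = Ext.base [] (P.subst σ) := by
  simp [Ext.subst, Frame.subst]

theorem Hy.subst_outs_nil {a : Hy V} (ha : a.outs = []) (σ : V → Term S V) :
    (a.subst σ).outs = [] := by simp [Hy.subst, ha]

theorem Hy.up_outs_nil {a : Hy V} (ha : a.outs = []) : a.up.outs = [] := by simp [Hy.up, ha]

theorem Term.map_symm_map (e : V ≃ W) (M : Term S W) : (M.map e.symm).map e = M := by
  rw [Term.map_map]
  simp only [Equiv.apply_symm_apply]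
  exact Term.subst_var M

theorem infinite_of_option (h : Infinite (Option V)) : Infinite V := by
  by_contra hV
  rw [not_infinite_iff_finite] at hV
  exact not_finite (Option V)

theorem Hy.map_subst_equiv (a : Hy V) (e : V ≃ W) (σ : W → Term S W) :
    (a.map e).subst σ = (a.subst fun v => (σ (e v)).map e.symm).map e := by
  have key (X : Set V) : img σ (e '' X) = e '' img (fun v => (σ (e v)).map e.symm) X := by
    ext w
    simp only [img, Set.mem_image, Set.mem_ofPred_eq, Term.mem_fv_map]
    constructor
    · rintro ⟨_, ⟨v, hv, rfl⟩, hw⟩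
      exact ⟨e.symm w, ⟨v, hv, w, hw, rfl⟩, by simp⟩
    · rintro ⟨_, ⟨v, hv, w, hw, rfl⟩, rfl⟩
      exact ⟨e v, ⟨v, hv, rfl⟩, by simpa using hw⟩
  simp [Hy.map, Hy.subst, key]

theorem Hy.Respects.of_map_equiv {a : Hy V} {e : V ≃ W} {σ : W → Term S W}
    (h : (a.map e).Respects σ) : a.Respects fun v => (σ (e v)).map e.symm := by
  intro p hp
  obtain ⟨h1, h2⟩ := h (e p.1, e '' p.2) (List.mem_map_of_mem hp)
  refine ⟨by simp [h1], fun y hy hm => ?_⟩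
  obtain ⟨w, hw, he⟩ := Term.mem_fv_map.1 hm
  refine h2 (e y) ⟨y, hy, rfl⟩ ?_
  rw [he, Equiv.apply_symm_apply]
  exact hw

end Base

namespace Bis

variable {Ax : Term S Name → Term S Name → Prop} {V W : Type}

theorem infinite {a : Hy V} {A B : Ext S V} (h : Bis Ax a A B) : Infinite V := by
  induction h with
  | bisim => exact inferInstanceAs (Infinite ℕ)
  | refl h => exact h
  | iso e _ ih => exact e.infinite_iff.1 ih
  | nu _ _ _ ih => exact infinite_of_option ih
  | hide _ _ _ _ _ ih => exact infinite_of_option ih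
  | inp _ _ _ ih => exact infinite_of_option ih
  | res _ _ ih => exact infinite_of_option ih
  | _ => assumption

theorem symm {a : Hy V} {A B : Ext S V} (h : Bis Ax a A B) : Bis Ax a B A := by
  induction h with
  | bisim hR h ha hA hB => exact .bisim hR (hR.symm h) ha hB hA
  | refl h hA => exact .refl h hA
  | trans _ _ ih1 ih2 => exact .trans ih2 ih1
  | mono _ h1 h2 ih => exact .mono ih h1 h2
  | iso e _ ih => exact .iso e ih
  | nu _ h1 h2 ih => exact .nu ih h2 h1
  | hide _ h1 h2 h3 h4 ih => exact .hide ih h1 h2 h4 h3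
  | env b _ hQ ih => exact .env b ih hQ
  | recipe _ h1 h2 h3 h4 ih => exact .recipe ih h1 h2 h4 h3
  | out ha hM hN _ ih => exact .out ha hM hN ih
  | inp ha hM _ ih => exact .inp ha hM ih
  | mat ha hM hN _ ih => exact .mat ha hM hN ih
  | res ha _ ih => exact .res ha ih
  | sum ha _ _ ih1 ih2 => exact .sum ha ih1 ih2
  | rep ha _ ih => exact .rep ha ih

theorem wf {a : Hy V} {A B : Ext S V} (h : Bis Ax a A B) : A.WF a ∧ B.WF a := by
  induction h with
  | bisim hR h ha hA hB => exact ⟨hA, hB⟩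
  | refl h hA => exact ⟨hA, hA⟩
  | trans _ _ ih1 ih2 => exact ⟨ih1.1, ih2.2⟩
  | mono _ h1 h2 ih => exact ⟨ih.1.mono h1 h2, ih.2.mono h1 h2⟩
  | iso e _ ih => exact ⟨ih.1.map e.injective, ih.2.map e.injective⟩
  | nu _ h1 h2 ih => exact ⟨h1.wf ih.1, h2.wf ih.2⟩
  | hide _ h1 h2 h3 h4 ih =>
    exact ⟨h3.wf (Option.some_injective _) h1 h2 ih.1, h4.wf (Option.some_injective _) h1 h2 ih.2⟩
  | env b _ hQ ih => exact ⟨Ext.env_wf ih.1 hQ, Ext.env_wf ih.2 hQ⟩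
  | recipe _ h1 h2 h3 h4 ih => exact ⟨h3.wf ih.1 h1 h2, h4.wf ih.2 h1 h2⟩
  | out ha hM hN _ ih =>
    simp only [Ext.wf_base_nil ha] at ih ⊢
    exact ⟨⟨ih.1.1, Set.union_subset (Set.union_subset hM hN) ih.1.2⟩,
      ⟨ih.1.1, Set.union_subset (Set.union_subset hM hN) ih.2.2⟩⟩
  | inp ha hM _ ih =>
    simp only [Ext.wf_base_nil ha, Ext.wf_base_nil (Hy.up_outs_nil ha)] at ih ⊢
    exact ⟨⟨Hy.upS_finite.1 ih.1.1, Set.union_subset hM fun x hx => some_mem_upS.1 (ih.1.2 hx)⟩,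
      ⟨Hy.upS_finite.1 ih.1.1, Set.union_subset hM fun x hx => some_mem_upS.1 (ih.2.2 hx)⟩⟩
  | mat ha hM hN _ ih =>
    simp only [Ext.wf_base_nil ha] at ih ⊢
    exact ⟨⟨ih.1.1, Set.union_subset (Set.union_subset hM hN) ih.1.2⟩,
      ⟨ih.1.1, Set.union_subset (Set.union_subset hM hN) ih.2.2⟩⟩
  | res ha _ ih =>
    simp only [Ext.wf_base_nil ha, Ext.wf_base_nil (Hy.up_outs_nil ha)] at ih ⊢
    exact ⟨⟨Hy.upS_finite.1 ih.1.1, fun x hx => some_mem_upS.1 (ih.1.2 hx)⟩,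
      ⟨Hy.upS_finite.1 ih.1.1, fun x hx => some_mem_upS.1 (ih.2.2 hx)⟩⟩
  | sum ha _ _ ih1 ih2 =>
    simp only [Ext.wf_base_nil ha] at ih1 ih2 ⊢
    exact ⟨⟨ih1.1.1, Set.union_subset ih1.1.2 ih2.1.2⟩, ⟨ih1.1.1, Set.union_subset ih1.2.2 ih2.2.2⟩⟩
  | rep ha _ ih =>
    simp only [Ext.wf_base_nil ha] at ih ⊢
    exact ih

theorem static {a : Hy V} {A B : Ext S V} (h : Bis Ax a A B) : StaticEq Ax A B := by
  have hV := h.infinite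
  induction h with
  | bisim hR h ha hA hB => exact hR.static h
  | refl h hA => exact fun M N => Iff.rfl
  | trans h1 h2 ih1 ih2 => exact fun M N => (ih1 hV M N).trans (ih2 hV M N)
  | mono _ h1 h2 ih => exact ih hV
  | iso e h ih =>
    intro M N
    have := h.infinite
    have h1 := ih this (M.map e.symm) (N.map e.symm)
    rw [← Ext.equates_map e.injective, ← Ext.equates_map e.injective] at h1
    simpa only [Term.map_symm_map] using h1
  | nu h h1 h2 ih => exact fun M N => (h1.equates.trans (ih h.infinite _ _)).trans h2.equates.symm
  | hide h _ _ h3 h4 ih =>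
    have hy {V : Type} : ∀ v : V, some v ≠ none := fun v => by simp
    exact fun M N => ((h3.equates (Option.some_injective _) hy).trans (ih h.infinite _ _)).trans
      (h4.equates (Option.some_injective _) hy).symm
  | env b _ hQ ih => exact fun M N => (Ext.env_equates.trans (ih hV M N)).trans Ext.env_equates.symm
  | recipe h _ _ h3 h4 ih =>
    exact fun M N => (h3.equates.trans (ih hV _ _)).trans h4.equates.symm
  -- The remaining rules relate plain processes, whose active substitutions are both empty.
  | _ => exact fun M N => Iff.rfl

theorem subst {a : Hy V} {A B : Ext S V} (h : Bis Ax a A B) {σ : V → Term S V}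
    (hσ : a.Respects σ) : Bis Ax (a.subst σ) (A.subst σ) (B.subst σ) := by
  have hfv {V : Type} {a : Hy V} {σ : V → Term S V} {M : Term S V} (hM : M.fv ⊆ a.known) :
      (M.subst σ).fv ⊆ (a.subst σ).known := by
    intro v hv
    obtain ⟨w, hw, hv⟩ := Term.mem_fv_subst.1 hv
    exact ⟨w, hM hw, hv⟩
  induction h with
  | bisim hR h ha hA hB =>
    have h1 := History.respects_toHy.1 (Hy.Respects.of_le ha hσ)
    refine .bisim hR (hR.subst h σ h1) ?_ (hA.subst hσ) (hB.subst hσ)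
    rw [History.toHy_subst h1]
    exact Hy.subst_le ha σ
  | refl h hA => exact .refl h (hA.subst hσ)
  | trans _ _ ih1 ih2 => exact .trans (ih1 hσ) (ih2 hσ)
  | mono _ h1 h2 ih => exact .mono (ih (hσ.of_le h1)) (Hy.subst_le h1 σ) (h2.subst hσ)
  | @iso V W a A B e _ ih =>
    have h1 : ∀ v, σ (e v) = ((σ (e v)).map e.symm).map e := fun v =>
      (Term.map_symm_map e _).symm
    rw [Ext.subst_rename A e.injective h1, Ext.subst_rename B e.injective h1, Hy.map_subst_equiv]
    exact .iso e (ih hσ.of_map_equiv)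
  | nu _ h1 h2 ih =>
    refine .nu ?_ (h1.subst σ) (h2.subst σ)
    rw [Hy.up_subst]
    exact ih hσ.up
  | hide h h1 h2 h3 h4 ih =>
    have hy {V : Type} : ∀ v : V, some v ≠ none := fun v => by simp
    exact .hide (ih (h1.respects h.wf.1.good hσ)) (h1.subst σ) (h2.subst hσ)
      (h3.subst (Option.some_injective _) hy fun v => rfl)
      (h4.subst (Option.some_injective _) hy fun v => rfl)
  | env b h hQ ih =>
    rw [Ext.env_subst h.wf.1 _ hσ, Ext.env_subst h.wf.2 _ hσ]
    refine .env b (ih hσ) fun v hv => ?_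
    obtain ⟨w, hw, hv⟩ := Proc.mem_fv_subst.1 hv
    exact ⟨w, hQ hw, hv⟩
  | recipe h h1 h2 h3 h4 ih =>
    have hg := h.wf.1.good
    exact .recipe (ih (h1.respects hg h2 hσ)) (h1.subst hg h2 hσ) (h2.subst hσ)
      (h3.subst h.wf.1 h1 h2 hσ) (h4.subst h.wf.2 h1 h2 hσ)
  | out ha hM hN _ ih =>
    have := ih hσ
    rw [Ext.base_nil_subst, Ext.base_nil_subst] at this ⊢
    exact .out (Hy.subst_outs_nil ha σ) (hfv hM) (hfv hN) this
  | inp ha hM _ ih =>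
    have := ih hσ.up
    rw [Ext.base_nil_subst, Ext.base_nil_subst] at this ⊢
    rw [← Hy.up_subst] at this
    exact .inp (Hy.subst_outs_nil ha σ) (hfv hM) this
  | mat ha hM hN _ ih =>
    have := ih hσ
    rw [Ext.base_nil_subst, Ext.base_nil_subst] at this ⊢
    exact .mat (Hy.subst_outs_nil ha σ) (hfv hM) (hfv hN) this
  | res ha _ ih =>
    have := ih hσ.up
    rw [Ext.base_nil_subst, Ext.base_nil_subst] at this ⊢
    rw [← Hy.up_subst] at this
    exact .res (Hy.subst_outs_nil ha σ) this
  | sum ha _ _ ih1 ih2 =>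
    have h1 := ih1 hσ
    have h2 := ih2 hσ
    rw [Ext.base_nil_subst, Ext.base_nil_subst] at h1 h2 ⊢
    exact .sum (Hy.subst_outs_nil ha σ) h1 h2
  | rep ha _ ih =>
    have := ih hσ
    rw [Ext.base_nil_subst, Ext.base_nil_subst] at this ⊢
    exact .rep (Hy.subst_outs_nil ha σ) this

end Bis

/-! ### Finite injections, and actions of the environment as operations on extended processes. -/

section Act

variable {Ax : Term S Name → Term S Name → Prop} {V W : Type}

/-- A finite set has smaller cardinality than the infinite type, so an injection on it extends to a
bijection. -/
theorem exists_equiv_extending [Infinite V] (e0 : V ≃ W) {X : Set V} (hX : X.Finite) {f : V → W}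
    (hf : Set.InjOn f X) : ∃ e : V ≃ W, ∀ x ∈ X, e x = f x := by
  obtain ⟨e, he⟩ := Cardinal.extend_function_of_lt (s := X) ⟨fun x => f x, fun x y h =>
    Subtype.ext (hf x.2 y.2 h)⟩ (by
      have := hX.to_subtype
      exact (Cardinal.mk_lt_aleph0).trans_le (Cardinal.aleph0_le_mk V)) ⟨e0⟩
  exact ⟨e, fun x hx => he ⟨x, hx⟩⟩

theorem exists_equiv_option (V : Type) [Infinite V] : Nonempty (V ≃ Option V) := by
  rw [← Cardinal.eq, Cardinal.mk_option, Cardinal.add_one_eq (Cardinal.aleph0_le_mk V)]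

theorem Hy.Good.map_congr {a : Hy V} (ha : a.Good) {f g : V → W} (h : ∀ x ∈ a.known, f x = g x) :
    a.map f = a.map g := by
  have h1 : ∀ p ∈ a.outs, f p.1 = g p.1 ∧ f '' p.2 = g '' p.2 := fun p hp =>
    ⟨h _ (ha.ovars_subset ⟨p, hp, rfl⟩), Set.image_congr fun x hx => h x (ha.subset p hp hx)⟩
  simp only [Hy.map, Set.image_congr h, Hy.mk.injEq, true_and]
  exact List.map_congr_left fun p hp => by rw [(h1 p hp).1, (h1 p hp).2]

namespace Ext

theorem act_tau (b : Bool) (x : V) (A : Ext S V) (Q : Proc S V) :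
    A.act b x (.tau Q) = A.env b Q := by
  induction A with
  | base θ P => simp only [act, env, Body.subst, Body.par, Con.toExt, Proc.pr_not]
  | nu A ih => simp only [act, env, Body.subst, ih]; rfl

theorem act_inp (b : Bool) {x : V} {A : Ext S V} (hx : x ∉ A.dom) (Q : Proc S (Option V)) :
    A.act b x (.inp Q) = A.env b (Q.subst (instBound (Term.var x))) := by
  induction A with
  | base θ P =>
    simp only [act, env, Body.subst, Body.par, Con.toExt, Proc.pr_not, Proc.pr_subst]
    congr 2
    · rw [Proc.map_subst]
      exact Proc.subst_var _
    · rw [Proc.subst_subst, Proc.subst_subst]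
      congr 1
      funext v
      cases v with
      | none => simp [instBound, Frame.app_of_notMem hx]
      | some v =>
        simp only [instBound, lift_some, Term.map_subst, Term.subst_var_apply]
        exact Term.subst_var _
  | nu A ih =>
    simp only [act, env, Body.subst]
    rw [ih hx, lift_var_comp]
    congr 2
    exact (Con.instBound_map some x Q).symm

/-- The environment's output is the newest entry, hence the position `A.len`; since `x` is fresh for
`Q`, the entry does not change the evaluation of `Q`. -/
theorem act_out (b : Bool) {x : V} (A : Ext S V) (N : Term S V) {Q : Proc S V} (hx : x ∉ Q.fv) :
    ∃ A', InsE x N A.len A A' ∧ A.act b x (.out N Q) = A'.env b Q := by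
  induction A with
  | base θ P =>
    refine ⟨_, InsE.base (θ := []) (by simp [Frame.dom]), ?_⟩
    simp only [act, env, Body.subst, Body.par, Con.toExt, Proc.pr_not, List.nil_append]
    congr 2
    exact Proc.subst_congr fun v hv => (Frame.app_cons_ne _ _ (by rintro rfl; exact hx hv)).symm
  | nu A ih =>
    obtain ⟨A', h1, h2⟩ := ih (x := some x) (N.map some) (Q := Q.map some) (by simpa using hx)
    exact ⟨_, .nu h1, congrArg nu h2⟩

end Ext

end Act

namespace Bis

variable {Ax : Term S Name → Term S Name → Prop} {U V W : Type}

/-- Only finitely many variables are known, so `f` agrees on them with a bijection and the rule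
`Bis.iso` applies. -/
theorem map_injOn {a : Hy V} {A B : Ext S V} (h : Bis Ax a A B) (e0 : V ≃ W) {f : V → W}
    (hf : Set.InjOn f a.known) : Bis Ax (a.map f) (A.map f) (B.map f) := by
  have := h.infinite
  obtain ⟨hA, hB⟩ := h.wf
  obtain ⟨e, he⟩ := exists_equiv_extending e0 hA.good.finite hf
  rw [← hA.good.map_congr he, ← Ext.map_congr fun x hx => he x (hA.fv_subset hx),
    ← Ext.map_congr fun x hx => he x (hB.fv_subset hx)]
  exact .iso e h

theorem weaken {a : Hy V} {A B : Ext S V} (h : Bis Ax a A B) :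
    Bis Ax a.up (A.map some) (B.map some) := by
  have := h.infinite
  obtain ⟨e0⟩ := exists_equiv_option V
  exact .mono (h.map_injOn e0 (Option.some_injective _).injOn) a.map_le_up
    (Hy.good_up.2 h.wf.1.good)

/-- Entering a binder with a new variable `x` is the renaming of `none` to `x`, which is injective
on the known variables because `x` was not among them. -/
theorem enter {a : Hy V} {P Q : Proc S (Option V)} (ha : a.outs = []) {x : V} (hx : x ∉ a.known)
    (h : Bis Ax a.up (Ext.base [] P) (Ext.base [] Q)) (M : Term S W) :
    Bis Ax (a.after (NLab.inp M) x) (Ext.base [] (P.subst (instBound (Term.var x))))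
      (Ext.base [] (Q.subst (instBound (Term.var x)))) := by
  have hV := h.infinite
  have := infinite_of_option hV
  obtain ⟨e0⟩ := exists_equiv_option V
  have hf : Set.InjOn (fun v : Option V => v.getD x) a.up.known := by
    rintro (_ | v) hv (_ | w) hw hvw
    · rfl
    · obtain rfl : x = w := hvw
      exact (hx (some_mem_upS.1 hw)).elim
    · obtain rfl : v = x := hvw
      exact (hx (some_mem_upS.1 hv)).elim
    · exact congrArg some hvw
  have h1 := h.map_injOn e0.symm hf
  have e (P : Proc S (Option V)) : (Ext.base [] P).map (fun v : Option V => v.getD x) =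
      Ext.base [] (P.subst (instBound (Term.var x))) := by
    simp only [Ext.map, Frame.rename_nil]
    congr 1
    unfold Proc.map
    congr 1
    funext v
    cases v <;> rfl
  rw [e, e] at h1
  have hg := Hy.good_up.1 h.wf.1.good
  refine h1.mono ⟨?_, ?_⟩ (hg.after _ hx)
  · rintro _ ⟨v, hv, rfl⟩
    cases v with
    | none => exact Or.inl rfl
    | some v => exact Or.inr (some_mem_upS.1 hv)
  · simp [Hy.map, Hy.up, Hy.after, ha]

theorem act {a : Hy V} {A B : Ext S V} (h : Bis Ax a A B) (b : Bool) {c : Body S V}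
    {μ : NLab S W} {x : V} (hc : (Con.base c).Fits μ) (hca : c.fv ⊆ a.known)
    (hx : x ∈ a.known → μ = .tau) : Bis Ax (a.after μ x) (A.act b x c) (B.act b x c) := by
  obtain ⟨hA, hB⟩ := h.wf
  cases c <;> cases μ <;> try exact hc.elim
  · rw [Ext.act_tau, Ext.act_tau]
    exact h.env b hca
  · rename_i N Q M
    have hx : x ∉ a.known := fun h => by cases hx h
    have hxQ : x ∉ Q.fv := fun h => hx (hca (Or.inr h))
    obtain ⟨A', h1, h2⟩ := A.act_out b N hxQ
    obtain ⟨B', h3, h4⟩ := B.act_out b N hxQ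
    rw [hA.len_eq] at h1
    rw [hB.len_eq] at h3
    rw [h2, h4]
    refine .env b (.recipe h ⟨Set.subset_insert _ _, hx, [], a.outs, [], a.outs, a.known, rfl, rfl,
      rfl, .nil, (Hy.le_refl a).2, fun v hv => hca (Or.inl hv)⟩ (hA.good.after (.out M) hx) h1 h3) ?_
    exact fun v hv => Or.inr (hca (Or.inr hv))
  · rename_i Q M
    have hx : x ∉ a.known := fun h => by cases hx h
    have hdom {A : Ext S V} (hA : A.WF a) : x ∉ A.dom := fun h =>
      hx (hA.good.ovars_subset (hA.dom_eq ▸ h))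
    rw [Ext.act_inp b (hdom hA), Ext.act_inp b (hdom hB)]
    refine .env b (h.mono ⟨Set.subset_insert _ _, (Hy.le_refl a).2⟩
      (hA.good.after (.inp M) hx)) fun v hv => ?_
    obtain ⟨w, hw, hv⟩ := Proc.mem_fv_subst.1 hv
    cases w with
    | none => exact Or.inl hv
    | some w => obtain rfl : v = w := hv; exact Or.inr (hca hw)

/-- The input variable `y` is newer than all outputs, so substituting a message over the known
variables for it respects the history. The result then returns to the history before the input. -/
theorem recv {a : Hy V} (ha : a.Good) {A B : Ext S V} {M : Term S U} {y : V} (hy : y ∉ a.known)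
    (h : Bis Ax (a.after (NLab.inp M) y) A B) (b : Bool) {c : Body S V}
    {K : Term S W} (hc : (Con.base c).Fits (NLab.out K)) (hca : c.fv ⊆ a.known) :
    Bis Ax a (A.recv b y c) (B.recv b y c) := by
  cases c <;> try exact hc.elim
  rename_i N Q
  have hne : ∀ v ∈ a.known, single y N v = Term.var v := fun v hv =>
    single_of_ne _ (by rintro rfl; exact hy hv)
  refine .env b ((h.subst (σ := single y N) ?_).mono ?_ ha) fun v hv => hca (Or.inr hv)
  · intro p hp
    refine ⟨hne _ (ha.ovars_subset ⟨p, hp, rfl⟩), fun v hv hm => ?_⟩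
    rw [hne v (ha.subset p hp hv)] at hm
    obtain rfl : p.1 = v := hm
    exact ha.notMem p hp hv
  · refine Hy.le_of_map ?_ rfl (List.map_id _).symm fun p hp => ⟨rfl, ?_⟩
    · rintro v ⟨w, hw, hv⟩
      rcases hw with rfl | hw
      · rw [single_self] at hv
        exact hca (Or.inl hv)
      · rw [hne w hw] at hv
        obtain rfl : v = w := hv
        exact hw
    · rintro v ⟨w, hw, hv⟩
      rw [hne w (ha.subset p hp hw)] at hv
      obtain rfl : v = w := hv
      exact hw

theorem mix_act {a : Hy V} {A B R R' : Ext S V} (h : Bis Ax a A B) {b : Bool} {C : Con S V}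
    {μ : NLab S W} {x : V} (hC : C.Fits μ) (hCa : C.fv ⊆ a.known) (hx : x ∈ a.known → μ = .tau)
    (hR : Mix (Ext.act b) x A C R) (hR' : Mix (Ext.act b) x B C R') :
    Bis Ax (a.after μ x) R R' := by
  induction C with
  | base c =>
    rw [hR.base_inv (Ext.isMixOp_act b), hR'.base_inv (Ext.isMixOp_act b)]
    exact h.act b hC hCa hx
  | nu C ih =>
    obtain ⟨R0, h1, h2⟩ := hR.nu_inv (Ext.isMixOp_act b)
    obtain ⟨R0', h3, h4⟩ := hR'.nu_inv (Ext.isMixOp_act b)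
    refine .nu ?_ h2 h4
    rw [Hy.up_after]
    refine ih h.weaken (by cases μ <;> exact hC) (fun v hv => ?_) (fun hm => hx (some_mem_upS.1 hm))
      h1 h3
    cases v with
    | none => simp [Hy.up]
    | some v => exact some_mem_upS.2 (hCa hv)

theorem mix_recv {a : Hy V} (ha : a.Good) {A B R R' : Ext S V} {M : Term S U} {y : V}
    (hy : y ∉ a.known) (h : Bis Ax (a.after (NLab.inp M) y) A B) {b : Bool} {C : Con S V}
    {K : Term S W} (hC : C.Fits (NLab.out K)) (hCa : C.fv ⊆ a.known)
    (hR : Mix (Ext.recv b) y A C R) (hR' : Mix (Ext.recv b) y B C R') : Bis Ax a R R' := by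
  induction C with
  | base c =>
    rw [hR.base_inv (Ext.isMixOp_recv b), hR'.base_inv (Ext.isMixOp_recv b)]
    exact h.recv ha hy b hC hCa
  | nu C ih =>
    obtain ⟨R0, h1, h2⟩ := hR.nu_inv (Ext.isMixOp_recv b)
    obtain ⟨R0', h3, h4⟩ := hR'.nu_inv (Ext.isMixOp_recv b)
    refine .nu ?_ h2 h4
    have hw := h.weaken
    rw [Hy.up_after] at hw
    refine ih (Hy.good_up.2 ha) (by simpa [Hy.up] using hy) hw hC (fun v hv => ?_) h1 h3
    cases v with
    | none => simp [Hy.up]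
    | some v => exact some_mem_upS.2 (hCa hv)

/-- After the bound output of `none`, the reception of `none` is a silent continuation of the
environment, and forgetting `none` restores the history `a`. -/
theorem mix_hide {a : Hy V} (ha : a.Good) {A B : Ext S (Option V)} {M : Term S W}
    (h : Bis Ax ((a.map some).after (NLab.out M) none) A B) {b : Bool} {D : Con S V} {K : Term S U}
    (hD : D.Fits (NLab.inp K)) (hDa : D.fv ⊆ a.known) {R1 R2 : Ext S (Option V)}
    (h1 : Mix (Ext.act b) none A ((D.map some).enter none) R1)
    (h2 : Mix (Ext.act b) none B ((D.map some).enter none) R2) {R R' : Ext S V}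
    (h3 : InsN some none a.outs.length R R1) (h4 : InsN some none a.outs.length R' R2) :
    Bis Ax a R R' := by
  have h5 : Bis Ax (((a.map some).after (NLab.out M) none).after (NLab.tau : NLab S U) none) R1 R2 :=
    h.mix_act (Con.enter_fits (Con.fits_subst.2 hD) none) (fun v hv => by
      rcases Con.fv_enter_subset _ _ hv with hv | hv
      · exact Or.inl hv
      · obtain ⟨w, hw, rfl⟩ := Con.mem_fv_map.1 hv
        exact Or.inr ⟨w, hDa hw, rfl⟩) (fun _ => rfl) h1 h2
  refine h5.hide ⟨?_, [], a.outs, [], (a.map some).outs, (a.map some).known, rfl, rfl, rfl, .nil,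
    ?_⟩ ha h3 h4
  · rintro v (hv | ⟨w, hw, hv⟩)
    · cases hv
    · cases hv; exact hw
  · simp only [Hy.map, List.forall₂_map_right_iff]
    refine List.forall₂_same.2 fun p _ => ⟨rfl, ?_⟩
    rintro v ⟨w, hw, hv⟩
    cases hv; exact hw

end Bis

/-! ### Simulation of transitions -/

theorem History.toHy_inp_var (h : History S) (x : Name) (M : Term S Name) :
    (h.inp (Term.var x)).toHy = h.toHy.after (NLab.inp M) x := by
  simp only [toHy, Hy.after, Hy.mk.injEq, and_true]
  exact Set.union_singleton

/-- Every transition of `A` can be matched by `B`. -/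
def Sim (Ax : Term S Name → Term S Name → Prop) {V : Type} (a : Hy V) (A B : Ext S V) : Prop :=
  ∀ μ x A', A.XStep Ax μ x A' → x ∉ a.known → x ∉ μ.fv →
    ∃ B', B.XStep Ax μ x B' ∧ Bis Ax (a.after μ x) A' B'

namespace Sim

variable {Ax : Term S Name → Term S Name → Prop} {V W : Type}

theorem iso {a : Hy V} {A B : Ext S V} (h : Sim Ax a A B) (e : V ≃ W) :
    Sim Ax (a.map e) (A.map e) (B.map e) := by
  intro μ x A' hs hx hμ
  have back {A : Ext S V} : (A.map e).map e.symm = A := by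
    rw [Ext.map_map]; simp only [Equiv.symm_apply_apply]; exact Ext.map_id A
  have forth {A : Ext S W} : (A.map e.symm).map e = A := by
    rw [Ext.map_map]; simp only [Equiv.apply_symm_apply]; exact Ext.map_id A
  have hμe : (μ.map e.symm).map e = μ := by
    rw [NLab.map_map]; simp only [Equiv.apply_symm_apply]; exact NLab.subst_var μ
  have h1 := hs.map e.symm.injective
  rw [back] at h1
  obtain ⟨B', h2, h3⟩ := h _ _ _ h1 (fun hm => hx ⟨_, hm, by simp⟩) (fun hm => by
    rw [NLab.map_mem_fv_map e.symm.injective] at hm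
    exact hμ hm)
  refine ⟨B'.map e, ?_, ?_⟩
  · have := h2.map e.injective
    rwa [hμe, Equiv.apply_symm_apply] at this
  · have := h3.iso e
    rwa [forth, Hy.map_after, Equiv.apply_symm_apply, Hy.after_map_label] at this

/-- The injection `f` is replaced by a bijection that agrees with it on the known variables and the
label. This makes `Sim` applicable with a bound variable outside the range of `f`, such as `none`
for `some`. -/
theorem map {a : Hy V} {A B : Ext S V} (h : Sim Ax a A B) (hA : A.WF a) (hB : B.WF a) [Infinite V]
    (e0 : V ≃ W) {f : V → W} (hf : f.Injective) {μ : NLab S V} {x : W} {A' : Ext S W}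
    (hs : (A.map f).XStep Ax (μ.map f) x A') (hx : x ∉ f '' a.known) (hμ : x ∉ (μ.map f).fv) :
    ∃ B', (B.map f).XStep Ax (μ.map f) x B' ∧ Bis Ax ((a.map f).after μ x) A' B' := by
  obtain ⟨e, he⟩ := exists_equiv_extending e0 (hA.good.finite.union μ.fv_finite) hf.injOn
  have hk : ∀ v ∈ a.known, e v = f v := fun v hv => he v (Or.inl hv)
  have := h.iso e (μ.map f) x A' (by
    rwa [Ext.map_congr fun v hv => hk v (hA.fv_subset hv)]) (by
    rwa [hA.good.map_congr hk]) hμ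
  rwa [hA.good.map_congr hk, Ext.map_congr fun v hv => hk v (hB.fv_subset hv),
    Hy.after_map_label] at this

/-- Moves of `A` are matched by `B`, moves of `Q` are transferred by static equivalence, and a
communication combines both. The results stay related by the operations built into `Bis`. -/
theorem env {a : Hy V} {A B : Ext S V} (hab : Bis Ax a A B) (h : Sim Ax a A B) (b : Bool)
    {Q : Proc S V} (hQ : Q.fv ⊆ a.known) : Sim Ax a (A.env b Q) (B.env b Q) := by
  intro μ x R hs hx hμ
  obtain ⟨hA, hB⟩ := hab.wf
  have := hab.infinite
  have himp := Ext.implies_of_static hab.static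
  have hgen := B.ev_generic
  rcases Ext.env_step hA (fun hm => hx (hQ hm)) hs with ⟨A', h1, rfl⟩ | ⟨Y, h1, h2⟩ |
    ⟨rfl, M, D, h1, h2⟩ | ⟨rfl, M, D, h1, h2⟩
  · obtain ⟨B', h3, h4⟩ := h _ _ _ h1 hx hμ
    refine ⟨_, Ext.env_step_left h3 fun hm => hx (hQ hm), .env b h4 fun v hv => ?_⟩
    cases μ with
    | tau => exact hQ hv
    | _ => exact Or.inr (hQ hv)
  · obtain ⟨R', h3, h4⟩ := Ext.env_step_act b (h1.transfer himp hgen (.refl _)) x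
    exact ⟨R', h3, hab.mix_act (Con.fits_label.1 h1.fits) (h1.fv_subset.trans hQ)
      (fun hm => (hx hm).elim) h2 h4⟩
  -- Communication from `A` to `Q`: the message is output as `none`, which is new for `V` and is
  -- hidden at the end.
  · obtain ⟨A', R1, h3, h4, h5⟩ := h2 some (Option.some_injective _) none fun v => by simp
    obtain ⟨e0⟩ := exists_equiv_option V
    obtain ⟨B', h6, h7⟩ := h.map hA hB e0 (μ := .out M) (Option.some_injective _) h3 (by simp)
      (by simp [NLab.fv])
    have hD := h1.transfer himp hgen (μ := .inp M) (.refl _)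
    obtain ⟨R', R2, h8, h9, h10⟩ := Ext.env_step_out b (Option.some_injective _)
      (fun v => by simp) h6 hD x
    rw [hA.len_eq] at h4
    rw [hB.len_eq] at h9
    exact ⟨R', h8, h7.mix_hide hA.good h1.fits (h1.fv_subset.trans hQ) h5 h10 h4 h9⟩
  -- Communication from `Q` to `A`: late input lets `B` match the input before the message is
  -- substituted for `y`.
  · obtain ⟨y, hy⟩ := (hA.good.finite.union M.fv_finite).exists_notMem
    rw [Set.mem_union, not_or] at hy
    obtain ⟨A', h3, h4⟩ := h2 y hy.1
    obtain ⟨B', h5, h6⟩ := h _ _ _ h3 hy.1 hy.2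
    have hD := h1.transfer himp hgen (μ := .out M) (.refl _)
    obtain ⟨R', h7, h8⟩ := Ext.env_step_inp b hB hy.1 h5 hD x
    exact ⟨R', h7, h6.mix_recv hA.good hy.1 h1.fits (h1.fv_subset.trans hQ) h4 h8⟩

theorem xstep_base_nil {P : Proc S V} {μ : NLab S V} {x : V} {R : Ext S V} :
    (Ext.base [] P).XStep Ax μ x R ↔ ∃ C, RStep Ax Term.var P μ C ∧ R = C.toExt [] x := by
  simp only [Ext.XStep, Frame.app_nil, NLab.subst_var]

theorem out {a : Hy V} (ha : a.outs = []) {M N : Term S V} {P Q : Proc S V} (hN : N.fv ⊆ a.known)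
    (h : Bis Ax a (Ext.base [] P) (Ext.base [] Q)) :
    Sim Ax a (Ext.base [] (Proc.out M N P)) (Ext.base [] (Proc.out M N Q)) := by
  intro μ x R hs hx hμ
  obtain ⟨C, hC, rfl⟩ := xstep_base_nil.1 hs
  cases hC with
  | out he =>
    refine ⟨_, xstep_base_nil.2 ⟨_, .out he, rfl⟩, h.recipe (M := N) (i := 0)
      ⟨Set.subset_insert _ _, hx, [], [], [], [], a.known, ha, by rw [Hy.after, ha]; rfl, rfl, .nil,
        .nil, hN⟩ (h.wf.1.good.after _ hx) ?_ ?_⟩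
    · have := InsE.base (x := x) (M := N) (θ := []) (θ' := []) (P := P) (by simp [Frame.dom])
      simp only [List.nil_append, Frame.app_nil, Term.subst_var] at this
      exact this
    · have := InsE.base (x := x) (M := N) (θ := []) (θ' := []) (P := Q) (by simp [Frame.dom])
      simp only [List.nil_append, Frame.app_nil, Term.subst_var] at this
      exact this

theorem inp {a : Hy V} (ha : a.outs = []) {M : Term S V} {P Q : Proc S (Option V)}
    (h : Bis Ax a.up (Ext.base [] P) (Ext.base [] Q)) :
    Sim Ax a (Ext.base [] (Proc.inp M P)) (Ext.base [] (Proc.inp M Q)) := by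
  intro μ x R hs hx hμ
  obtain ⟨C, hC, rfl⟩ := xstep_base_nil.1 hs
  cases hC with
  | inp he => exact ⟨_, xstep_base_nil.2 ⟨_, .inp he, rfl⟩, h.enter ha hx _⟩

theorem mat {a : Hy V} {M N : Term S V} {P Q : Proc S V}
    (h : Sim Ax a (Ext.base [] P) (Ext.base [] Q)) :
    Sim Ax a (Ext.base [] (Proc.mat M N P)) (Ext.base [] (Proc.mat M N Q)) := by
  intro μ x R hs hx hμ
  obtain ⟨C, hC, rfl⟩ := xstep_base_nil.1 hs
  cases hC with
  | mat he hC =>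
    obtain ⟨B', h1, h2⟩ := h _ _ _ (xstep_base_nil.2 ⟨_, hC, rfl⟩) hx hμ
    obtain ⟨D, hD, rfl⟩ := xstep_base_nil.1 h1
    exact ⟨_, xstep_base_nil.2 ⟨_, .mat he hD, rfl⟩, h2⟩

theorem res {a : Hy V} {P Q : Proc S (Option V)}
    (h : Sim Ax a.up (Ext.base [] P) (Ext.base [] Q)) :
    Sim Ax a (Ext.base [] (Proc.nu P)) (Ext.base [] (Proc.nu Q)) := by
  intro μ x R hs hx hμ
  obtain ⟨C, hC, rfl⟩ := xstep_base_nil.1 hs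
  cases hC with
  | res hC =>
    rw [lift_var] at hC
    obtain ⟨B', h1, h2⟩ := h _ (some x) _ (xstep_base_nil.2 ⟨_, hC, rfl⟩)
      (by simpa [Hy.up] using hx) (by rwa [NLab.map_mem_fv_map (Option.some_injective _)])
    obtain ⟨D, hD, rfl⟩ := xstep_base_nil.1 h1
    rw [Hy.after_map_label, ← Hy.up_after] at h2
    exact ⟨_, xstep_base_nil.2 ⟨_, .res (by rwa [lift_var]), rfl⟩, .nu h2 .here .here⟩

theorem sum {a : Hy V} {P Q P' Q' : Proc S V} (h : Sim Ax a (Ext.base [] P) (Ext.base [] Q))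
    (h' : Sim Ax a (Ext.base [] P') (Ext.base [] Q')) :
    Sim Ax a (Ext.base [] (Proc.sum P P')) (Ext.base [] (Proc.sum Q Q')) := by
  intro μ x R hs hx hμ
  obtain ⟨C, hC, rfl⟩ := xstep_base_nil.1 hs
  cases hC with
  | sumL hC =>
    obtain ⟨B', h1, h2⟩ := h _ _ _ (xstep_base_nil.2 ⟨_, hC, rfl⟩) hx hμ
    obtain ⟨D, hD, rfl⟩ := xstep_base_nil.1 h1
    exact ⟨_, xstep_base_nil.2 ⟨_, .sumL hD, rfl⟩, h2⟩
  | sumR hC =>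
    obtain ⟨B', h1, h2⟩ := h' _ _ _ (xstep_base_nil.2 ⟨_, hC, rfl⟩) hx hμ
    obtain ⟨D, hD, rfl⟩ := xstep_base_nil.1 h1
    exact ⟨_, xstep_base_nil.2 ⟨_, .sumR hD, rfl⟩, h2⟩

/-- One component is replaced at a time. First `C` becomes `D` next to the environment `!P`, then
`!P` becomes `!Q` next to the environment continuation `D`. -/
theorem par_rep {a : Hy V} {P Q : Proc S V}
    (h : Bis Ax a (Ext.base [] (Proc.rep P)) (Ext.base [] (Proc.rep Q))) {C D : Con S V}
    {μ : NLab S W} {x : V} (hCD : Bis Ax (a.after μ x) (C.toExt [] x) (D.toExt [] x))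
    (hD : D.Fits μ) (hDa : D.fv ⊆ a.known) (hP : P.fv ⊆ a.known) (hx : x ∉ a.known) :
    Bis Ax (a.after μ x) ((C.par true (Proc.rep P)).toExt [] x)
      ((D.par true (Proc.rep Q)).toExt [] x) := by
  have h1 := hCD.env true (Q := Proc.rep P) (by
    cases μ with
    | tau => exact hP
    | _ => exact hP.trans (Set.subset_insert _ _))
  have hxP : x ∉ (Proc.rep P).fv := fun hm => hx (hP hm)
  rw [Con.toExt_env _ _ _ hxP, Con.toExt_env _ _ _ hxP, Frame.app_nil, Proc.subst_var] at h1
  have h2 := Ext.mix_act false x [] (Proc.rep P) D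
  have h3 := Ext.mix_act false x [] (Proc.rep Q) D
  rw [Frame.app_nil, Con.subst_var] at h2 h3
  exact h1.trans (h.mix_act hD hDa (fun hm => (hx hm).elim) h2 h3)

theorem rep {a : Hy V} (ha : a.outs = []) {P Q : Proc S V}
    (hPQ : Bis Ax a (Ext.base [] P) (Ext.base [] Q))
    (h : Sim Ax a (Ext.base [] P) (Ext.base [] Q)) :
    Sim Ax a (Ext.base [] (Proc.rep P)) (Ext.base [] (Proc.rep Q)) := by
  intro μ x R hs hx hμ
  have hV := hPQ.infinite
  obtain ⟨hA, hB⟩ := hPQ.wf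
  have hfin := hA.good.finite
  have hP := ((Ext.wf_base_nil ha).1 hA).2
  have hQ := ((Ext.wf_base_nil ha).1 hB).2
  obtain ⟨E, hE, rfl⟩ := xstep_base_nil.1 hs
  cases hE with
  | rep hC =>
    obtain ⟨B', h1, h2⟩ := h _ _ _ (xstep_base_nil.2 ⟨_, hC, rfl⟩) hx hμ
    obtain ⟨D, hD, rfl⟩ := xstep_base_nil.1 h1
    exact ⟨_, xstep_base_nil.2 ⟨_, .rep hD, rfl⟩,
      par_rep (.rep ha hPQ) h2 hD.fits (hD.fv_subset.trans hQ) hP hx⟩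
  | @repClose _ _ _ _ M M' C1 C2 hC1 hC2 he =>
    replace hC2 := hC2.relabel (.inp he.symm)
    have hy : ∀ v : V, some v ≠ none := fun v => by simp
    obtain ⟨e0⟩ := exists_equiv_option V
    have hC1' : ((Ext.base [] P).map some).XStep Ax ((NLab.out M).map some) none
        ((C1.map some).toExt [] none) := by
      refine xstep_base_nil.2 ⟨_, ?_, rfl⟩
      exact (hC1.inst fun v => Term.var (some v)).to_subst rfl
    obtain ⟨B', h1, h2⟩ := h.map hA hB e0 (Option.some_injective _) hC1' (by simp)
      (by simp [NLab.fv])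
    obtain ⟨D1', hD1', rfl⟩ := xstep_base_nil.1 h1
    obtain ⟨D1, hD1, rfl⟩ := hD1'.of_subst
    replace hD1 : RStep Ax (fun x => (Term.var x : Term S V).map some) Q
      ((NLab.out M).map some) D1 := hD1
    replace hD1 := hD1.of_map (Option.some_injective _)
    obtain ⟨y, hyk⟩ := (hfin.union M.fv_finite).exists_notMem
    rw [Set.mem_union, not_or] at hyk
    obtain ⟨B', h3, h4⟩ := h _ _ _ (xstep_base_nil.2 ⟨_, hC2, rfl⟩) hyk.1 hyk.2
    obtain ⟨D2, hD2, rfl⟩ := xstep_base_nil.1 h3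
    obtain ⟨R1, h5, h6⟩ := Con.sync_out true (θ := []) hC1.fits hC2.fits x
      (Option.some_injective _) hy
    obtain ⟨R2, h7, h8⟩ := Con.sync_out true (θ := []) hD1.fits hC2.fits x
      (Option.some_injective _) hy
    rw [Frame.app_nil, Con.subst_var] at h5 h7
    -- The sender is replaced while the receiving copy of `P` acts as the environment.
    have h9 : Bis Ax a ((C1.close true C2).toExt [] x) ((D1.close true C2).toExt [] x) :=
      h2.mix_hide hA.good hC2.fits (hC2.fv_subset.trans hP) h6 h8 (by rwa [ha]) (by rwa [ha])
    have h10 := Ext.sync_in_of_wf false hA hC2.fits hD1.fits hC2.fv_subset hyk.1 x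
    have h11 := Ext.sync_in_of_wf false hB hD2.fits hD1.fits hD2.fv_subset hyk.1 x
    rw [Frame.app_nil, Con.subst_var] at h10 h11
    -- Now the receiver is replaced, with the sending copy of `Q` as the environment.
    have h12 := h4.mix_recv hA.good hyk.1 hD1.fits (hD1.fv_subset.trans hQ) h10 h11
    refine ⟨_, xstep_base_nil.2 ⟨_, .repClose hD1 hD2 (.refl _), rfl⟩,
      par_rep (.rep ha hPQ) (μ := .tau) (h9.trans h12) Con.fits_close ?_ hP hx⟩
    intro v hv
    rcases Con.fv_close_subset hv with hv | hv
    · exact hQ (hD1.fv_subset hv)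
    · exact hQ (hD2.fv_subset hv)

end Sim

namespace Bis

variable {Ax : Term S Name → Term S Name → Prop} {V W : Type}

theorem sim {a : Hy V} {A B : Ext S V} (h : Bis Ax a A B) : Sim Ax a A B := by
  induction h with
  | @bisim R h a A B hR hAB ha hA hB =>
    intro μ x A' hs hx hμ
    have hxA : x ∉ A.fv := fun hm => hx (hA.fv_subset hm)
    have hxB : x ∉ B.fv := fun hm => hx (hB.fv_subset hm)
    have hxh : x ∉ h.fv := fun hm => hx (ha.1 (h.toHy_known ▸ hm))
    have hx3 : x ∉ A.fv ∪ B.fv ∪ h.fv := by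
      rintro ((hm | hm) | hm)
      exacts [hxA hm, hxB hm, hxh hm]
    have hV : Infinite Name := inferInstanceAs (Infinite ℕ)
    have hs' := hs.to_estep hxA hμ
    have hA' := hA.step hs hx
    cases μ with
    | tau =>
      obtain ⟨B', h1, h2⟩ := hR.tau hAB A' hs'
      have h3 := (h1.to_xstep (x := x) trivial).1
      exact ⟨B', h3, .bisim hR h2 ha hA' (hB.step h3 hx)⟩
    | out M =>
      obtain ⟨B', h1, h2⟩ := hR.out hAB M x A' hx3 hs'
      have h3 := (h1.to_xstep (x := x) rfl).1
      refine ⟨B', h3, .bisim hR h2 ?_ hA' (hB.step h3 hx)⟩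
      exact Hy.after_le ha (NLab.out M) x
    | inp M =>
      obtain ⟨B', h1, h2⟩ := hR.inp hAB M x A' hx3 hs'
      have h3 := (h1.to_xstep (x := x) rfl).1
      refine ⟨B', h3, .bisim hR h2 ?_ hA' (hB.step h3 hx)⟩
      rw [h.toHy_inp_var x M]
      exact Hy.after_le ha (NLab.inp M) x
  | refl hV hA => exact fun μ x A' hs hx _ => ⟨A', hs, .refl hV (hA.step hs hx)⟩
  | trans h1 h2 ih1 ih2 =>
    intro μ x A' hs hx hμ
    obtain ⟨B', h3, h4⟩ := ih1 _ _ _ hs hx hμ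
    obtain ⟨C', h5, h6⟩ := ih2 _ _ _ h3 hx hμ
    exact ⟨C', h5, h4.trans h6⟩
  | mono h h1 h2 ih =>
    intro μ x A' hs hx hμ
    obtain ⟨B', h3, h4⟩ := ih _ _ _ hs (fun hm => hx (h1.1 hm)) hμ
    exact ⟨B', h3, h4.mono (Hy.after_le h1 μ x) (h2.after μ hx)⟩
  | iso e _ ih => exact ih.iso e
  | nu _ h1 h2 ih =>
    intro μ x A' hs hx hμ
    obtain ⟨A1, h3, h4⟩ := h1.step hs
    obtain ⟨B1, h5, h6⟩ := ih _ _ _ h3 (by simpa [Hy.up] using hx)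
      (by rwa [NLab.map_mem_fv_map (Option.some_injective _)])
    obtain ⟨B', h7, h8⟩ := h2.step_inv h5
    rw [Hy.after_map_label, ← Hy.up_after] at h6
    exact ⟨B', h7, .nu h6 h4 h8⟩
  | hide h h1 h2 h3 h4 ih =>
    have hV := infinite_of_option h.infinite
    intro μ x A' hs hx hμ
    obtain ⟨A1, h5, h6⟩ := h3.step (Option.some_injective _) (fun v => by simp) hs
    obtain ⟨B1, h7, h8⟩ := ih _ _ _ h5 (fun hm => hx (h1.1 hm))
      (by rwa [NLab.map_mem_fv_map (Option.some_injective _)])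
    obtain ⟨B', h9, h10⟩ := h4.step_inv (Option.some_injective _) (fun v => by simp) h7
    rw [Hy.after_map_label] at h8
    exact ⟨B', h9, h8.hide (h1.after (Option.some_injective _) μ x) (h2.after μ hx) h6 h10⟩
  | env b h hQ ih => exact Sim.env h ih b hQ
  | @recipe V a b x M i A B A' B' h h1 h2 h3 h4 ih =>
    intro μ y R hs hy hμ
    obtain ⟨hk, hxa, l, l', m, m', X, ha, hb, hl, hl1, hl2, hM⟩ := id h1
    have hxb : x ∈ b.known := h2.ovars_subset ⟨(x, X), by rw [hb]; simp, rfl⟩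
    -- The recipe contains only known variables and `x` is itself known, so the new bound variable
    -- differs from all of them and stays fresh for the label after `x` is replaced.
    have hyx : y ≠ x := by rintro rfl; exact hy hxb
    have hyM : y ∉ M.fv := fun hm => hy (h2.subset (x, X) (by rw [hb]; simp) (hM hm))
    obtain ⟨A1, h5, h6⟩ := h3.step_inv hyx hyM hs
    obtain ⟨B1, h7, h8⟩ := ih _ _ _ h5 (fun hm => hy (hk hm)) (by
      rw [NLab.mem_fv_subst]
      rintro ⟨v, hv, hm⟩
      by_cases hvx : v = x
      · rw [hvx, single_self] at hm; exact hyM hm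
      · rw [single_of_ne _ hvx] at hm
        obtain rfl : y = v := hm
        exact hμ hv)
    obtain ⟨B1', h9, h10⟩ := h4.step hyx hyM h7
    rw [Hy.after_subst_label] at h8
    exact ⟨B1', h9, h8.recipe (h1.after h2 μ hy) (h2.after μ hy) h6 h10⟩
  | out ha hM hN h ih => exact Sim.out ha hN h
  | inp ha hM h ih => exact Sim.inp ha h
  | mat ha hM hN _ ih => exact ih.mat
  | res ha _ ih => exact ih.res
  | sum ha _ _ ih1 ih2 => exact ih1.sum ih2
  | rep ha h ih => exact Sim.rep ha h ih

/-- The closure of open bisimilarity is an open bisimulation. -/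
theorem isOpenBisim : IsOpenBisim Ax fun (h : History S) A B => Bis Ax h.toHy A B where
  normal h := ⟨h.wf.1.normal, h.wf.2.normal⟩
  symm h := h.symm
  static h := h.static
  subst {h _ _} hAB σ hσ := by
    rw [History.toHy_subst hσ]
    exact hAB.subst (History.respects_toHy.2 hσ)
  tau {h A B} hAB A' hs := by
    have hV : Infinite Name := inferInstanceAs (Infinite ℕ)
    obtain ⟨x, hx⟩ := hAB.wf.1.good.finite.exists_notMem
    obtain ⟨B', h1, h2⟩ := hAB.sim _ _ _ (hs.to_xstep (x := x) trivial).1 hx (by simp [NLab.fv, Label.strip])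
    exact ⟨B', h1.to_estep (fun hm => hx (hAB.wf.2.fv_subset hm)) (by simp [NLab.fv, Label.strip]), h2⟩
  out {h A B} hAB M x A' hx hs := by
    have hV : Infinite Name := inferInstanceAs (Infinite ℕ)
    obtain ⟨h1, h2⟩ := hs.to_xstep (x := x) rfl
    have hx' : x ∉ h.toHy.known := fun hm => hx (Or.inr (h.toHy_known ▸ hm))
    obtain ⟨B', h3, h4⟩ := hAB.sim _ _ _ h1 hx' (h2 rfl)
    exact ⟨B', h3.to_estep (fun hm => hx (Or.inl (Or.inr hm))) (h2 rfl), h4⟩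
  inp {h A B} hAB M x A' hx hs := by
    have hV : Infinite Name := inferInstanceAs (Infinite ℕ)
    obtain ⟨h1, h2⟩ := hs.to_xstep (x := x) rfl
    have hx' : x ∉ h.toHy.known := fun hm => hx (Or.inr (h.toHy_known ▸ hm))
    obtain ⟨B', h3, h4⟩ := hAB.sim _ _ _ h1 hx' (h2 rfl)
    refine ⟨B', h3.to_estep (fun hm => hx (Or.inl (Or.inr hm))) (h2 rfl), ?_⟩
    rw [h.toHy_inp_var x M]
    exact h4

end Bis

/-! ### Congruence -/

section Congruence

variable {Ax : Term S Name → Term S Name → Prop}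

theorem History.toHy_ofInputs (xs : List Name) :
    (History.ofInputs xs : History S).toHy = ⟨{x | x ∈ xs}, []⟩ := by
  have : ∀ h : History S, (xs.foldl (fun h x => inp h (Term.var x)) h).toHy =
      ⟨h.toHy.known ∪ {x | x ∈ xs}, h.toHy.outs⟩ := by
    induction xs with
    | nil => intro h; simp
    | cons x xs ih =>
      intro h
      rw [List.foldl_cons, ih]
      simp only [toHy, Hy.mk.injEq, and_true]
      ext y
      simp [Term.fv, or_assoc, or_left_comm]
  rw [ofInputs, this]
  simp [toHy]

/-- A history of inputs has no outputs, so only its set of variables matters, and any finite set can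
be listed. One direction embeds a given bisimulation in `Bis`; the other uses that `Bis` is a
bisimulation. -/
theorem openBisimilar_iff {P Q : Proc S Name} : OpenBisimilar Ax P Q ↔
    ∃ F : Set Name, F.Finite ∧ Bis Ax ⟨F, []⟩ (Ext.base [] P) (Ext.base [] Q) := by
  constructor
  · rintro ⟨R, hR, xs, hxs, h⟩
    have hF : {x | x ∈ xs}.Finite := xs.finite_toSet
    refine ⟨_, hF, .bisim hR h ?_ ((Ext.wf_base_nil rfl).2 ⟨hF, fun x hx => hxs (Or.inl hx)⟩)
      ((Ext.wf_base_nil rfl).2 ⟨hF, fun x hx => hxs (Or.inr hx)⟩)⟩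
    rw [History.toHy_ofInputs]
    exact Hy.le_refl _
  · rintro ⟨F, hF, h⟩
    have he : {x | x ∈ hF.toFinset.toList} = F := by ext; simp
    refine ⟨_, Bis.isOpenBisim, hF.toFinset.toList, ?_, ?_⟩
    · rw [he]
      exact Set.union_subset ((Ext.wf_base_nil rfl).1 h.wf.1).2 ((Ext.wf_base_nil rfl).1 h.wf.2).2
    · rw [History.toHy_ofInputs, he]
      exact h

theorem Bis.mono_known {F G : Set Name} {A B : Ext S Name} (h : Bis Ax ⟨F, []⟩ A B) (hFG : F ⊆ G)
    (hG : G.Finite) : Bis Ax ⟨G, []⟩ A B :=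
  h.mono ⟨hFG, .nil⟩ hG

theorem Bis.refl_base {F : Set Name} (hF : F.Finite) {P : Proc S Name} (hP : P.fv ⊆ F) :
    Bis Ax ⟨F, []⟩ (Ext.base [] P) (Ext.base [] P) :=
  .refl (inferInstanceAs (Infinite ℕ)) ((Ext.wf_base_nil rfl).2 ⟨hF, hP⟩)

theorem openBisimilar_equivalence : Equivalence (OpenBisimilar (S := S) Ax) where
  refl P := openBisimilar_iff.2 ⟨P.fv, P.fv_finite, .refl_base P.fv_finite subset_rfl⟩
  symm h := by
    obtain ⟨F, hF, h⟩ := openBisimilar_iff.1 h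
    exact openBisimilar_iff.2 ⟨F, hF, h.symm⟩
  trans h h' := by
    obtain ⟨F, hF, h⟩ := openBisimilar_iff.1 h
    obtain ⟨G, hG, h'⟩ := openBisimilar_iff.1 h'
    exact openBisimilar_iff.2 ⟨F ∪ G, hF.union hG, (h.mono_known Set.subset_union_left
      (hF.union hG)).trans (h'.mono_known Set.subset_union_right (hF.union hG))⟩

theorem bindName_injective (x : Name) : (bindName x).Injective := by
  intro y z h
  unfold bindName at h
  split_ifs at h with h1 h2 h2
  · rw [h1, h2]
  · exact Option.some.inj h

/-- A capturing binder turns the variable `x` into the bound one. This is an injective renaming, and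
the bound variable counts as known. -/
theorem Bis.bind {F G : Set Name} {P Q : Proc S Name} (h : Bis Ax ⟨F, []⟩ (Ext.base [] P)
    (Ext.base [] Q)) (hFG : F ⊆ G) (hG : G.Finite) (x : Name) :
    Bis Ax (Hy.up ⟨G, []⟩) (Ext.base [] (P.map (bindName x))) (Ext.base [] (Q.map (bindName x))) := by
  have := h.infinite
  obtain ⟨e0⟩ := exists_equiv_option Name
  refine (h.map_injOn e0 (bindName_injective x).injOn).mono ⟨?_, .nil⟩ (Hy.good_up.2 hG)
  rintro _ ⟨y, hy, rfl⟩
  unfold bindName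
  split_ifs
  · exact none_mem_upS
  · exact some_mem_upS.2 (hFG hy)

theorem Bis.fill {F : Set Name} (hF : F.Finite) {P Q : Proc S Name}
    (h : Bis Ax ⟨F, []⟩ (Ext.base [] P) (Ext.base [] Q)) (C : Ctx S) :
    ∃ G : Set Name, G.Finite ∧ Bis Ax ⟨G, []⟩ (Ext.base [] (C.fill P)) (Ext.base [] (C.fill Q)) := by
  induction C with
  | hole => exact ⟨F, hF, h⟩
  | out M N C ih =>
    obtain ⟨G, hG, h⟩ := ih
    have hK := (hG.union M.fv_finite).union N.fv_finite
    exact ⟨_, hK, .out rfl (fun x hx => Or.inl (Or.inr hx)) (fun x hx => Or.inr hx)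
      (h.mono_known (fun x hx => Or.inl (Or.inl hx)) hK)⟩
  | inp M x C ih =>
    obtain ⟨G, hG, h⟩ := ih
    have hK := hG.union M.fv_finite
    exact ⟨_, hK, .inp rfl (fun x hx => Or.inr hx) (h.bind (fun x hx => Or.inl hx) hK x)⟩
  | mat M N C ih =>
    obtain ⟨G, hG, h⟩ := ih
    have hK := (hG.union M.fv_finite).union N.fv_finite
    exact ⟨_, hK, .mat rfl (fun x hx => Or.inl (Or.inr hx)) (fun x hx => Or.inr hx)
      (h.mono_known (fun x hx => Or.inl (Or.inl hx)) hK)⟩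
  | nu x C ih =>
    obtain ⟨G, hG, h⟩ := ih
    exact ⟨G, hG, .res rfl (h.bind subset_rfl hG x)⟩
  | parL C R ih =>
    obtain ⟨G, hG, h⟩ := ih
    have hK := hG.union R.fv_finite
    -- With an empty active substitution, the environment composition is plain parallel composition.
    have := (h.mono_known Set.subset_union_left hK).env true (Q := R) fun x hx => Or.inr hx
    rw [Ext.env, Ext.env, Frame.app_nil, Proc.subst_var] at this
    exact ⟨_, hK, this⟩
  | parR R C ih =>
    obtain ⟨G, hG, h⟩ := ih
    have hK := hG.union R.fv_finite
    have := (h.mono_known Set.subset_union_left hK).env false (Q := R) fun x hx => Or.inr hx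
    rw [Ext.env, Ext.env, Frame.app_nil, Proc.subst_var] at this
    exact ⟨_, hK, this⟩
  | sumL C R ih =>
    obtain ⟨G, hG, h⟩ := ih
    have hK := hG.union R.fv_finite
    exact ⟨_, hK, .sum rfl (h.mono_known Set.subset_union_left hK)
      (.refl_base hK fun x hx => Or.inr hx)⟩
  | sumR R C ih =>
    obtain ⟨G, hG, h⟩ := ih
    have hK := hG.union R.fv_finite
    exact ⟨_, hK, .sum rfl (.refl_base hK fun x hx => Or.inr hx)
      (h.mono_known Set.subset_union_left hK)⟩
  | rep C ih =>
    obtain ⟨G, hG, h⟩ := ih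
    exact ⟨G, hG, .rep rfl h⟩

end Congruence

end AppliedPi

theorem mainTheorem6 (S : AppliedPi.Signature)
    (Ax : AppliedPi.Term S AppliedPi.Name → AppliedPi.Term S AppliedPi.Name → Prop) :
    Equivalence (AppliedPi.OpenBisimilar Ax) ∧
      ∀ P Q : AppliedPi.Proc S AppliedPi.Name, AppliedPi.OpenBisimilar Ax P Q →
        ∀ C : AppliedPi.Ctx S, AppliedPi.OpenBisimilar Ax (C.fill P) (C.fill Q) := by
  refine ⟨AppliedPi.openBisimilar_equivalence, fun P Q h C => ?_⟩
  obtain ⟨F, hF, h⟩ := AppliedPi.openBisimilar_iff.1 h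
  exact AppliedPi.openBisimilar_iff.2 (h.fill hF C)
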